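/- **Setting.** "Probabilistic polynomial time" (PPT) means: computed by (non-uniform) randomized Boolean programs, that is, randomized Boolean circuits which may also contain loops "repeat with fresh coins until success", whose expected number of steps on every input is bounded by a polynomial in the security parameter $k$. For an ideal-model simulator, which receives the answer of a trusted party in the middle of its computation, the expected total number of steps has to be polynomially bounded for every auxiliary input and every list of items. Two families of distributions are computationally indistinguishable if every PPT distinguisher has negligible advantage. A symmetric encryption scheme $(\mathrm{Gen},E,D)$ with key, message and ciphertext lengths polynomial in $k$ is secure if its algorithms are PPT, $D_K(E_K(m))=m$ always, and for any two sequences of messages $m,m'$ the distributions of $E_K(m)$ and $E_K(m')$, for a random key $K$, are computationally indistinguishable. Let $n$ items $m_1,\dots,m_n$ (bit strings of a common length) have fixed integer weights $p_1,\dots,p_n$. A two-party protocol with polynomially many rounds and PPT parties, in which the sender holds the items and the receiver holds a choice set $\sigma\subseteq\{1,\dots,n\}$, is a *weighted oblivious transfer* with weights $p$ if the following hold. * *Correctness.* If both parties are honest, then the receiver obtains $m_i$ for all $i\in\sigma$, and the sender learns $\sum_{i\in\sigma}p_i$. * *Receiver's privacy.* For every PPT sender (honest or malicious) and all choice sets $\sigma,\tau$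 with $\sum_{i\in\sigma}p_i=\sum_{i\in\tau}p_i$, the sender's views for $\sigma$ and for $\tau$ are computationally indistinguishable. The receiver's choice is *unconditionally secure* if these views are identically distributed for every sender, however powerful. * *Sender's privacy (compared with the ideal model).* In the ideal model a trusted party holds the items; the receiver submits one set $\sigma$ and one payment $P\le\sum_i p_i$; the trusted party returns the items in $\sigma$ if $\sum_{i\in\sigma}p_i\le P$ and nothing otherwise, and reports $P$ to the sender. For every malicious PPT receiver $R$ there is a PPT simulator $R'$ in the ideal model such that, for all items and all auxiliary inputs of $R$, the pair (price learned by the sender, output of $R$) in a real execution with the honest sender and the pair ($P$, output of $R'$) in the ideal model are computationally indistinguishable. A protocol for $t$-out-of-$N$ oblivious transfer, where the sender learns $t$ and nothing else about the receiver's choice, is the special case of $N$ items which all have weight $1$; it is called secure if it satisfies this definition. **The protocol.** Let $p_1,\dots,p_n\ge 1$. The sender samples independent keys $K_1,\dots,K_n$, sends the ciphertexts $E_{K_1}(m_1),\dots,E_{K_n}(m_n)$, and divides each $K_i$ into random parts $K_{i1},\dots,K_{ip_i}$ with $\bigoplus_j K_{ij}=K_i$. The parties then run an oblivious transfer on the $\sum_i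 p_i$ parts, in which the receiver chooses the $\sum_{i\in\sigma}p_i$ parts of the keys $K_i$, $i\in\sigma$. The receiver recovers these keys by XOR and decrypts the chosen items. **Theorem.** If the symmetric encryption scheme and the underlying oblivious transfer are secure, then the protocol is a weighted oblivious transfer with weights $p_1,\dots,p_n$: it is efficient and satisfies correctness, receiver's privacy and sender's privacy against malicious receivers. Moreover: * a semi-honest PPT receiver with choice set $\sigma$ (one that follows the protocol but may keep records of its coins and messages) learns nothing about the other items: if $m_i=m'_i$ for all $i\in\sigma$, then its views for $(m_1,\dots,m_n)$ and for $(m'_1,\dots,m'_n)$ are computationally indistinguishable; * if the receiver's choice is unconditionally secure in the underlying oblivious transfer, then it is unconditionally secure in the protocol. -/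

import Mathlib

open scoped ENNReal

noncomputable section

namespace WOT

/-! ## Bit strings and randomized maps -/

/-- Bit strings whose positions ("wires") are the elements of `α`. -/
abbrev Bits (α : Type) : Type := α → Bool

/-- Concatenation of two bit strings. -/
def pair {α β : Type} (x : Bits α) (y : Bits β) : Bits (α ⊕ β) := Sum.elim x y

/-- The first part of a concatenation. -/
def fstBits {α β : Type} (x : Bits (α ⊕ β)) : Bits α := fun a => x (Sum.inl a)

/-- The second part of a concatenation. -/
def sndBits {α β : Type} (x : Bits (α ⊕ β)) : Bits β := fun b => x (Sum.inr b)

/-- Randomized maps from bit strings to bit strings. -/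
abbrev Kernel (α β : Type) : Type := Bits α → PMF (Bits β)

/-- The number of ones of a bit string. -/
def ones {α : Type} [Fintype α] (x : Bits α) : ℕ := ∑ a, if x a then 1 else 0

/-- The number `a` written in unary with `N` digits. -/
def unary (N a : ℕ) : Bits (Fin N) := fun j => decide ((j : ℕ) < a)

theorem tsum_prod_fin : ∀ (n : ℕ) (β : Fin n → Type) (μ : ∀ i, PMF (β i)),
    ∑' y : ∀ i, β i, ∏ i, μ i (y i) = 1
  | 0, β, μ => by simp
  | n + 1, β, μ => by
    rw [← (Fin.consEquiv β).tsum_eq, ENNReal.tsum_prod']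
    simp only [Fin.prod_univ_succ, Fin.consEquiv_apply, Fin.cons_zero, Fin.cons_succ,
      ENNReal.tsum_mul_left]
    simp only [tsum_prod_fin n (fun i => β i.succ) (fun i => μ i.succ), mul_one]
    exact (μ 0).tsum_coe

theorem tsum_prod {ι : Type} [Fintype ι] {β : ι → Type} (μ : ∀ i, PMF (β i)) :
    ∑' y : ∀ i, β i, ∏ i, μ i (y i) = 1 := by
  let e := (Fintype.equivFin ι).symm
  rw [← (Equiv.piCongrLeft β e).tsum_eq, ← tsum_prod_fin _ (fun j => β (e j)) (fun j => μ (e j))]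
  refine tsum_congr fun y => ?_
  rw [← Equiv.prod_comp e]
  exact Finset.prod_congr rfl fun j _ => by rw [Equiv.piCongrLeft_apply_apply]

/-- Independent sampling: the product of a finite family of distributions. -/
def piPMF {ι : Type} [Fintype ι] {β : ι → Type} (μ : ∀ i, PMF (β i)) : PMF (∀ i, β i) :=
  ⟨fun y => ∏ i, μ i (y i), by
    have h := ENNReal.summable (f := fun y : ∀ i, β i => ∏ i, μ i (y i))
    exact tsum_prod μ ▸ h.hasSum⟩

/-! ## Probabilistic polynomial time -/

/-- Randomized Boolean programs: circuits with random gates, sequential and parallel composition,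
and loops that repeat a subprogram with fresh coins until it raises its flag. -/
inductive Prog : Type → Type → Type 1
  /-- Every output wire copies an input wire or carries a constant. -/
  | rewire {α β : Type} (f : β → α ⊕ Bool) : Prog α β
  /-- One NAND gate for every output wire. -/
  | nand {α β : Type} [Fintype β] (f g : β → α) : Prog α β
  /-- One fresh random bit for every output wire. -/
  | flips {α β : Type} [Fintype β] : Prog α β
  /-- Sequential composition. -/
  | seq {α β γ : Type} (c : Prog α β) (d : Prog β γ) : Prog α γ
  /-- Independent subprograms on disjoint wires. -/
  | par {ι : Type} [Fintype ι] {α β : ι → Type} (c : ∀ i, Prog (α i) (β i)) :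
      Prog (Σ i, α i) (Σ i, β i)
  /-- Repeat `c` on the same input, with fresh coins, until the flag `none` is raised. -/
  | loop {α β : Type} (c : Prog α (Option β)) : Prog α β

open scoped Classical in
/-- `repeatUntil μ` is the result of sampling from `μ` until the flag `none` is raised
(the all-zero string if this never happens). -/
def repeatUntil {β : Type} (μ : PMF (Bits (Option β))) : PMF (Bits β) :=
  if h : ∃ y ∈ {y : Bits (Option β) | y none = true}, y ∈ μ.support then
    (μ.filter _ h).map fun y b => y (some b)
  else PMF.pure fun _ => false

/-- The probability that the flag `none` is raised in a sample from `μ`. -/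
def flagProb {β : Type} (μ : PMF (Bits (Option β))) : ℝ≥0∞ :=
  ∑' y, if y none = true then μ y else 0

/-- The output distribution of a program. -/
def Prog.run : {α β : Type} → Prog α β → Kernel α β
  | _, _, .rewire f => fun x => PMF.pure fun b => Sum.elim x id (f b)
  | _, _, @Prog.nand _ _ _ f g => fun x => PMF.pure fun b => !(x (f b) && x (g b))
  | _, _, @Prog.flips _ _ _ => fun _ => piPMF fun _ => PMF.uniformOfFintype Bool
  | _, _, .seq c d => fun x => (c.run x).bind d.run
  | _, _, @Prog.par _ _ _ _ c => fun x =>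
      (piPMF fun i => (c i).run fun a => x ⟨i, a⟩).map fun y s => y s.1 s.2
  | _, _, .loop c => fun x => repeatUntil (c.run x)

/-- The expected number of steps of a program on a given input: gates, random bits and loop
iterations count. A loop whose body has expected cost `t` and success probability `q` takes `1 / q`
iterations on average. -/
def Prog.cost : {α β : Type} → Prog α β → Bits α → ℝ≥0∞
  | _, _, .rewire _ => fun _ => 0
  | _, β, @Prog.nand _ _ _ _ _ => fun _ => (Nat.card β : ℝ≥0∞)
  | _, β, @Prog.flips _ _ _ => fun _ => (Nat.card β : ℝ≥0∞)
  | _, _, .seq c d => fun x => c.cost x + ∑' y, c.run x y * d.cost y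
  | _, _, @Prog.par _ _ _ _ c => fun x => ∑ i, (c i).cost fun a => x ⟨i, a⟩
  | _, _, .loop c => fun x => (1 + c.cost x) / flagProb (c.run x)

/-- A bound on expected costs that is polynomial in the security parameter `k`. -/
def PolyBounded {X : ℕ → Type} (c : ∀ k, X k → ℝ≥0∞) : Prop :=
  ∃ q : Polynomial ℕ, ∀ k x, c k x ≤ ((q.eval k : ℕ) : ℝ≥0∞)

/-- A family of randomized maps, indexed by the security parameter, is (non-uniform) probabilistic
polynomial time: it is computed by programs whose expected cost is polynomially bounded on every
input. -/
def PPT {α β : ℕ → Type} (f : ∀ k, Kernel (α k) (β k)) : Prop :=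
  ∃ c : ∀ k, Prog (α k) (β k), (∀ k, (c k).run = f k) ∧ PolyBounded fun k => (c k).cost

/-- Negligible functions of the security parameter. -/
def Negligible (f : ℕ → ℝ) : Prop :=
  Asymptotics.SuperpolynomialDecay Filter.atTop (fun k : ℕ => (k : ℝ)) f

/-- The probability that the distinguisher `D` outputs `1` on a sample from `μ`. -/
def acceptProb {α : Type} (μ : PMF (Bits α)) (D : Kernel α Unit) : ℝ :=
  ((μ.bind D) fun _ => true).toReal

/-- Computational indistinguishability of two families of distributions. -/
def CompIndist {α : ℕ → Type} (X Y : ∀ k, PMF (Bits (α k))) : Prop :=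
  ∀ D : ∀ k, Kernel (α k) Unit, PPT D →
    Negligible fun k => |acceptProb (X k) (D k) - acceptProb (Y k) (D k)|

/-! ## Symmetric encryption -/

/-- A symmetric encryption scheme (for one value of the security parameter). -/
structure SymEnc where
  keyLen : ℕ
  msgLen : ℕ
  ctLen : ℕ
  gen : PMF (Bits (Fin keyLen))
  enc : Bits (Fin keyLen) → Bits (Fin msgLen) → PMF (Bits (Fin ctLen))
  dec : Bits (Fin keyLen) → Bits (Fin ctLen) → Bits (Fin msgLen)

/-- A secure symmetric encryption scheme: it is efficient, decryption inverts encryption, and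
encryptions of any two messages under a random key are computationally indistinguishable. -/
structure SecureEnc (E : ℕ → SymEnc) : Prop where
  lengths : ∃ q : Polynomial ℕ, ∀ k,
    (E k).keyLen ≤ q.eval k ∧ (E k).msgLen ≤ q.eval k ∧ (E k).ctLen ≤ q.eval k
  gen_ppt : PPT (α := fun _ => Empty) fun k _ => (E k).gen
  enc_ppt : PPT (α := fun k => Fin (E k).keyLen ⊕ Fin (E k).msgLen)
    fun k x => (E k).enc (fstBits x) (sndBits x)
  dec_ppt : PPT (α := fun k => Fin (E k).keyLen ⊕ Fin (E k).ctLen)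
    fun k x => PMF.pure ((E k).dec (fstBits x) (sndBits x))
  correct : ∀ k, ∀ K ∈ (E k).gen.support, ∀ m, ∀ c ∈ ((E k).enc K m).support, (E k).dec K c = m
  secure : ∀ m m' : ∀ k, Bits (Fin (E k).msgLen),
    CompIndist (fun k => (E k).gen.bind fun K => (E k).enc K (m k))
      (fun k => (E k).gen.bind fun K => (E k).enc K (m' k))

/-! ## Two-party protocols -/

section Protocols

variable {ι : Type} [Fintype ι]

/-- The total price of a set of items. -/
def price (w : ι → ℕ) (σ : Bits ι) : ℕ := ∑ i, if σ i then w i else 0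

/-- The sum of all weights. -/
def total (w : ι → ℕ) : ℕ := ∑ i, w i

/-- A two-party protocol (for one value of the security parameter) between a sender, who holds items
of `ℓ` bits with weights `w`, and a receiver, who holds a choice set. The sender moves first;
then, in every round, the receiver sends a message and the sender answers. The number of ones in
the sender's output is the price that the sender learns. -/
structure Protocol (ι : Type) [Fintype ι] (w : ι → ℕ) (ℓ : ℕ) where
  SState : Type
  RState : Type
  First : Type
  ToS : Type
  ToR : Type
  [finS : Finite SState]
  [finR : Finite RState]
  [finFirst : Finite First]
  [finToS : Finite ToS]
  [finToR : Finite ToR]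
  rounds : ℕ
  sInit : Kernel (ι × Fin ℓ) (SState ⊕ First)
  sStep : Kernel (SState ⊕ ToS) (SState ⊕ ToR)
  sOut : Kernel SState (Fin (total w))
  rInit : Kernel (ι ⊕ First) RState
  rSend : Kernel RState (RState ⊕ ToS)
  rRecv : Kernel (RState ⊕ ToR) RState
  rOut : Kernel RState (ι × Fin ℓ)

attribute [instance] Protocol.finS Protocol.finR Protocol.finFirst Protocol.finToS Protocol.finToR

/-- The joint distribution of the final states after the given number of rounds. -/
def interact {S R ToS ToR : Type} (sStep : Kernel (S ⊕ ToS) (S ⊕ ToR))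
    (rSend : Kernel R (R ⊕ ToS)) (rRecv : Kernel (R ⊕ ToR) R) :
    ℕ → Bits S → Bits R → PMF (Bits S × Bits R)
  | 0, s, r => PMF.pure (s, r)
  | n + 1, s, r =>
      (rSend r).bind fun u =>
      (sStep (pair s (sndBits u))).bind fun v =>
      (rRecv (pair (fstBits u) (sndBits v))).bind fun r' =>
      interact sStep rSend rRecv n (fstBits v) r'

variable {w : ι → ℕ} {ℓ : ℕ}

/-- An arbitrary strategy for the sender's side of `Q`; `Aux` carries an auxiliary input. -/
structure SenderStrategy (Q : Protocol ι w ℓ) (Aux : Type) where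
  State : Type
  [finState : Finite State]
  init : Kernel Aux (State ⊕ Q.First)
  step : Kernel (State ⊕ Q.ToS) (State ⊕ Q.ToR)

/-- An arbitrary strategy for the receiver's side of `Q`; its output is its final state. -/
structure ReceiverStrategy (Q : Protocol ι w ℓ) (Aux : Type) where
  State : Type
  [finState : Finite State]
  init : Kernel (Aux ⊕ Q.First) State
  send : Kernel State (State ⊕ Q.ToS)
  recv : Kernel (State ⊕ Q.ToR) State

attribute [instance] SenderStrategy.finState ReceiverStrategy.finState

/-- Outputs (price learned by the sender, items learned by the receiver) of an honest execution. -/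
def honestRun (Q : Protocol ι w ℓ) (m : Bits (ι × Fin ℓ)) (σ : Bits ι) :
    PMF (ℕ × Bits (ι × Fin ℓ)) :=
  (Q.sInit m).bind fun a =>
  (Q.rInit (pair σ (sndBits a))).bind fun r =>
  (interact Q.sStep Q.rSend Q.rRecv Q.rounds (fstBits a) r).bind fun f =>
  (Q.sOut f.1).bind fun P =>
  (Q.rOut f.2).map fun y => (ones P, y)

/-- What a sender who follows the strategy `A` sees (its final state) when the receiver is honest
and has the choice set `σ`. -/
def senderView (Q : Protocol ι w ℓ) {Aux : Type} (A : SenderStrategy Q Aux) (z : Bits Aux)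
    (σ : Bits ι) : PMF (Bits A.State) :=
  (A.init z).bind fun a =>
  (Q.rInit (pair σ (sndBits a))).bind fun r =>
  (interact A.step Q.rSend Q.rRecv Q.rounds (fstBits a) r).map fun f => f.1

/-- The price learned by the honest sender, together with the output of a receiver who follows the
strategy `A`. -/
def realRun (Q : Protocol ι w ℓ) {Aux : Type} (A : ReceiverStrategy Q Aux) (z : Bits Aux)
    (m : Bits (ι × Fin ℓ)) : PMF (Bits (Fin (total w) ⊕ A.State)) :=
  (Q.sInit m).bind fun a =>
  (A.init (pair z (sndBits a))).bind fun r =>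
  (interact Q.sStep A.send A.recv Q.rounds (fstBits a) r).bind fun f =>
  (Q.sOut f.1).map fun P => pair (unary (total w) (ones P)) f.2

/-! ### The ideal model -/

/-- The answer of the trusted party, who holds the items `m`, to a receiver who pays `P` and asks for
the items in `σ`: these items if their total price is at most `P`, and nothing otherwise. -/
def trusted (w : ι → ℕ) (m : Bits (ι × Fin ℓ)) (σ : Bits ι) (P : ℕ) : Bits (ι × Fin ℓ) :=
  fun s => decide (price w σ ≤ P) && σ s.1 && m s

/-- A receiver in the ideal model: it sends one request and one payment (the number of ones of a bit
string) to the trusted party, and computes its output from the answer. -/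
structure Simulator (w : ι → ℕ) (ℓ : ℕ) (Aux Out : Type) where
  State : Type
  [finState : Finite State]
  choose : Prog Aux (State ⊕ (ι ⊕ Fin (total w)))
  finish : Prog (State ⊕ (ι × Fin ℓ)) Out

attribute [instance] Simulator.finState

/-- What the simulator sees after the trusted party has answered. -/
def Simulator.answered {Aux Out : Type} (B : Simulator w ℓ Aux Out) (m : Bits (ι × Fin ℓ))
    (u : Bits (B.State ⊕ (ι ⊕ Fin (total w)))) : Bits (B.State ⊕ (ι × Fin ℓ)) :=
  pair (fstBits u) (trusted w m (fstBits (sndBits u)) (ones (sndBits (sndBits u))))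

/-- The price that the trusted party reports to the sender, together with the simulator's output. -/
def idealRun {Aux Out : Type} (B : Simulator w ℓ Aux Out) (z : Bits Aux) (m : Bits (ι × Fin ℓ)) :
    PMF (Bits (Fin (total w) ⊕ Out)) :=
  (B.choose.run z).bind fun u =>
  (B.finish.run (B.answered m u)).map fun y =>
    pair (unary (total w) (ones (sndBits (sndBits u)))) y

/-- The expected running time of the simulator in the ideal model. -/
def Simulator.cost {Aux Out : Type} (B : Simulator w ℓ Aux Out)
    (x : Bits Aux × Bits (ι × Fin ℓ)) : ℝ≥0∞ :=
  B.choose.cost x.1 + ∑' u, B.choose.run x.1 u * B.finish.cost (B.answered x.2 u)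

/-! ### Weighted oblivious transfer -/

/-- Polynomially many rounds, and both honest parties run in probabilistic polynomial time. -/
structure Efficient {ℓ : ℕ → ℕ} (Q : ∀ k, Protocol ι w (ℓ k)) : Prop where
  rounds : ∃ q : Polynomial ℕ, ∀ k, (Q k).rounds ≤ q.eval k
  sInit : PPT fun k => (Q k).sInit
  sStep : PPT fun k => (Q k).sStep
  sOut : PPT fun k => (Q k).sOut
  rInit : PPT fun k => (Q k).rInit
  rSend : PPT fun k => (Q k).rSend
  rRecv : PPT fun k => (Q k).rRecv
  rOut : PPT fun k => (Q k).rOut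

/-- If both parties are honest, then the receiver gets the chosen items, and the sender learns their
total price. -/
def Correct {ℓ : ℕ → ℕ} (Q : ∀ k, Protocol ι w (ℓ k)) : Prop :=
  ∀ k m σ, ∀ o ∈ (honestRun (Q k) m σ).support,
    o.1 = price w σ ∧ ∀ i, σ i = true → ∀ b, o.2 (i, b) = m (i, b)

/-- Choice sets with equal total prices are computationally indistinguishable for every
probabilistic polynomial time sender. -/
def ReceiverPrivacy {ℓ : ℕ → ℕ} (Q : ∀ k, Protocol ι w (ℓ k)) : Prop :=
  ∀ (Aux : ℕ → Type) [∀ k, Finite (Aux k)] (A : ∀ k, SenderStrategy (Q k) (Aux k)),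
    PPT (fun k => (A k).init) → PPT (fun k => (A k).step) →
    ∀ (z : ∀ k, Bits (Aux k)) (σ τ : ℕ → Bits ι), (∀ k, price w (σ k) = price w (τ k)) →
      CompIndist (fun k => senderView (Q k) (A k) (z k) (σ k))
        (fun k => senderView (Q k) (A k) (z k) (τ k))

/-- The receiver's choice is unconditionally secure: choice sets with equal total prices lead to
identically distributed views of every sender, however powerful. -/
def UnconditionalReceiverPrivacy {ℓ : ℕ → ℕ} (Q : ∀ k, Protocol ι w (ℓ k)) : Prop :=
  ∀ (k : ℕ) (Aux : Type) [Finite Aux] (A : SenderStrategy (Q k) Aux) (z : Bits Aux)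
    (σ τ : Bits ι), price w σ = price w τ → senderView (Q k) A z σ = senderView (Q k) A z τ

/-- A receiver strategy is probabilistic polynomial time. -/
structure ReceiverPPT {ℓ : ℕ → ℕ} {Q : ∀ k, Protocol ι w (ℓ k)} {Aux : ℕ → Type}
    (A : ∀ k, ReceiverStrategy (Q k) (Aux k)) : Prop where
  init : PPT fun k => (A k).init
  send : PPT fun k => (A k).send
  recv : PPT fun k => (A k).recv

/-- For every malicious probabilistic polynomial time receiver there is a probabilistic polynomial
time simulator in the ideal model such that the price that the sender learns and the receiver's
output are computationally indistinguishable in the two models. -/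
def SenderPrivacy {ℓ : ℕ → ℕ} (Q : ∀ k, Protocol ι w (ℓ k)) : Prop :=
  ∀ (Aux : ℕ → Type) [∀ k, Finite (Aux k)] (A : ∀ k, ReceiverStrategy (Q k) (Aux k)),
    ReceiverPPT A →
    ∃ B : ∀ k, Simulator w (ℓ k) (Aux k) (A k).State,
      PolyBounded (fun k => (B k).cost) ∧
      ∀ (z : ∀ k, Bits (Aux k)) (m : ∀ k, Bits (ι × Fin (ℓ k))),
        CompIndist (fun k => realRun (Q k) (A k) (z k) (m k))
          (fun k => idealRun (B k) (z k) (m k))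

/-- Weighted oblivious transfer with weights `w`. With all weights `1` this is ordinary
`t`-out-of-`N` oblivious transfer, where `t` is the size of the receiver's choice set. -/
structure IsWeightedOT {ℓ : ℕ → ℕ} (Q : ∀ k, Protocol ι w (ℓ k)) : Prop where
  efficient : Efficient Q
  correct : Correct Q
  receiverPrivacy : ReceiverPrivacy Q
  senderPrivacy : SenderPrivacy Q

/-- The strategy `A` is semi-honest with choice set `σ`: some of its wires carry the state of the
honest receiver, on which it acts exactly as prescribed; the others keep arbitrary records
(such as coins and messages). -/
def ReceiverStrategy.SemiHonest {Q : Protocol ι w ℓ} {Aux : Type} (A : ReceiverStrategy Q Aux)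
    (σ : Bits ι) : Prop :=
  ∃ f : Q.RState → A.State,
    (∀ z a, (A.init (pair z a)).map (fun s => s ∘ f) = Q.rInit (pair σ a)) ∧
    (∀ s, (A.send s).map (fun u => pair (fstBits u ∘ f) (sndBits u)) = Q.rSend (s ∘ f)) ∧
    ∀ s a, (A.recv (pair s a)).map (fun s' => s' ∘ f) = Q.rRecv (pair (s ∘ f) a)

/-- A semi-honest receiver learns nothing about the items outside its choice set. -/
def SemiHonestSenderPrivacy {ℓ : ℕ → ℕ} (Q : ∀ k, Protocol ι w (ℓ k)) : Prop :=
  ∀ (Aux : ℕ → Type) [∀ k, Finite (Aux k)] (A : ∀ k, ReceiverStrategy (Q k) (Aux k))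
    (σ : ℕ → Bits ι), ReceiverPPT A → (∀ k, (A k).SemiHonest (σ k)) →
    ∀ (z : ∀ k, Bits (Aux k)) (m m' : ∀ k, Bits (ι × Fin (ℓ k))),
      (∀ k i, σ k i = true → ∀ b, m k (i, b) = m' k (i, b)) →
      CompIndist (fun k => realRun (Q k) (A k) (z k) (m k))
        (fun k => realRun (Q k) (A k) (z k) (m' k))

end Protocols

/-! ## The protocol -/

/-- The XOR of a family of bit strings. -/
def xorAll {p κ : ℕ} (x : Fin p → Bits (Fin κ)) : Bits (Fin κ) :=
  fun b => (List.ofFn fun j => x j b).foldr xor false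

/-- Divide a key into `p` parts whose XOR is the key: all parts but the last are random. -/
def xorSplit {κ : ℕ} : (p : ℕ) → Bits (Fin κ) → PMF (Fin p → Bits (Fin κ))
  | 0, _ => PMF.pure fun j => j.elim0
  | p + 1, K =>
      (PMF.uniformOfFintype (Fin p → Bits (Fin κ))).map fun r =>
        Fin.snoc (α := fun _ => Bits (Fin κ)) r fun b => xor (K b) (xorAll r b)

/-- The index set of all key parts: the key of item `i` has `p i` parts. -/
abbrev Parts {n : ℕ} (p : Fin n → ℕ) : Type := Σ i, Fin (p i)

theorem total_parts {n : ℕ} (p : Fin n → ℕ) : total (fun _ : Parts p => 1) = total p := by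
  simp [total]

/-- The sender encrypts item `i` under a fresh key `K i`, publishes the ciphertexts, and
divides `K i` into `p i` parts. The parties then run the given oblivious transfer on all parts, in
which the receiver chooses the parts of the keys of the chosen items. The receiver recovers these
keys and decrypts. The receiver's state consists of the choice set, the ciphertexts, and the state
of the oblivious transfer. -/
def keySplitProtocol {n : ℕ} (p : Fin n → ℕ) (E : SymEnc)
    (ot : Protocol (Parts p) (fun _ => 1) E.keyLen) : Protocol (Fin n) p E.msgLen where
  SState := ot.SState
  RState := Fin n ⊕ ((Fin n × Fin E.ctLen) ⊕ ot.RState)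
  First := (Fin n × Fin E.ctLen) ⊕ ot.First
  ToS := ot.ToS
  ToR := ot.ToR
  rounds := ot.rounds
  sInit := fun m =>
    (piPMF fun _ : Fin n => E.gen).bind fun K =>
    (piPMF fun i => E.enc (K i) fun b => m (i, b)).bind fun c =>
    (piPMF fun i => xorSplit (p i) (K i)).bind fun x =>
    (ot.sInit fun s => x s.1.1 s.1.2 s.2).map fun a =>
      pair (fstBits a) (pair (fun s => c s.1 s.2) (sndBits a))
  sStep := ot.sStep
  sOut := fun s => (ot.sOut s).map fun P j => P (Fin.cast (total_parts p).symm j)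
  rInit := fun x =>
    let σ := fstBits x
    let c := fstBits (sndBits x)
    let first := sndBits (sndBits x)
    (ot.rInit (pair (fun s => σ s.1) first)).map fun r => pair σ (pair c r)
  rSend := fun s =>
    (ot.rSend (sndBits (sndBits s))).map fun u =>
      pair (pair (fstBits s) (pair (fstBits (sndBits s)) (fstBits u))) (sndBits u)
  rRecv := fun x =>
    let s := fstBits x
    (ot.rRecv (pair (sndBits (sndBits s)) (sndBits x))).map fun r =>
      pair (fstBits s) (pair (fstBits (sndBits s)) r)
  rOut := fun s =>
    let σ := fstBits s
    let c := fstBits (sndBits s)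
    (ot.rOut (sndBits (sndBits s))).map fun x t =>
      σ t.1 && E.dec (xorAll fun j b => x (⟨t.1, j⟩, b)) (fun b => c (t.1, b)) t.2

end WOT

end

/-! Correctness and the receiver's privacy transfer directly. The receiver merely stores the
ciphertexts, so its conversation is that of the underlying transfer in which it chooses all parts of
the chosen keys (`honestRun_keySplit`, `senderView_keySplit`), and the number of these parts is the
price.

The sender's privacy carries the work. A malicious receiver is also a receiver of the underlying
transfer, with the ciphertexts as auxiliary input (`realRun_keySplit`). It therefore has a simulator
`B` there, and the real execution may be replaced by `hybridRun`, where `B` gets key parts from a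
trusted party. The verdict of a request of `B` consists of the items all of whose parts are
delivered, and of the payment. The payment covers these items (`price_verdict_le`). Every other key
lacks a part, so what `B` sees is independent of it (`splitKeys_mask`), and the security of the
encryption allows the other messages to be replaced by zeros (`compIndist_maskedKeysCts`).

The difficulty is the order of events: the new simulator must send its request before it knows any
item, whereas `B` sends its request after seeing the ciphertexts. So the simulator runs the first
phase of `B` on encryptions of zeros, submits the verdict `v`, and afterwards reruns this phase on
encryptions of the returned items until `v` occurs again. Let q₀ and q₁ be the probabilities of `v`
with zeros and with the returned items. No key is needed to compute a verdict, so |q₀ - q₁| is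
negligible. But the expected number of repetitions, a sum of terms q₀/q₁, need not be bounded,
because q₁ may be tiny or zero on rare verdicts.

The remedy is `guess`: T successful trials, each choosing zeros or the returned items by a fair
coin, and the returned items are used in the final loop only if one of these trials used them. This
event has probability at most T·q₁/(q₀+q₁), which cancels the factor 1/q₁ in the running time
(`trialProb_mul_simFinishCost_le`). It fails with probability (q₀/(q₀+q₁))^T. This is at most
(2/3)^T unless q₀ > 2q₁, and then q₀ < 2|q₀ - q₁| is itself small (`rejection_bound`). Since n and p
are fixed, there is a constant number of verdicts; with T = k the total running time is polynomial
and the total error negligible.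

For a semi-honest receiver, the correctness of the underlying transfer forces `B` to request, up to
negligible probability, exactly the parts of the chosen keys (`negligible_badProb`): the payment
must be right, and a part that is not requested could not influence the output. Then all other keys
may be erased (`negligible_erase_keys`), and the security of the encryption applies again. -/

noncomputable section

namespace WOT

/-! ## Expectations -/

/-- The expected value of `f` under `μ`. -/
def ev {α : Type*} (μ : PMF α) (f : α → ℝ≥0∞) : ℝ≥0∞ := ∑' a, μ a * f a

section Expectation

variable {α β γ : Type*}

@[simp] theorem ev_pure (a : α) (f : α → ℝ≥0∞) : ev (PMF.pure a) f = f a := by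
  classical
  rw [ev, tsum_eq_single a]
  · simp
  · intro b hb; simp [PMF.pure_apply, hb]

@[simp] theorem ev_bind (μ : PMF α) (g : α → PMF β) (f : β → ℝ≥0∞) :
    ev (μ.bind g) f = ev μ fun a => ev (g a) f := by
  simp only [ev, PMF.bind_apply, ← ENNReal.tsum_mul_right, ← ENNReal.tsum_mul_left, mul_assoc]
  exact ENNReal.tsum_comm

@[simp] theorem ev_map (μ : PMF α) (g : α → β) (f : β → ℝ≥0∞) :
    ev (μ.map g) f = ev μ fun a => f (g a) := by
  rw [← PMF.bind_pure_comp, ev_bind]; simp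

@[simp] theorem ev_const (μ : PMF α) (c : ℝ≥0∞) : ev μ (fun _ => c) = c := by
  rw [ev, ENNReal.tsum_mul_right, PMF.tsum_coe, one_mul]

theorem ev_mono {μ : PMF α} {f g : α → ℝ≥0∞} (h : ∀ a, f a ≤ g a) : ev μ f ≤ ev μ g :=
  ENNReal.tsum_le_tsum fun a => mul_le_mul_right (h a) _

theorem ev_le {μ : PMF α} {f : α → ℝ≥0∞} {c : ℝ≥0∞} (h : ∀ a, f a ≤ c) : ev μ f ≤ c :=
  (ev_mono h).trans (ev_const μ c).le

theorem ev_add (μ : PMF α) (f g : α → ℝ≥0∞) :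
    (ev μ fun a => f a + g a) = ev μ f + ev μ g := by
  simp only [ev, mul_add, ENNReal.tsum_add]

theorem ev_const_mul (μ : PMF α) (c : ℝ≥0∞) (f : α → ℝ≥0∞) :
    (ev μ fun a => c * f a) = c * ev μ f := by
  simp only [ev, ← ENNReal.tsum_mul_left]
  exact tsum_congr fun a => by ring

theorem ev_mul_const (μ : PMF α) (c : ℝ≥0∞) (f : α → ℝ≥0∞) :
    (ev μ fun a => f a * c) = ev μ f * c := by
  simp only [ev, ← ENNReal.tsum_mul_right, mul_assoc]

theorem ev_sum {κ : Type*} (μ : PMF α) (s : Finset κ) (f : κ → α → ℝ≥0∞) :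
    (ev μ fun a => ∑ i ∈ s, f i a) = ∑ i ∈ s, ev μ (f i) := by
  simp only [ev, Finset.mul_sum]
  exact Summable.tsum_finsetSum fun _ _ => ENNReal.summable

theorem ev_comm (μ : PMF α) (ν : PMF β) (f : α → β → ℝ≥0∞) :
    (ev μ fun a => ev ν (f a)) = ev ν fun b => ev μ fun a => f a b := by
  simp only [ev, ← ENNReal.tsum_mul_left]
  rw [ENNReal.tsum_comm]
  exact tsum_congr fun b => tsum_congr fun a => by ring

theorem ev_congr {μ : PMF α} {f g : α → ℝ≥0∞} (h : ∀ a ∈ μ.support, f a = g a) :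
    ev μ f = ev μ g := by
  refine tsum_congr fun a => ?_
  by_cases ha : μ a = 0
  · simp [ha]
  · rw [h a ((PMF.mem_support_iff _ _).2 ha)]

theorem pmf_ext_ev {μ ν : PMF α} (h : ∀ f, ev μ f = ev ν f) : μ = ν := by
  classical
  ext a
  have := h fun b => if b = a then 1 else 0
  simpa [ev] using this

/-- An expectation decomposes according to the values of a map into a finite type. -/
theorem ev_fiberwise [Fintype β] [DecidableEq β] (μ : PMF α) (g : α → β) (f : α → ℝ≥0∞) :
    ev μ f = ∑ b, ev μ fun a => if g a = b then f a else 0 := by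
  rw [← ev_sum]
  simp

theorem map_eq_bind (μ : PMF α) (f : α → β) : μ.map f = μ.bind fun a => PMF.pure (f a) := rfl

theorem pmf_bind_congr {μ : PMF α} {f g : α → PMF β} (h : ∀ a ∈ μ.support, f a = g a) :
    μ.bind f = μ.bind g := by
  refine pmf_ext_ev fun φ => ?_
  rw [ev_bind, ev_bind]
  exact ev_congr fun a ha => by rw [h a ha]

end Expectation

/-! ## Products of distributions -/

section Products

theorem tsum_fin_prod_eq : ∀ (n : ℕ) (β : Fin n → Type) (f : ∀ i, β i → ℝ≥0∞),
    ∑' y : ∀ i, β i, ∏ i, f i (y i) = ∏ i, ∑' b, f i b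
  | 0, β, f => by simp
  | n + 1, β, f => by
    rw [← (Fin.consEquiv β).tsum_eq, ENNReal.tsum_prod']
    simp only [Fin.prod_univ_succ, Fin.consEquiv_apply, Fin.cons_zero, Fin.cons_succ,
      ENNReal.tsum_mul_left]
    rw [tsum_fin_prod_eq n (fun i => β i.succ) (fun i => f i.succ), ENNReal.tsum_mul_right]

variable {ι : Type} [Fintype ι]

theorem tsum_prod_eq {β : ι → Type} (f : ∀ i, β i → ℝ≥0∞) :
    ∑' y : ∀ i, β i, ∏ i, f i (y i) = ∏ i, ∑' b, f i b := by
  let e := (Fintype.equivFin ι).symm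
  rw [← (Equiv.piCongrLeft β e).tsum_eq, ← Equiv.prod_comp e,
    ← tsum_fin_prod_eq _ (fun j => β (e j)) (fun j => f (e j))]
  refine tsum_congr fun y => ?_
  rw [← Equiv.prod_comp e]
  exact Finset.prod_congr rfl fun j _ => by rw [Equiv.piCongrLeft_apply_apply]

theorem piPMF_apply {β : ι → Type} (μ : ∀ i, PMF (β i)) (y : ∀ i, β i) :
    piPMF μ y = ∏ i, μ i (y i) := rfl

/-- Tonelli for finite products: the sum over independent choices factors by `tsum_prod_eq`. -/
theorem piPMF_bind {β γ : ι → Type} (μ : ∀ i, PMF (β i)) (g : ∀ i, β i → PMF (γ i)) :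
    ((piPMF μ).bind fun x => piPMF fun i => g i (x i)) = piPMF fun i => (μ i).bind (g i) := by
  ext y
  simp only [PMF.bind_apply, piPMF_apply, ← Finset.prod_mul_distrib]
  exact tsum_prod_eq fun i b => μ i b * g i b (y i)

theorem piPMF_pure {β : ι → Type} (x : ∀ i, β i) :
    (piPMF fun i => PMF.pure (x i)) = PMF.pure x := by
  classical
  ext y
  simp only [piPMF_apply, PMF.pure_apply, Finset.prod_ite_zero, Finset.prod_const_one,
    Finset.mem_univ, true_implies, funext_iff]

theorem piPMF_map {β γ : ι → Type} (μ : ∀ i, PMF (β i)) (g : ∀ i, β i → γ i) :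
    ((piPMF μ).map fun x i => g i (x i)) = piPMF fun i => (μ i).map (g i) := by
  simp only [map_eq_bind, ← piPMF_bind, piPMF_pure]

/-- Resampling one coordinate forgets its former value and leaves the others alone. This is what
permits planting a challenge ciphertext. -/
theorem piPMF_update [DecidableEq ι] {β : ι → Type} (μ : ∀ i, PMF (β i)) (i : ι) (ν : PMF (β i)) :
    ((piPMF μ).bind fun x => ν.map (Function.update x i)) = piPMF (Function.update μ i ν) := by
  classical
  -- Resampling is itself a coordinatewise kernel (a point mass everywhere except at `i`), so
  -- `piPMF_bind` applies.
  have h : ∀ x : ∀ j, β j, ν.map (Function.update x i) =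
      piPMF (fun j => (Function.update (fun j b => PMF.pure b) i (fun _ => ν) :
        ∀ j, β j → PMF (β j)) j (x j)) := by
    intro x
    ext y
    rw [PMF.map_apply, tsum_eq_single (y i), piPMF_apply]
    · rw [← Finset.mul_prod_erase _ _ (Finset.mem_univ i)]
      have : ∏ j ∈ Finset.univ.erase i, (Function.update (fun j b => PMF.pure b) i (fun _ => ν) :
          ∀ j, β j → PMF (β j)) j (x j) (y j) =
          ∏ j ∈ Finset.univ.erase i, if y j = x j then 1 else 0 := by
        refine Finset.prod_congr rfl fun j hj => ?_
        rw [Function.update_of_ne (Finset.ne_of_mem_erase hj), PMF.pure_apply]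
      rw [this, Finset.prod_ite_zero]
      simp only [Function.update_self, Function.eq_update_iff, Finset.mem_erase, Finset.mem_univ,
        and_true, Finset.prod_const_one, mul_ite, mul_one, mul_zero, true_and]
    · intro b hb
      rw [if_neg]
      rintro rfl
      simp at hb
  simp only [h]
  rw [piPMF_bind]
  congr 1
  ext j : 1
  by_cases hj : j = i
  · subst hj; simp
  · simp [hj]

theorem map_equiv_apply {α β : Type*} (μ : PMF α) (e : α ≃ β) (b : β) :
    μ.map e b = μ (e.symm b) := by
  classical
  rw [PMF.map_apply, tsum_eq_single (e.symm b)]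
  · simp
  · intro a ha
    rw [if_neg]
    rintro rfl
    simp at ha

/-- Links the coin gates of programs with the uniform distribution in `xorSplit`. -/
theorem piPMF_uniform_map {β : Type*} [Fintype β] [Nonempty β] (e : (ι → Bool) ≃ β) :
    (piPMF fun _ : ι => PMF.uniformOfFintype Bool).map e = PMF.uniformOfFintype β := by
  classical
  ext y
  have hc : Fintype.card β = 2 ^ Fintype.card ι := by
    rw [← Fintype.card_congr e]; simp
  rw [map_equiv_apply]
  simp [piPMF_apply, PMF.uniformOfFintype_apply, hc, ENNReal.inv_pow]

theorem mem_support_piPMF {β : ι → Type} (μ : ∀ i, PMF (β i)) (y : ∀ i, β i) :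
    y ∈ (piPMF μ).support ↔ ∀ i, y i ∈ (μ i).support := by
  simp only [PMF.mem_support_iff, piPMF_apply, ne_eq, Finset.prod_eq_zero_iff, not_exists,
    Finset.mem_univ, true_and]

end Products

/-! ## Programs for composite kernels -/

section Computability

variable {α β γ δ : Type}

@[simp] theorem fstBits_pair (x : Bits α) (y : Bits β) : fstBits (pair x y) = x := rfl
@[simp] theorem sndBits_pair (x : Bits α) (y : Bits β) : sndBits (pair x y) = y := rfl
@[simp] theorem pair_inl (x : Bits α) (y : Bits β) (a : α) : pair x y (Sum.inl a) = x a := rfl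
@[simp] theorem pair_inr (x : Bits α) (y : Bits β) (b : β) : pair x y (Sum.inr b) = y b := rfl
@[simp] theorem pair_eta (x : Bits (α ⊕ β)) : pair (fstBits x) (sndBits x) = x := by
  funext s; cases s <;> rfl

/-- `Comp f t`: some program computes the kernel `f` with expected cost at most `t`. -/
def Comp (f : Kernel α β) (t : Bits α → ℝ≥0∞) : Prop :=
  ∃ c : Prog α β, c.run = f ∧ ∀ x, c.cost x ≤ t x

/-- Every output bit is a copy of an input bit or constant. -/
def IsRewire (h : Bits α → Bits β) : Prop :=
  ∀ b, (∃ a, ∀ x, h x b = x a) ∨ ∃ v, ∀ x, h x b = v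

theorem Comp.congr {f g : Kernel α β} {s t : Bits α → ℝ≥0∞} (h : Comp f s) (hf : ∀ x, f x = g x)
    (hs : ∀ x, s x ≤ t x) : Comp g t := by
  obtain ⟨c, rfl, hc⟩ := h
  exact ⟨c, funext hf, fun x => (hc x).trans (hs x)⟩

theorem Comp.mono {f : Kernel α β} {s t : Bits α → ℝ≥0∞} (h : Comp f s)
    (hs : ∀ x, s x ≤ t x) : Comp f t := h.congr (fun _ => rfl) hs

theorem Comp.rewire {h : Bits α → Bits β} (hh : IsRewire h) :
    Comp (fun x => PMF.pure (h x)) fun _ => 0 := by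
  have : ∀ b, ∃ s : α ⊕ Bool, ∀ x, h x b = Sum.elim x id s := by
    intro b
    rcases hh b with ⟨a, ha⟩ | ⟨v, hv⟩
    · exact ⟨.inl a, ha⟩
    · exact ⟨.inr v, hv⟩
  choose f hf using this
  refine ⟨.rewire f, ?_, fun x => by simp [Prog.cost]⟩
  funext x
  simp only [Prog.run]
  congr 1
  funext b
  exact (hf b x).symm

theorem Comp.seq {f : Kernel α β} {g : Kernel β γ} {s : Bits α → ℝ≥0∞} {t : Bits β → ℝ≥0∞}
    (hf : Comp f s) (hg : Comp g t) : Comp (fun x => (f x).bind g) fun x => s x + ev (f x) t := by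
  obtain ⟨c, rfl, hc⟩ := hf
  obtain ⟨d, rfl, hd⟩ := hg
  refine ⟨.seq c d, by simp only [Prog.run], fun x => ?_⟩
  simp only [Prog.cost]
  exact add_le_add (hc x) (ev_mono hd)

theorem Comp.pre {f : Kernel β γ} {t : Bits β → ℝ≥0∞} {h : Bits α → Bits β} (hf : Comp f t)
    (hh : IsRewire h) : Comp (fun x => f (h x)) fun x => t (h x) :=
  ((Comp.rewire hh).seq hf).congr (fun x => by simp) fun x => by simp

theorem Comp.post {f : Kernel α β} {t : Bits α → ℝ≥0∞} {h : Bits β → Bits γ} (hf : Comp f t)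
    (hh : IsRewire h) : Comp (fun x => (f x).map h) t :=
  (hf.seq (Comp.rewire hh)).congr (fun x => rfl) fun x => by simp

theorem Comp.loop {f : Kernel α (Option β)} {t : Bits α → ℝ≥0∞} (hf : Comp f t) :
    Comp (fun x => repeatUntil (f x)) fun x => (1 + t x) / flagProb (f x) := by
  obtain ⟨c, rfl, hc⟩ := hf
  refine ⟨.loop c, by simp only [Prog.run], fun x => ?_⟩
  simp only [Prog.cost]
  gcongr
  exact hc x

theorem Comp.pi {ι : Type} [Fintype ι] {β : ι → Type} {f : ∀ i, Kernel α (β i)}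
    {t : ι → Bits α → ℝ≥0∞} (hf : ∀ i, Comp (f i) (t i)) :
    Comp (fun x => (piPMF fun i => f i x).map fun y (s : Σ i, β i) => y s.1 s.2)
      fun x => ∑ i, t i x := by
  choose c hc ht using hf
  have : Comp (fun x : Bits (Σ _ : ι, α) => (piPMF fun i => f i fun a => x ⟨i, a⟩).map
      fun y (s : Σ i, β i) => y s.1 s.2) fun x => ∑ i, t i fun a => x ⟨i, a⟩ := by
    refine ⟨.par c, ?_, fun x => ?_⟩
    · funext x
      simp only [Prog.run, hc]
    · simp only [Prog.cost]
      exact Finset.sum_le_sum fun i _ => ht i _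
  exact this.pre (h := fun x s => x s.2) fun b => .inl ⟨b.2, fun _ => rfl⟩

theorem Comp.piProd {ι : Type} [Fintype ι] {f : ι → Kernel α β}
    {t : ι → Bits α → ℝ≥0∞} (hf : ∀ i, Comp (f i) (t i)) :
    Comp (fun x => (piPMF fun i => f i x).map fun y (s : ι × β) => y s.1 s.2)
      fun x => ∑ i, t i x := by
  refine ((Comp.pi hf).post (h := fun x (s : ι × β) => x ⟨s.1, s.2⟩)
    fun b => .inl ⟨⟨b.1, b.2⟩, fun _ => rfl⟩).congr (fun x => ?_) fun x => le_rfl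
  rw [PMF.map_comp]
  rfl

theorem ev_piPMF_bool {β : Bool → Type} (μ : ∀ b, PMF (β b)) (f : (∀ b, β b) → ℝ≥0∞) :
    ev (piPMF μ) f = ev (μ false) fun a => ev (μ true) fun b => f (Bool.rec a b) := by
  let e : β false × β true ≃ ∀ b, β b :=
    { toFun := fun p => Bool.rec p.1 p.2
      invFun := fun y => (y false, y true)
      left_inv := fun p => rfl
      right_inv := fun y => by funext b; cases b <;> rfl }
  unfold ev
  rw [← e.tsum_eq, ENNReal.tsum_prod']
  refine tsum_congr fun a => ?_
  rw [← ENNReal.tsum_mul_left]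
  refine tsum_congr fun b => ?_
  simp only [piPMF_apply, Fintype.prod_bool]
  simp only [e, Equiv.coe_fn_mk]
  ring

/-- Run a program and keep its input. -/
theorem Comp.keep {f : Kernel α β} {t : Bits α → ℝ≥0∞} (hf : Comp f t) :
    Comp (fun x => (f x).map (pair x)) t := by
  -- The identity on one side and `f` on the other, run in parallel on two copies of the input.
  let B : Bool → Type := fun b => Bool.rec α β b
  have h : ∀ b, Comp (β := B b) (Bool.rec (fun x => PMF.pure x) f b) (Bool.rec 0 t b) := by
    intro b
    cases b
    · exact (Comp.rewire (h := id) fun b => .inl ⟨b, fun _ => rfl⟩).mono fun _ => le_rfl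
    · exact hf
  refine ((Comp.pi h).post (h := fun x (s : α ⊕ β) => Sum.elim (fun a => x ⟨false, a⟩)
    (fun b => x ⟨true, b⟩) s) ?_).congr (fun x => ?_) fun x => ?_
  · rintro (a | b)
    · exact .inl ⟨_, fun _ => rfl⟩
    · exact .inl ⟨_, fun _ => rfl⟩
  · refine pmf_ext_ev fun φ => ?_
    simp only [ev_map, ev_piPMF_bool, ev_pure]
    rfl
  · simp

theorem Comp.bind {f : Kernel α β} {g : Bits α → Kernel β γ} {s : Bits α → ℝ≥0∞}
    {t : Bits α → Bits β → ℝ≥0∞} (hf : Comp f s)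
    (hg : Comp (fun w : Bits (α ⊕ β) => g (fstBits w) (sndBits w))
      fun w => t (fstBits w) (sndBits w)) :
    Comp (fun x => (f x).bind (g x)) fun x => s x + ev (f x) (t x) :=
  (hf.keep.seq hg).congr (fun x => by simp [PMF.bind_map, Function.comp_def]) fun x => by simp

theorem Comp.bind_const {f : Kernel α β} {g : Bits α → Kernel β γ} {s t : ℝ≥0∞}
    (hf : Comp f fun _ => s)
    (hg : Comp (fun w : Bits (α ⊕ β) => g (fstBits w) (sndBits w)) fun _ => t) :
    Comp (fun x => (f x).bind (g x)) fun _ => s + t :=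
  (hf.bind (t := fun _ _ => t) hg).mono fun x => by simp

theorem Comp.nand [Fintype β] {g h : β → α} :
    Comp (fun x : Bits α => PMF.pure fun b => !(x (g b) && x (h b))) fun _ => Nat.card β :=
  ⟨.nand g h, by simp only [Prog.run], fun x => by simp [Prog.cost]⟩

theorem Comp.flips [Fintype β] :
    Comp (fun _ : Bits α => piPMF fun _ : β => PMF.uniformOfFintype Bool) fun _ => Nat.card β :=
  ⟨.flips, by simp only [Prog.run], fun x => by simp [Prog.cost]⟩

/-! ### Boolean functions -/

/-- The Boolean function `g` is computed with `C` steps. -/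
def GateComp (g : Bits α → Bool) (C : ℕ) : Prop :=
  Comp (fun x => PMF.pure fun _ : Unit => g x) fun _ => C

theorem GateComp.nand {g h : Bits α → Bool} {C D : ℕ} (hg : GateComp g C) (hh : GateComp h D) :
    GateComp (fun x => !(g x && h x)) (C + (D + 1)) := by
  have h1 : Comp (fun w : Bits ((α ⊕ Unit) ⊕ Unit) => PMF.pure fun _ : Unit =>
      !(w (.inl (.inr ())) && w (.inr ()))) fun _ => (1 : ℝ≥0∞) :=
    Comp.nand.mono fun _ => by simp
  have h2 : Comp (fun w : Bits (α ⊕ Unit) => PMF.pure fun _ : Unit => !(w (.inr ()) && h (fstBits w)))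
      fun _ => (D : ℝ≥0∞) + 1 := by
    refine ((Comp.pre (h := fstBits) hh fun b => .inl ⟨.inl b, fun _ => rfl⟩).bind_const
      (g := fun w y => PMF.pure fun _ : Unit => !(w (.inr ()) && y ())) h1).congr (fun x => ?_)
      fun _ => le_rfl
    simp [PMF.pure_bind]
  refine (Comp.bind_const hg (g := fun x y => PMF.pure fun _ : Unit => !(y () && h x)) h2).congr
    (fun x => ?_) fun x => ?_
  · simp [PMF.pure_bind]
  · push_cast; exact le_rfl

theorem GateComp.const (v : Bool) : GateComp (fun _ : Bits α => v) 0 := by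
  simpa [GateComp] using
    Comp.rewire (h := fun (_ : Bits α) (_ : Unit) => v) fun _ => .inr ⟨v, fun _ => rfl⟩

theorem GateComp.proj (a : α) : GateComp (fun x : Bits α => x a) 0 := by
  simpa [GateComp] using
    Comp.rewire (h := fun (x : Bits α) (_ : Unit) => x a) fun _ => .inl ⟨a, fun _ => rfl⟩

/-- Disjunctive normal form: `g` tests membership in the finite set of inputs that it accepts. -/
theorem exists_gateComp [Finite α] (g : Bits α → Bool) : ∃ C, GateComp g C := by
  classical
  have := Fintype.ofFinite α
  have hnot : ∀ g : Bits α → Bool, (∃ C, GateComp g C) → ∃ C, GateComp (fun x => !g x) C := by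
    rintro g ⟨C, hC⟩
    exact ⟨_, by simpa using hC.nand hC⟩
  have hand : ∀ g h : Bits α → Bool, (∃ C, GateComp g C) → (∃ C, GateComp h C) →
      ∃ C, GateComp (fun x => g x && h x) C := by
    rintro g h ⟨C, hC⟩ ⟨D, hD⟩
    simpa using hnot _ ⟨_, hC.nand hD⟩
  have hor : ∀ g h : Bits α → Bool, (∃ C, GateComp g C) → (∃ C, GateComp h C) →
      ∃ C, GateComp (fun x => g x || h x) C := by
    intro g h hg hh
    simpa using hnot _ (hand _ _ (hnot _ hg) (hnot _ hh))
  have heq : ∀ (y : Bits α) (s : Finset α),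
      ∃ C, GateComp (fun x : Bits α => decide (∀ a ∈ s, x a = y a)) C := by
    intro y s
    induction s using Finset.induction_on with
    | empty => simpa using ⟨0, GateComp.const (α := α) true⟩
    | insert a s ha ih =>
      have h1 : ∃ C, GateComp (fun x : Bits α => decide (x a = y a)) C := by
        cases hy : y a
        · simpa using hnot _ ⟨0, GateComp.proj a⟩
        · simpa using ⟨0, GateComp.proj a⟩
      simpa only [Finset.forall_mem_insert, Bool.decide_and] using hand _ _ h1 ih
  have hmem : ∀ s : Finset (Bits α), ∃ C, GateComp (fun x : Bits α => decide (x ∈ s)) C := by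
    intro s
    induction s using Finset.induction_on with
    | empty => simpa using ⟨0, GateComp.const (α := α) false⟩
    | insert y s hy ih =>
      have h1 : ∃ C, GateComp (fun x : Bits α => decide (x = y)) C := by
        simpa [funext_iff] using heq y Finset.univ
      simpa only [Finset.mem_insert, Bool.decide_or] using hor _ _ h1 ih
  simpa using hmem (Finset.univ.filter fun x => g x = true)

/-- There are finitely many Boolean functions on finitely many wires. The bound is exponential in
general, but it is applied only to wire sets of fixed size, such as `Request p`, so it is a constant
with respect to the security parameter. -/
theorem exists_gateBound (α : Type) [Finite α] : ∃ C, ∀ g : Bits α → Bool, GateComp g C := by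
  classical
  have := Fintype.ofFinite α
  choose C hC using exists_gateComp (α := α)
  refine ⟨∑ g, C g, fun g => (hC g).mono fun _ => ?_⟩
  exact_mod_cast Finset.single_le_sum (f := C) (fun _ _ => Nat.zero_le _) (Finset.mem_univ g)

/-- A number of steps that suffices for all Boolean functions on the given wires. -/
def gateBound (α : Type) [Finite α] : ℕ := (exists_gateBound α).choose

theorem gateComp (α : Type) [Finite α] (g : Bits α → Bool) : GateComp g (gateBound α) :=
  (exists_gateBound α).choose_spec g

/-- A deterministic map each of whose output bits depends on few input bits. -/
theorem Comp.local (A : Type) [Finite A] [Finite β] {h : Bits α → Bits β}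
    (hh : ∀ b, ∃ (e : A → α) (g : Bits A → Bool), ∀ x, h x b = g (x ∘ e)) :
    Comp (fun x => PMF.pure (h x)) fun _ => (Nat.card β * gateBound A : ℕ) := by
  have := Fintype.ofFinite β
  choose e g hg using hh
  have h1 : ∀ b, Comp (fun x : Bits α => PMF.pure fun _ : Unit => h x b) fun _ => gateBound A := by
    intro b
    refine ((gateComp A (g b)).pre (h := fun x : Bits α => x ∘ e b)
      fun a => .inl ⟨e b a, fun _ => rfl⟩).congr (fun x => ?_) fun x => le_rfl
    simp [hg]
  refine ((Comp.piProd h1).post (h := fun x b => x (b, ())) fun b => .inl ⟨_, fun _ => rfl⟩).congr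
    (fun x => ?_) fun x => ?_
  · rw [piPMF_pure (fun (b : β) (_ : Unit) => h x b), PMF.pure_map, PMF.pure_map]
  · simp

end Computability

/-! ## Sharing a key -/

section Sharing

/-- The XOR of a family of bits. -/
def xorFn {p : ℕ} (f : Fin p → Bool) : Bool := (List.ofFn f).foldr xor false

theorem xorAll_apply {p κ : ℕ} (x : Fin p → Bits (Fin κ)) (b : Fin κ) :
    xorAll x b = xorFn fun j => x j b := rfl

theorem xorFn_succ {p : ℕ} (f : Fin (p + 1) → Bool) :
    xorFn f = xor (f 0) (xorFn fun j => f j.succ) := by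
  simp [xorFn, List.ofFn_succ]

theorem xorFn_snoc : ∀ {p : ℕ} (f : Fin (p + 1) → Bool),
    xorFn f = xor (xorFn fun j => f j.castSucc) (f (Fin.last p))
  | 0, f => by simp [xorFn]
  | p + 1, f => by
    rw [xorFn_succ, xorFn_snoc fun j => f j.succ, xorFn_succ fun j => f j.castSucc]
    simp

theorem xorFn_update : ∀ {p : ℕ} (f : Fin p → Bool) (j : Fin p) (d : Bool),
    xorFn (Function.update f j (xor (f j) d)) = xor (xorFn f) d
  | p + 1, f, j, d => by
    rw [xorFn_succ, xorFn_succ f]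
    refine Fin.cases ?_ (fun i => ?_) j
    · have : (fun j : Fin p => Function.update f 0 (xor (f 0) d) j.succ) = fun j => f j.succ := by
        funext j; simp
      rw [this, Function.update_self]
      cases f 0 <;> cases d <;> simp
    · have : (fun j : Fin p => Function.update f i.succ (xor (f i.succ) d) j.succ) =
          Function.update (fun j => f j.succ) i (xor (f i.succ) d) := by
        funext j
        by_cases h : j = i
        · subst h; simp
        · simp [h]
      rw [this, xorFn_update (fun j => f j.succ) i d,
        Function.update_of_ne (Fin.succ_ne_zero i).symm, Bool.xor_assoc]

/-- The parts are uniform among all tuples with the right XOR. In this description the last part,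
which is computed from the others, is no longer special. -/
theorem xorSplit_apply {p κ : ℕ} (K : Bits (Fin κ)) (x : Fin (p + 1) → Bits (Fin κ)) :
    xorSplit (p + 1) K x =
      if xorAll x = K then (Fintype.card (Fin p → Bits (Fin κ)) : ℝ≥0∞)⁻¹ else 0 := by
  classical
  have key : ∀ r : Fin p → Bits (Fin κ),
      x = Fin.snoc (α := fun _ => Bits (Fin κ)) r (fun b => xor (K b) (xorAll r b)) ↔
        r = Fin.init x ∧ xorAll x = K := by
    intro r
    have hx : ∀ b, xorAll x b = xor (xorAll (Fin.init x) b) (x (Fin.last p) b) := fun b =>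
      xorFn_snoc _
    constructor
    · intro h
      have hr : r = Fin.init x := by rw [h, Fin.init_snoc]
      refine ⟨hr, funext fun b => ?_⟩
      rw [hx b, ← hr, h, Fin.snoc_last]
      cases K b <;> cases xorAll r b <;> rfl
    · rintro ⟨rfl, h⟩
      conv_lhs => rw [← Fin.snoc_init_self x]
      congr 1
      funext b
      rw [← h, hx b]
      cases xorAll (Fin.init x) b <;> simp
  rw [xorSplit, PMF.map_apply]
  simp only [key]
  split_ifs with h
  · rw [tsum_eq_single (Fin.init x)]
    · simp [h]
    · intro r hr; simp [hr]
  · simp [h]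

theorem xorAll_of_mem_support {p κ : ℕ} (hp : 1 ≤ p) {K : Bits (Fin κ)} {x : Fin p → Bits (Fin κ)}
    (hx : x ∈ (xorSplit p K).support) : xorAll x = K := by
  obtain ⟨p, rfl⟩ := Nat.exists_eq_add_of_le' hp
  rw [PMF.mem_support_iff, xorSplit_apply] at hx
  by_contra h
  simp [h] at hx

/-- All parts but one are independent of the key. -/
theorem xorSplit_map_eq {p κ : ℕ} {γ : Type*} (K K' : Bits (Fin κ)) (j : Fin p)
    (h : (Fin p → Bits (Fin κ)) → γ) (hh : ∀ x y, h (Function.update x j y) = h x) :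
    (xorSplit p K).map h = (xorSplit p K').map h := by
  cases p with
  | zero => exact j.elim0
  | succ p =>
    -- Adding `K ⊕ K'` to part `j` is a bijection between the sharings of `K` and those of `K'`, and
    -- `h` does not notice it.
    have hinv : Function.Involutive fun x : Fin (p + 1) → Bits (Fin κ) =>
        Function.update x j fun b => xor (x j b) (xor (K b) (K' b)) := by
      intro x
      funext i b
      by_cases hi : i = j
      · subst hi; simp
      · simp [hi]
    have hxor : ∀ x : Fin (p + 1) → Bits (Fin κ), ∀ b,
        xorAll (hinv.toPerm _ x) b = xor (xorAll x b) (xor (K b) (K' b)) := by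
      intro x b
      rw [xorAll_apply, xorAll_apply, ← xorFn_update _ j]
      congr 1
      funext i
      by_cases hi : i = j
      · subst hi; simp
      · simp [hi]
    have : xorSplit (p + 1) K' = (xorSplit (p + 1) K).map (hinv.toPerm _) := by
      ext x
      rw [map_equiv_apply, hinv.toPerm_symm, xorSplit_apply, xorSplit_apply]
      congr 1
      rw [funext_iff, funext_iff, eq_iff_iff]
      refine forall_congr' fun b => ?_
      rw [hxor]
      cases xorAll x b <;> cases K b <;> cases K' b <;> simp
    rw [this, PMF.map_comp]
    congr 1
    funext x
    exact (hh _ _).symm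

/-- The positions of the key are processed separately, so the cost is linear in the key length with
a constant that depends on `p` only. -/
theorem exists_comp_xorSplit (p : ℕ) : ∃ C : ℕ, ∀ κ : ℕ,
    Comp (fun K : Bits (Fin κ) => (xorSplit p K).map fun x (s : Fin p × Fin κ) => x s.1 s.2)
      fun _ => (C * κ : ℕ) := by
  cases p with
  | zero =>
    refine ⟨0, fun κ => ?_⟩
    refine (Comp.rewire (h := fun (_ : Bits (Fin κ)) (s : Fin 0 × Fin κ) => false)
      fun b => b.1.elim0).congr (fun x => ?_) fun x => by simp
    rw [xorSplit, PMF.pure_map]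
    congr 1
    funext s
    exact s.1.elim0
  | succ p =>
    -- For each position there are `p` coins, and `p + 1` output bits that depend on these coins and
    -- on one key bit.
    refine ⟨p + (p + 1) * gateBound (Option (Fin p)), fun κ => ?_⟩
    have h1 : Comp (fun w : Bits (Fin κ ⊕ (Fin p × Fin κ)) => PMF.pure
        fun s : Fin (p + 1) × Fin κ => Fin.snoc (α := fun _ => Bits (Fin κ))
          (fun j b => w (.inr (j, b)))
          (fun b => xor (w (.inl b)) (xorFn fun j => w (.inr (j, b)))) s.1 s.2)
        fun _ => (Nat.card (Fin (p + 1) × Fin κ) * gateBound (Option (Fin p)) : ℕ) := by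
      refine Comp.local (Option (Fin p)) fun s => ⟨fun a => a.elim (.inl s.2) fun j => .inr (j, s.2),
        fun y => Fin.snoc (α := fun _ => Bool) (fun j => y (some j))
          (xor (y none) (xorFn fun j => y (some j))) s.1, fun x => ?_⟩
      obtain ⟨j, b⟩ := s
      refine Fin.lastCases ?_ (fun j => ?_) j <;> simp
    refine (Comp.bind_const (Comp.flips (β := Fin p × Fin κ)) (g := fun K r => PMF.pure
        fun s : Fin (p + 1) × Fin κ => Fin.snoc (α := fun _ => Bits (Fin κ))
          (fun j b => r (j, b)) (fun b => xor (K b) (xorFn fun j => r (j, b))) s.1 s.2)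
        h1).congr (fun K => ?_) fun x => ?_
    · rw [xorSplit, ← piPMF_uniform_map (Equiv.curry (Fin p) (Fin κ) Bool), PMF.map_comp,
        PMF.map_comp]
      rfl
    · rw [Nat.card_eq_fintype_card, Nat.card_eq_fintype_card]
      simp only [Fintype.card_prod, Fintype.card_fin]
      push_cast
      ring_nf
      exact le_rfl

variable {n : ℕ}

/-- Independently share the keys of all items. -/
def splitKeys (p : Fin n → ℕ) {κ : ℕ} (K : Bits (Fin n × Fin κ)) : PMF (Bits (Parts p × Fin κ)) :=
  (piPMF fun i => xorSplit (p i) fun b => K (i, b)).map fun x s => x s.1.1 s.1.2 s.2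

theorem exists_comp_splitKeys (p : Fin n → ℕ) : ∃ C : ℕ, ∀ κ : ℕ,
    Comp (fun K : Bits (Fin n × Fin κ) => splitKeys p K) fun _ => (C * κ : ℕ) := by
  choose C hC using fun i => exists_comp_xorSplit (p i)
  refine ⟨∑ i, C i, fun κ => ?_⟩
  have h1 : ∀ i, Comp (fun K : Bits (Fin n × Fin κ) => (xorSplit (p i) fun b => K (i, b)).map
      fun x (s : Fin (p i) × Fin κ) => x s.1 s.2) fun _ => (C i * κ : ℕ) := fun i =>
    (hC i κ).pre (h := fun K b => K (i, b)) fun b => .inl ⟨_, fun _ => rfl⟩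
  refine ((Comp.pi h1).post (h := fun y (s : Parts p × Fin κ) => y ⟨s.1.1, (s.1.2, s.2)⟩)
    fun b => .inl ⟨_, fun _ => rfl⟩).congr (fun K => ?_) fun x => ?_
  · rw [splitKeys, ← piPMF_map, PMF.map_comp, PMF.map_comp]
    rfl
  · rw [Finset.sum_mul]; push_cast; exact le_rfl

/-- Blank out the keys outside `J`. -/
def maskKeys {κ : ℕ} (J : Bits (Fin n)) (K : Bits (Fin n × Fin κ)) : Bits (Fin n × Fin κ) :=
  fun s => J s.1 && K s

/-- Blank out the parts outside `V`. -/
def maskParts {p : Fin n → ℕ} {κ : ℕ} (V : Bits (Parts p)) (x : Bits (Parts p × Fin κ)) :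
    Bits (Parts p × Fin κ) := fun s => V s.1 && x s

/-- If every key outside `J` has a part outside `V`, then the parts in `V` do not depend on the
keys outside `J`. -/
theorem splitKeys_mask {p : Fin n → ℕ} {κ : ℕ} {J : Bits (Fin n)} {V : Bits (Parts p)}
    (hJ : ∀ i, J i = false → ∃ j, V ⟨i, j⟩ = false) (K : Bits (Fin n × Fin κ)) :
    (splitKeys p (maskKeys J K)).map (maskParts V) = (splitKeys p K).map (maskParts V) := by
  have h : ∀ L : Bits (Fin n × Fin κ), (splitKeys p L).map (maskParts V) =
      (piPMF fun i => (xorSplit (p i) fun b => L (i, b)).map fun x j b => V ⟨i, j⟩ && x j b).map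
        fun x s => x s.1.1 s.1.2 s.2 := by
    intro L
    rw [← piPMF_map, splitKeys, PMF.map_comp, PMF.map_comp]
    rfl
  rw [h, h]
  congr 2
  funext i
  -- A key outside `J` misses the part `j`, so `xorSplit_map_eq` applies; a key in `J` is not
  -- changed by the mask.
  cases hi : J i
  · obtain ⟨j, hj⟩ := hJ i hi
    refine xorSplit_map_eq _ _ j _ fun x y => ?_
    funext j' b
    by_cases h' : j' = j
    · subst h'; simp [hj]
    · simp [h']
  · simp [maskKeys, hi]

end Sharing

/-! ## Polynomial bounds -/

/-- Bounds that are polynomial in the security parameter. -/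
def PolyLe (t : ℕ → ℝ≥0∞) : Prop := ∃ q : Polynomial ℕ, ∀ k, t k ≤ (q.eval k : ℕ)

theorem PolyLe.const (c : ℕ) : PolyLe fun _ => c := ⟨Polynomial.C c, fun k => by simp⟩

theorem PolyLe.one : PolyLe fun _ => 1 := ⟨1, fun k => by simp⟩

theorem PolyLe.id : PolyLe fun k => k := ⟨Polynomial.X, fun k => by simp⟩

theorem PolyLe.add {s t : ℕ → ℝ≥0∞} (hs : PolyLe s) (ht : PolyLe t) :
    PolyLe fun k => s k + t k := by
  obtain ⟨q, hq⟩ := hs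
  obtain ⟨r, hr⟩ := ht
  refine ⟨q + r, fun k => ?_⟩
  rw [Polynomial.eval_add, Nat.cast_add]
  exact add_le_add (hq k) (hr k)

theorem PolyLe.mul {s t : ℕ → ℝ≥0∞} (hs : PolyLe s) (ht : PolyLe t) :
    PolyLe fun k => s k * t k := by
  obtain ⟨q, hq⟩ := hs
  obtain ⟨r, hr⟩ := ht
  refine ⟨q * r, fun k => ?_⟩
  rw [Polynomial.eval_mul, Nat.cast_mul]
  exact mul_le_mul' (hq k) (hr k)

theorem PPT.exists_comp {α β : ℕ → Type} {f : ∀ k, Kernel (α k) (β k)} (hf : PPT f) :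
    ∃ t : ℕ → ℝ≥0∞, PolyLe t ∧ ∀ k, Comp (f k) fun _ => t k := by
  obtain ⟨c, hc, q, hq⟩ := hf
  exact ⟨_, ⟨q, fun k => le_rfl⟩, fun k => ⟨c k, hc k, hq k⟩⟩

theorem PPT.of_comp {α β : ℕ → Type} {f : ∀ k, Kernel (α k) (β k)} {t : ℕ → ℝ≥0∞} (ht : PolyLe t)
    (hf : ∀ k, Comp (f k) fun _ => t k) : PPT f := by
  obtain ⟨q, hq⟩ := ht
  choose c hc hct using hf
  exact ⟨c, hc, q, fun k x => (hct k x).trans (hq k)⟩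

theorem PPT.congr {α β : ℕ → Type} {f g : ∀ k, Kernel (α k) (β k)} (hf : PPT f)
    (h : ∀ k x, f k x = g k x) : PPT g := by
  have : f = g := funext fun k => funext (h k)
  exact this ▸ hf

/-! ## Negligible functions -/

theorem Negligible.mono {f g : ℕ → ℝ} (hg : Negligible g) (h : ∀ k, |f k| ≤ g k) : Negligible f :=
  Asymptotics.SuperpolynomialDecay.trans_abs_le hg fun k => (h k).trans (le_abs_self _)

theorem Negligible.add {f g : ℕ → ℝ} (hf : Negligible f) (hg : Negligible g) :
    Negligible fun k => f k + g k := Asymptotics.SuperpolynomialDecay.add hf hg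

theorem Negligible.const_mul {f : ℕ → ℝ} (hf : Negligible f) (c : ℝ) :
    Negligible fun k => c * f k := Asymptotics.SuperpolynomialDecay.const_mul hf c

theorem Negligible.zero : Negligible fun _ => 0 := Asymptotics.superpolynomialDecay_zero _ _

theorem Negligible.sum {κ : Type*} (s : Finset κ) {f : κ → ℕ → ℝ} (hf : ∀ i, Negligible (f i)) :
    Negligible fun k => ∑ i ∈ s, f i k := by
  classical
  induction s using Finset.induction_on with
  | empty => simpa using Negligible.zero
  | insert a s ha ih => simpa [Finset.sum_insert ha] using (hf a).add ih

theorem Negligible.pow {r : ℝ} (h0 : 0 ≤ r) (h1 : r < 1) : Negligible fun k => r ^ k :=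
  fun m => tendsto_pow_const_mul_const_pow_of_lt_one m h0 h1

/-- If a quantity is negligible for all sequences of parameters, then it is negligible uniformly in
the parameters. -/
theorem Negligible.exists_uniform {I : ℕ → Type*} [∀ k, Finite (I k)] [∀ k, Nonempty (I k)]
    {h : ∀ k, I k → ℝ} (hh : ∀ i : ∀ k, I k, Negligible fun k => h k (i k)) :
    ∃ s : ℕ → ℝ, Negligible s ∧ ∀ k i, h k i ≤ s k := by
  -- For every `k` the worst parameter is picked; this sequence is one of those covered by `hh`.
  choose i hi using fun k => Finite.exists_max (h k)
  exact ⟨_, hh i, hi⟩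

/-! ## Computational indistinguishability -/

section Indist

variable {α β : Type}

/-- The probability that `D` accepts the input `y`. -/
def acc (D : Kernel α Unit) (y : Bits α) : ℝ≥0∞ := D y fun _ => true

theorem acc_le_one (D : Kernel α Unit) (y : Bits α) : acc D y ≤ 1 := PMF.coe_le_one _ _

theorem acc_pure (g : Bits α → Bool) (y : Bits α) :
    acc (fun x => PMF.pure fun _ => g x) y = if g y then 1 else 0 := by
  classical
  rw [acc, PMF.pure_apply]
  congr 1
  exact eq_iff_iff.2 ⟨fun h => (congrFun h ()).symm, fun h => funext fun _ => h.symm⟩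

theorem acceptProb_eq (μ : PMF (Bits α)) (D : Kernel α Unit) :
    acceptProb μ D = (ev μ (acc D)).toReal := by
  rw [acceptProb, PMF.bind_apply]
  rfl

theorem ev_le_one {γ : Type*} {μ : PMF γ} {f : γ → ℝ≥0∞} (h : ∀ a, f a ≤ 1) : ev μ f ≤ 1 := ev_le h

theorem ev_ne_top {γ : Type*} {μ : PMF γ} {f : γ → ℝ≥0∞} (h : ∀ a, f a ≤ 1) : ev μ f ≠ ∞ :=
  ((ev_le_one h).trans_lt ENNReal.one_lt_top).ne

theorem abs_toReal_sub_le {a b d : ℝ≥0∞} (ha : a ≠ ∞) (hb : b ≠ ∞) (hd : d ≠ ∞) (h : a ≤ b + d)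
    (h' : b ≤ a + d) : |a.toReal - b.toReal| ≤ d.toReal := by
  have h1 := ENNReal.toReal_mono (ENNReal.add_ne_top.2 ⟨hb, hd⟩) h
  have h2 := ENNReal.toReal_mono (ENNReal.add_ne_top.2 ⟨ha, hd⟩) h'
  rw [ENNReal.toReal_add hb hd] at h1
  rw [ENNReal.toReal_add ha hd] at h2
  rw [abs_le]
  constructor <;> linarith

theorem abs_ev_sub_le {γ : Type*} (μ : PMF γ) {f g d : γ → ℝ≥0∞} (hf : ∀ a, f a ≤ 1)
    (hg : ∀ a, g a ≤ 1) (hd : ev μ d ≠ ∞) (h : ∀ a, f a ≤ g a + d a) (h' : ∀ a, g a ≤ f a + d a) :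
    |(ev μ f).toReal - (ev μ g).toReal| ≤ (ev μ d).toReal :=
  abs_toReal_sub_le (ev_ne_top hf) (ev_ne_top hg) hd ((ev_mono h).trans (ev_add _ _ _).le)
    ((ev_mono h').trans (ev_add _ _ _).le)

theorem abs_ev_sub_le_const {γ : Type*} (μ : PMF γ) {f g : γ → ℝ≥0∞} {s : ℝ} (hs : 0 ≤ s)
    (hf : ∀ a, f a ≤ 1) (hg : ∀ a, g a ≤ 1) (h : ∀ a, |(f a).toReal - (g a).toReal| ≤ s) :
    |(ev μ f).toReal - (ev μ g).toReal| ≤ s := by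
  have key : ∀ {a b : ℝ≥0∞}, a ≤ 1 → b ≤ 1 → |a.toReal - b.toReal| ≤ s →
      a ≤ b + ENNReal.ofReal s := by
    intro a b ha hb hab
    have ha' : a ≠ ∞ := (ha.trans_lt ENNReal.one_lt_top).ne
    have hb' : b ≠ ∞ := (hb.trans_lt ENNReal.one_lt_top).ne
    rw [← ENNReal.ofReal_toReal ha', ← ENNReal.ofReal_toReal hb',
      ← ENNReal.ofReal_add ENNReal.toReal_nonneg hs]
    exact ENNReal.ofReal_le_ofReal (by linarith [(abs_le.1 hab).2])
  have := abs_ev_sub_le μ (d := fun _ => ENNReal.ofReal s) hf hg (by simp)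
    (fun a => key (hf a) (hg a) (h a)) fun a => key (hg a) (hf a) (by rw [abs_sub_comm]; exact h a)
  simpa [ENNReal.toReal_ofReal hs] using this

end Indist

section Families

variable {α β : ℕ → Type} {X Y Z : ∀ k, PMF (Bits (α k))}

theorem CompIndist.refl (X : ∀ k, PMF (Bits (α k))) : CompIndist X X := fun D _ => by
  simpa using Negligible.zero

theorem CompIndist.symm (h : CompIndist X Y) : CompIndist Y X := fun D hD => by
  simpa only [abs_sub_comm] using h D hD

theorem CompIndist.trans (h : CompIndist X Y) (h' : CompIndist Y Z) : CompIndist X Z :=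
  fun D hD => ((h D hD).add (h' D hD)).mono fun k => by
    rw [abs_abs]; exact abs_sub_le _ _ _

theorem CompIndist.bind (h : CompIndist X Y) {g : ∀ k, Kernel (α k) (β k)} (hg : PPT g) :
    CompIndist (fun k => (X k).bind (g k)) fun k => (Y k).bind (g k) := by
  intro D hD
  obtain ⟨s, hs, hgs⟩ := hg.exists_comp
  obtain ⟨t, ht, hDt⟩ := hD.exists_comp
  have := h (fun k x => (g k x).bind (D k)) (PPT.of_comp (hs.add ht) fun k =>
    ((hgs k).seq (hDt k)).mono fun x => by simp)
  simpa only [acceptProb, PMF.bind_bind] using this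

/-- Averages of indistinguishable distributions are indistinguishable. -/
theorem CompIndist.average {I : ℕ → Type} [∀ k, Finite (I k)] {X Y : ∀ k, I k → PMF (Bits (α k))}
    (μ : ∀ k, PMF (I k))
    (h : ∀ i : ∀ k, I k, CompIndist (fun k => X k (i k)) fun k => Y k (i k)) :
    CompIndist (fun k => (μ k).bind (X k)) fun k => (μ k).bind (Y k) := by
  intro D hD
  have : ∀ k, Nonempty (I k) := fun k => ⟨(μ k).support_nonempty.some⟩
  obtain ⟨s, hs, hle⟩ := Negligible.exists_uniform (I := I)
    (h := fun k i => |acceptProb (X k i) (D k) - acceptProb (Y k i) (D k)|)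
    fun i => h i D hD
  refine hs.mono fun k => ?_
  rw [abs_abs, acceptProb_eq, acceptProb_eq, ev_bind, ev_bind]
  refine abs_ev_sub_le_const _ ((abs_nonneg _).trans (hle k (this k).some))
    (fun i => ev_le_one (acc_le_one _)) (fun i => ev_le_one (acc_le_one _)) fun i => ?_
  simpa only [acceptProb_eq] using hle k i

end Families

/-! ## Rewirings -/

section Rewirings

variable {α β γ δ : Type}

theorem IsRewire.id : IsRewire fun x : Bits α => x := fun b => .inl ⟨b, fun _ => rfl⟩

theorem IsRewire.const (y : Bits β) : IsRewire fun _ : Bits α => y := fun b => .inr ⟨y b, fun _ => rfl⟩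

theorem IsRewire.reindex {h : Bits α → Bits β} (hh : IsRewire h) (e : γ → β) :
    IsRewire fun x c => h x (e c) := fun c => hh (e c)

theorem IsRewire.fst {h : Bits α → Bits (β ⊕ γ)} (hh : IsRewire h) :
    IsRewire fun x => fstBits (h x) := hh.reindex _

theorem IsRewire.snd {h : Bits α → Bits (β ⊕ γ)} (hh : IsRewire h) :
    IsRewire fun x => sndBits (h x) := hh.reindex _

theorem IsRewire.pair {g : Bits α → Bits β} {h : Bits α → Bits γ} (hg : IsRewire g)
    (hh : IsRewire h) : IsRewire fun x => WOT.pair (g x) (h x) := by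
  rintro (b | c)
  · exact hg b
  · exact hh c

theorem Comp.keep_post {f : Kernel α β} {t : Bits α → ℝ≥0∞} {h : Bits (α ⊕ β) → Bits γ}
    (hf : Comp f t) (hh : IsRewire h) : Comp (fun x => (f x).map fun y => h (pair x y)) t :=
  (hf.keep.post hh).congr (fun x => by rw [PMF.map_comp]; rfl) fun _ => le_rfl

end Rewirings

/-! ## Sampling keys and ciphertexts -/

/-- `t` bounds the lengths and the running times of the encryption scheme `E`. -/
structure EncBound (E : SymEnc) (t : ℝ≥0∞) : Prop where
  keyLen : (E.keyLen : ℝ≥0∞) ≤ t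
  msgLen : (E.msgLen : ℝ≥0∞) ≤ t
  ctLen : (E.ctLen : ℝ≥0∞) ≤ t
  gen : Comp (fun _ : Bits Empty => E.gen) fun _ => t
  enc : Comp (fun x : Bits (Fin E.keyLen ⊕ Fin E.msgLen) => E.enc (fstBits x) (sndBits x))
    fun _ => t
  dec : Comp (fun x : Bits (Fin E.keyLen ⊕ Fin E.ctLen) =>
    PMF.pure (E.dec (fstBits x) (sndBits x))) fun _ => t

theorem SecureEnc.exists_bound {E : ℕ → SymEnc} (hE : SecureEnc E) :
    ∃ t, PolyLe t ∧ ∀ k, EncBound (E k) (t k) := by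
  obtain ⟨q, hq⟩ := hE.lengths
  obtain ⟨s₁, hs₁, hg⟩ := hE.gen_ppt.exists_comp
  obtain ⟨s₂, hs₂, he⟩ := hE.enc_ppt.exists_comp
  obtain ⟨s₃, hs₃, hd⟩ := hE.dec_ppt.exists_comp
  refine ⟨fun k => (q.eval k : ℕ) + (s₁ k + (s₂ k + s₃ k)),
    PolyLe.add ⟨q, fun k => le_rfl⟩ (hs₁.add (hs₂.add hs₃)), fun k => ⟨?_, ?_, ?_, ?_, ?_, ?_⟩⟩
  · exact (Nat.cast_le.2 (hq k).1).trans le_self_add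
  · exact (Nat.cast_le.2 (hq k).2.1).trans le_self_add
  · exact (Nat.cast_le.2 (hq k).2.2).trans le_self_add
  · exact (hg k).mono fun _ => le_self_add.trans le_add_self
  · exact (he k).mono fun _ => le_self_add.trans (le_add_self.trans le_add_self)
  · exact (hd k).mono fun _ => le_add_self.trans (le_add_self.trans le_add_self)

section Sampling

variable {n : ℕ}

/-- Fresh keys and the encryptions of the messages `M` under these keys. -/
def keysCts (E : SymEnc) (M : Bits (Fin n × Fin E.msgLen)) :
    PMF (Bits ((Fin n × Fin E.keyLen) ⊕ (Fin n × Fin E.ctLen))) :=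
  (piPMF fun _ : Fin n => E.gen).bind fun K =>
    (piPMF fun i => E.enc (K i) fun b => M (i, b)).map fun c =>
      pair (fun s => K s.1 s.2) fun s => c s.1 s.2

theorem comp_keysCts {E : SymEnc} {t : ℝ≥0∞} (hE : EncBound E t) :
    Comp (fun M : Bits (Fin n × Fin E.msgLen) => keysCts E M) fun _ => n * t + n * t := by
  have h1 : Comp (fun _ : Bits (Fin n × Fin E.msgLen) => (piPMF fun _ : Fin n => E.gen).map
      fun K (s : Fin n × Fin E.keyLen) => K s.1 s.2) fun _ => n * t :=
    (Comp.piProd fun _ : Fin n => hE.gen.pre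
      (IsRewire.const (α := Fin n × Fin E.msgLen) fun a : Empty => a.elim)).mono fun _ => by simp
  have h2 : Comp (fun w : Bits ((Fin n × Fin E.msgLen) ⊕ (Fin n × Fin E.keyLen)) =>
      (piPMF fun i => E.enc (fun b => sndBits w (i, b)) fun b => fstBits w (i, b)).map
        fun c (s : Fin n × Fin E.ctLen) => c s.1 s.2) fun _ => n * t :=
    (Comp.piProd fun i : Fin n => hE.enc.pre
      (((IsRewire.id (α := (Fin n × Fin E.msgLen) ⊕ (Fin n × Fin E.keyLen))).snd.reindex
        fun b => (i, b)).pair (IsRewire.id.fst.reindex fun b => (i, b)))).mono fun _ => by simp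
  refine (h1.bind_const (g := fun M K => ((piPMF fun i => E.enc (fun b => K (i, b))
    fun b => M (i, b)).map fun c (s : Fin n × Fin E.ctLen) => c s.1 s.2).map (pair K))
    ((h2.keep_post (h := fun w => pair (sndBits (fstBits w)) (sndBits w))
      (IsRewire.id.fst.snd.pair IsRewire.id.snd)).congr (fun w => rfl) fun w => le_rfl)).congr
    (fun M => ?_) fun _ => le_rfl
  rw [keysCts, PMF.bind_map]
  simp only [PMF.map_comp]
  rfl

end Sampling

/-! ## Executions of protocols -/

/-- A map between receiver states that is compatible with the moves commutes with executions. -/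
theorem interact_map {S R R' ToS ToR : Type} (sStep : Kernel (S ⊕ ToS) (S ⊕ ToR))
    {rSend : Kernel R (R ⊕ ToS)} {rRecv : Kernel (R ⊕ ToR) R}
    {rSend' : Kernel R' (R' ⊕ ToS)} {rRecv' : Kernel (R' ⊕ ToR) R'} (e : Bits R → Bits R')
    (hs : ∀ r, rSend' (e r) = (rSend r).map fun u => pair (e (fstBits u)) (sndBits u))
    (hr : ∀ r a, rRecv' (pair (e r) a) = (rRecv (pair r a)).map e) :
    ∀ (N : ℕ) (s : Bits S) (r : Bits R), interact sStep rSend' rRecv' N s (e r) =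
      (interact sStep rSend rRecv N s r).map fun f => (f.1, e f.2)
  | 0, s, r => by simp [interact, PMF.pure_map]
  | N + 1, s, r => by
    simp only [interact, hs, hr, PMF.bind_map, PMF.map_bind, Function.comp_def, fstBits_pair,
      sndBits_pair, interact_map sStep e hs hr N]

section KeySplit

variable {n : ℕ} (p : Fin n → ℕ) (E : SymEnc)
  (ot : Protocol (Parts p) (fun _ => 1) E.keyLen)

/-- The sender's first move. -/
def keySplitInit (m : Bits (Fin n × Fin E.msgLen)) :
    PMF (Bits (ot.SState ⊕ ((Fin n × Fin E.ctLen) ⊕ ot.First))) :=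
  (keysCts E m).bind fun w => (splitKeys p (fstBits w)).bind fun x =>
    (ot.sInit x).map fun a => pair (fstBits a) (pair (sndBits w) (sndBits a))

theorem keySplit_sInit (m : Bits (Fin n × Fin E.msgLen)) :
    (keySplitProtocol p E ot).sInit m = keySplitInit p E ot m := by
  simp only [keySplitInit, keysCts, splitKeys, PMF.bind_bind, PMF.bind_map, Function.comp_def,
    fstBits_pair, sndBits_pair]
  rfl

variable {p E}

/-- The receiver's states consist of the choice set, the ciphertexts, and a state of the oblivious
transfer. -/
def embedState (σ : Bits (Fin n)) (c : Bits (Fin n × Fin E.ctLen)) (r : Bits ot.RState) :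
    Bits (Fin n ⊕ ((Fin n × Fin E.ctLen) ⊕ ot.RState)) :=
  pair σ (pair c r)

theorem keySplit_interact {S : Type} (sStep : Kernel (S ⊕ ot.ToS) (S ⊕ ot.ToR)) (σ : Bits (Fin n))
    (c : Bits (Fin n × Fin E.ctLen)) (N : ℕ) (s : Bits S) (r : Bits ot.RState) :
    interact (R := Fin n ⊕ ((Fin n × Fin E.ctLen) ⊕ ot.RState)) (ToS := ot.ToS) (ToR := ot.ToR)
        sStep
        (keySplitProtocol p E ot).rSend (keySplitProtocol p E ot).rRecv N s (embedState ot σ c r) =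
      (interact sStep ot.rSend ot.rRecv N s r).map fun f => (f.1, embedState ot σ c f.2) :=
  interact_map sStep (embedState ot σ c) (fun _ => rfl) (fun _ _ => rfl) N s r

variable (p E)

theorem ones_cast {a b : ℕ} (h : a = b) (P : Bits (Fin b)) :
    ones (fun j => P (Fin.cast h j)) = ones P := by
  subst h; rfl

theorem price_parts (σ : Bits (Fin n)) :
    price (fun _ : Parts p => 1) (fun s => σ s.1) = price p σ := by
  simp only [price, Fintype.sum_sigma]
  refine Finset.sum_congr rfl fun i _ => ?_
  by_cases h : σ i = true <;> simp [h]

/-- The weighted transfer is an honest run of the underlying transfer on random key parts, followed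
by decryption. Hence the correctness of that transfer applies to every outcome of the sampling. -/
theorem honestRun_keySplit (m : Bits (Fin n × Fin E.msgLen)) (σ : Bits (Fin n)) :
    honestRun (keySplitProtocol p E ot) m σ = (keysCts E m).bind fun w =>
      (splitKeys p (fstBits w)).bind fun x =>
        (honestRun ot x fun s => σ s.1).map fun o => (o.1, fun t =>
          σ t.1 && E.dec (xorAll fun j b => o.2 (⟨t.1, j⟩, b)) (fun b => sndBits w (t.1, b)) t.2) := by
  -- Unfolding by definition, with the receiver's initial state displayed as `embedState`, so that
  -- `keySplit_interact` can rewrite the rounds.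
  have h : honestRun (keySplitProtocol p E ot) m σ =
      PMF.bind (α := Bits (ot.SState ⊕ ((Fin n × Fin E.ctLen) ⊕ ot.First)))
        ((keySplitProtocol p E ot).sInit m) fun a =>
      ((ot.rInit (pair (fun s => σ s.1) (sndBits (sndBits a)))).map
        (embedState ot σ (fstBits (sndBits a)))).bind fun r =>
      (interact (R := Fin n ⊕ ((Fin n × Fin E.ctLen) ⊕ ot.RState)) (ToS := ot.ToS)
        (ToR := ot.ToR) ot.sStep
        (keySplitProtocol p E ot).rSend (keySplitProtocol p E ot).rRecv ot.rounds
        (fstBits a) r).bind fun f =>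
      ((ot.sOut f.1).map fun P j => P (Fin.cast (total_parts p).symm j)).bind fun P =>
      ((ot.rOut (sndBits (sndBits f.2))).map fun x (t : Fin n × Fin E.msgLen) =>
        fstBits f.2 t.1 && E.dec (xorAll fun j b => x (⟨t.1, j⟩, b))
          (fun b => fstBits (sndBits f.2) (t.1, b)) t.2).map fun y => (ones P, y) := rfl
  rw [h, keySplit_sInit, keySplitInit]
  simp only [PMF.bind_bind, PMF.map_bind, PMF.bind_map, PMF.map_comp, Function.comp_def,
    sndBits_pair, fstBits_pair, keySplit_interact, honestRun, ones_cast]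
  rfl

theorem correct_keySplit {p : Fin n → ℕ} (hp : ∀ i, 1 ≤ p i) {E : ℕ → SymEnc}
    (hE : SecureEnc E) {ot : ∀ k, Protocol (Parts p) (fun _ => 1) (E k).keyLen}
    (hot : Correct ot) : Correct fun k => keySplitProtocol p (E k) (ot k) := by
  intro k m σ o ho
  rw [honestRun_keySplit] at ho
  simp only [PMF.mem_support_bind_iff, PMF.mem_support_map_iff, keysCts, splitKeys] at ho
  obtain ⟨w, ⟨K, hK, c, hc, rfl⟩, _, ⟨x, hx, rfl⟩, o', ho', rfl⟩ := ho
  rw [mem_support_piPMF] at hK hc hx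
  obtain ⟨h1, h2⟩ := hot k _ _ o' ho'
  refine ⟨h1.trans (price_parts p σ), fun i hi b => ?_⟩
  have hkey : (xorAll fun j b => o'.2 (⟨i, j⟩, b)) = K i := by
    -- At least one part is needed: an empty XOR would give the zero key.
    refine Eq.trans ?_ (xorAll_of_mem_support (hp i) (hx i))
    congr 1
    funext j b
    exact h2 ⟨i, j⟩ hi b
  simp only [hi, hkey, Bool.true_and, sndBits_pair]
  exact congrFun (hE.correct k _ (hK i) _ _ (hc i)) b

/-! ### Receiver's privacy -/

variable {p E ot}

/-- The strategy against the oblivious transfer of a sender of the weighted transfer. -/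
def SenderStrategy.toOT {Aux : Type} (A : SenderStrategy (keySplitProtocol p E ot) Aux) :
    SenderStrategy ot Aux where
  State := A.State
  init := fun z => (A.init z).map fun a => pair (fstBits a) (sndBits (sndBits a))
  step := A.step

theorem view_embedState {S : Type} (μ : PMF (Bits (S ⊕ ((Fin n × Fin E.ctLen) ⊕ ot.First))))
    (step : Kernel (S ⊕ ot.ToS) (S ⊕ ot.ToR)) (σ : Bits (Fin n)) :
    (μ.bind fun a =>
      ((ot.rInit (pair (fun s => σ s.1) (sndBits (sndBits a)))).map
        (embedState ot σ (fstBits (sndBits a)))).bind fun r =>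
      (interact (R := Fin n ⊕ ((Fin n × Fin E.ctLen) ⊕ ot.RState)) (ToS := ot.ToS) (ToR := ot.ToR)
        step (keySplitProtocol p E ot).rSend (keySplitProtocol p E ot).rRecv ot.rounds
        (fstBits a) r).map fun f => f.1) =
      (μ.map fun a => pair (fstBits a) (sndBits (sndBits a))).bind fun a =>
      (ot.rInit (pair (fun s => σ s.1) (sndBits a))).bind fun r =>
      (interact step ot.rSend ot.rRecv ot.rounds (fstBits a) r).map fun f => f.1 := by
  simp only [PMF.bind_map, PMF.map_comp, Function.comp_def, sndBits_pair, fstBits_pair,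
    keySplit_interact]

/-- Choice set and ciphertexts sit in the receiver's state and influence no message beyond the
choice of parts. The views agree exactly, so computational and unconditional privacy are both
inherited. -/
theorem senderView_keySplit {Aux : Type} (A : SenderStrategy (keySplitProtocol p E ot) Aux)
    (z : Bits Aux) (σ : Bits (Fin n)) :
    senderView (keySplitProtocol p E ot) A z σ = senderView ot A.toOT z fun s => σ s.1 :=
  view_embedState (A.init z) A.step σ

theorem receiverPrivacy_keySplit {E : ℕ → SymEnc}
    {ot : ∀ k, Protocol (Parts p) (fun _ => 1) (E k).keyLen} (hot : ReceiverPrivacy ot) :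
    ReceiverPrivacy fun k => keySplitProtocol p (E k) (ot k) := by
  intro Aux _ A hi hs z σ τ hστ
  simp only [senderView_keySplit]
  refine hot Aux (fun k => (A k).toOT) ?_ hs z _ _ fun k => ?_
  · obtain ⟨t, ht, h⟩ := hi.exists_comp
    exact PPT.of_comp ht fun k => (h k).post
      (IsRewire.id.fst.pair IsRewire.id.snd.snd)
  · rw [price_parts, price_parts, hστ]

theorem unconditionalReceiverPrivacy_keySplit {E : ℕ → SymEnc}
    {ot : ∀ k, Protocol (Parts p) (fun _ => 1) (E k).keyLen} (hot : UnconditionalReceiverPrivacy ot) :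
    UnconditionalReceiverPrivacy fun k => keySplitProtocol p (E k) (ot k) := by
  intro k Aux _ A z σ τ hστ
  simp only [senderView_keySplit]
  exact hot k Aux A.toOT z _ _ (by rw [price_parts, price_parts, hστ])

end KeySplit

/-! ## Efficiency of the protocol -/

section Efficiency

variable {n : ℕ} {p : Fin n → ℕ} {E : SymEnc} {ot : Protocol (Parts p) (fun _ => 1) E.keyLen}

theorem comp_keySplitInit {C : ℕ} (hC : ∀ κ : ℕ,
    Comp (fun K : Bits (Fin n × Fin κ) => splitKeys p K) fun _ => (C * κ : ℕ))
    {s t : ℝ≥0∞} (hE : EncBound E t) (h : Comp ot.sInit fun _ => s) :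
    Comp (fun m => keySplitInit p E ot m) fun _ => n * t + n * t + (C * t + s) := by
  have h1 : Comp (fun w : Bits ((Fin n × Fin E.msgLen) ⊕ ((Fin n × Fin E.keyLen) ⊕
      (Fin n × Fin E.ctLen))) => splitKeys p (fstBits (sndBits w))) fun _ => C * t :=
    ((hC E.keyLen).pre IsRewire.id.snd.fst).mono fun _ => by
      push_cast
      exact mul_le_mul_right hE.keyLen _
  have h2 : Comp (fun w : Bits (((Fin n × Fin E.msgLen) ⊕ ((Fin n × Fin E.keyLen) ⊕
      (Fin n × Fin E.ctLen))) ⊕ (Parts p × Fin E.keyLen)) => (ot.sInit (sndBits w)).map fun a =>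
        pair (fstBits a) (pair (sndBits (sndBits (fstBits w))) (sndBits a))) fun _ => s :=
    (h.pre IsRewire.id.snd).keep_post (IsRewire.id.snd.fst.pair
      (IsRewire.id.fst.fst.snd.snd.pair IsRewire.id.snd.snd))
  exact (comp_keysCts hE).bind_const (g := fun _ w => (splitKeys p (fstBits w)).bind fun x =>
    (ot.sInit x).map fun a => pair (fstBits a) (pair (sndBits w) (sndBits a)))
    (h1.bind_const (g := fun w x => (ot.sInit x).map fun a =>
      pair (fstBits a) (pair (sndBits (sndBits w)) (sndBits a))) h2)

theorem comp_keySplit_sOut {s : ℝ≥0∞} (h : Comp ot.sOut fun _ => s) :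
    Comp (keySplitProtocol p E ot).sOut fun _ => s :=
  h.post (IsRewire.id.reindex (Fin.cast (total_parts p).symm))

theorem comp_keySplit_rInit {s : ℝ≥0∞} (h : Comp ot.rInit fun _ => s) :
    Comp (keySplitProtocol p E ot).rInit fun _ => s := by
  have : Comp (fun x : Bits (Fin n ⊕ ((Fin n × Fin E.ctLen) ⊕ ot.First)) =>
      (ot.rInit (pair (fun s => fstBits x s.1) (sndBits (sndBits x)))).map fun r =>
        pair (fstBits x) (pair (fstBits (sndBits x)) r)) fun _ => s :=
    (h.pre ((IsRewire.id.fst.reindex Sigma.fst).pair IsRewire.id.snd.snd)).keep_post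
      (IsRewire.id.fst.fst.pair (IsRewire.id.fst.snd.fst.pair IsRewire.id.snd))
  exact this

theorem comp_keySplit_rSend {s : ℝ≥0∞} (h : Comp ot.rSend fun _ => s) :
    Comp (keySplitProtocol p E ot).rSend fun _ => s := by
  have : Comp (fun x : Bits (Fin n ⊕ ((Fin n × Fin E.ctLen) ⊕ ot.RState)) =>
      (ot.rSend (sndBits (sndBits x))).map fun u =>
        pair (pair (fstBits x) (pair (fstBits (sndBits x)) (fstBits u))) (sndBits u)) fun _ => s :=
    (h.pre IsRewire.id.snd.snd).keep_post
      ((IsRewire.id.fst.fst.pair (IsRewire.id.fst.snd.fst.pair IsRewire.id.snd.fst)).pair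
        IsRewire.id.snd.snd)
  exact this

theorem comp_keySplit_rRecv {s : ℝ≥0∞} (h : Comp ot.rRecv fun _ => s) :
    Comp (keySplitProtocol p E ot).rRecv fun _ => s := by
  have : Comp (fun x : Bits ((Fin n ⊕ ((Fin n × Fin E.ctLen) ⊕ ot.RState)) ⊕ ot.ToR) =>
      (ot.rRecv (pair (sndBits (sndBits (fstBits x))) (sndBits x))).map fun r =>
        pair (fstBits (fstBits x)) (pair (fstBits (sndBits (fstBits x))) r)) fun _ => s :=
    (h.pre (IsRewire.id.fst.snd.snd.pair IsRewire.id.snd)).keep_post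
      (IsRewire.id.fst.fst.fst.pair (IsRewire.id.fst.fst.snd.fst.pair IsRewire.id.snd))
  exact this

/-- The three summands after `s` pay for the XOR of the parts, the `n` decryptions, and the blanking
of the items that were not chosen. -/
theorem comp_keySplit_rOut {s t : ℝ≥0∞} (hE : EncBound E t) (h : Comp ot.rOut fun _ => s) :
    Comp (keySplitProtocol p E ot).rOut
      fun _ => s + (n * t * gateBound (Parts p) + (n * t + n * t * gateBound Bool)) := by
  let S := Fin n ⊕ ((Fin n × Fin E.ctLen) ⊕ ot.RState)
  have h1 : Comp (fun w : Bits (S ⊕ (Parts p × Fin E.keyLen)) => PMF.pure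
      fun t : Fin n × Fin E.keyLen => xorFn fun j => sndBits w (⟨t.1, j⟩, t.2))
      fun _ => n * t * gateBound (Parts p) := by
    refine Comp.mono (Comp.local (Parts p) fun s => ⟨fun a => .inr (a, s.2),
      fun y => xorFn fun j => y ⟨s.1, j⟩, fun x => rfl⟩) fun _ => ?_
    rw [Nat.card_eq_fintype_card, Fintype.card_prod, Fintype.card_fin, Fintype.card_fin]
    push_cast
    gcongr
    exact hE.keyLen
  have h2 : Comp (fun w : Bits ((S ⊕ (Parts p × Fin E.keyLen)) ⊕ (Fin n × Fin E.keyLen)) => PMF.pure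
      fun t : Fin n × Fin E.msgLen => E.dec (fun b => sndBits w (t.1, b))
        (fun b => fstBits (sndBits (fstBits (fstBits w))) (t.1, b)) t.2)
      fun _ => n * t := by
    refine (Comp.piProd fun i : Fin n => hE.dec.pre
      ((IsRewire.id.snd.reindex fun b => (i, b)).pair
        (IsRewire.id.fst.fst.snd.fst.reindex fun b => (i, b)))).congr (fun w => ?_) fun w => ?_
    · rw [piPMF_pure, PMF.pure_map]
      rfl
    · simp
  have h3 : Comp (fun w : Bits (((S ⊕ (Parts p × Fin E.keyLen)) ⊕ (Fin n × Fin E.keyLen)) ⊕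
      (Fin n × Fin E.msgLen)) => PMF.pure
      fun t : Fin n × Fin E.msgLen => fstBits (fstBits (fstBits (fstBits w))) t.1 && sndBits w t)
      fun _ => n * t * gateBound Bool := by
    refine Comp.mono (Comp.local Bool fun s =>
      ⟨fun a => bif a then .inr s else .inl (.inl (.inl (.inl s.1))),
      fun y => y false && y true, fun x => rfl⟩) fun _ => ?_
    rw [Nat.card_eq_fintype_card, Fintype.card_prod, Fintype.card_fin, Fintype.card_fin]
    push_cast
    gcongr
    exact hE.msgLen
  have : Comp (fun w : Bits S => (ot.rOut (sndBits (sndBits w))).map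
      fun x (t : Fin n × Fin E.msgLen) => fstBits w t.1 &&
        E.dec (xorAll fun j b => x (⟨t.1, j⟩, b)) (fun b => fstBits (sndBits w) (t.1, b)) t.2)
      fun _ => s + (n * t * gateBound (Parts p) + (n * t + n * t * gateBound Bool)) := by
    refine ((h.pre (IsRewire.id (α := S)).snd.snd).bind_const (g := fun w x => PMF.pure
      fun t : Fin n × Fin E.msgLen => fstBits w t.1 &&
        E.dec (xorAll fun j b => x (⟨t.1, j⟩, b)) (fun b => fstBits (sndBits w) (t.1, b)) t.2)
      ?_).congr (fun w => rfl) fun _ => le_rfl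
    refine (h1.bind_const (g := fun w K => PMF.pure
      fun t : Fin n × Fin E.msgLen => fstBits (fstBits w) t.1 &&
        E.dec (fun b => K (t.1, b)) (fun b => fstBits (sndBits (fstBits w)) (t.1, b)) t.2)
      ?_).congr (fun w => ?_) fun _ => le_rfl
    · refine (h2.bind_const (g := fun w m => PMF.pure
        fun t : Fin n × Fin E.msgLen => fstBits (fstBits (fstBits w)) t.1 && m t)
        h3).congr (fun w => ?_) fun _ => le_rfl
      rw [PMF.pure_bind]
    · rw [PMF.pure_bind]
      rfl
  exact this

theorem efficient_keySplit {E : ℕ → SymEnc} (hE : SecureEnc E)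
    {ot : ∀ k, Protocol (Parts p) (fun _ => 1) (E k).keyLen} (hot : Efficient ot) :
    Efficient fun k => keySplitProtocol p (E k) (ot k) := by
  obtain ⟨t, ht, hEt⟩ := hE.exists_bound
  obtain ⟨C, hC⟩ := exists_comp_splitKeys p
  refine ⟨hot.rounds, ?_, hot.sStep, ?_, ?_, ?_, ?_, ?_⟩
  · obtain ⟨s, hs, h⟩ := hot.sInit.exists_comp
    refine PPT.congr (f := fun k m => keySplitInit p (E k) (ot k) m) (PPT.of_comp
      ((((PolyLe.const n).mul ht).add ((PolyLe.const n).mul ht)).add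
        (((PolyLe.const C).mul ht).add hs)) fun k => comp_keySplitInit hC (hEt k) (h k))
      fun k m => (keySplit_sInit p (E k) (ot k) m).symm
  · obtain ⟨s, hs, h⟩ := hot.sOut.exists_comp
    exact PPT.of_comp hs fun k => comp_keySplit_sOut (h k)
  · obtain ⟨s, hs, h⟩ := hot.rInit.exists_comp
    exact PPT.of_comp hs fun k => comp_keySplit_rInit (h k)
  · obtain ⟨s, hs, h⟩ := hot.rSend.exists_comp
    exact PPT.of_comp hs fun k => comp_keySplit_rSend (h k)
  · obtain ⟨s, hs, h⟩ := hot.rRecv.exists_comp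
    exact PPT.of_comp hs fun k => comp_keySplit_rRecv (h k)
  · obtain ⟨s, hs, h⟩ := hot.rOut.exists_comp
    have hn := (PolyLe.const n).mul ht
    exact PPT.of_comp (hs.add ((hn.mul (PolyLe.const _)).add (hn.add (hn.mul (PolyLe.const _)))))
      fun k => comp_keySplit_rOut (hEt k) (h k)

end Efficiency

/-! ## Replacing the encrypted messages -/

section Hybrid

variable {n : ℕ}

/-- Keys and ciphertexts, where only the keys in `J` are revealed. -/
def maskedKeysCts (E : SymEnc) (J : Bits (Fin n)) (M : Bits (Fin n × Fin E.msgLen)) :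
    PMF (Bits ((Fin n × Fin E.keyLen) ⊕ (Fin n × Fin E.ctLen))) :=
  (keysCts E M).map fun w => pair (maskKeys J (fstBits w)) (sndBits w)

/-- The key (if it is revealed) and the ciphertext of one message. -/
def keyCt (E : SymEnc) (r : Bool) (m : Bits (Fin E.msgLen)) :
    PMF (Bits (Fin E.keyLen ⊕ Fin E.ctLen)) :=
  E.gen.bind fun K => (E.enc K m).map fun c => pair (fun b => r && K b) c

theorem maskedKeysCts_eq (E : SymEnc) (J : Bits (Fin n)) (M : Bits (Fin n × Fin E.msgLen)) :
    maskedKeysCts E J M = (piPMF fun i => keyCt E (J i) fun b => M (i, b)).map fun y =>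
      pair (fun s => y s.1 (.inl s.2)) fun s => y s.1 (.inr s.2) := by
  simp only [keyCt, ← piPMF_bind (fun _ : Fin n => E.gen), ← piPMF_map, maskedKeysCts, keysCts,
    PMF.map_bind, PMF.map_comp]
  rfl

/-- Put a ciphertext in place of the `i`-th ciphertext. -/
def replaceCt {κ ℓ : ℕ} (i : Fin n) (w : Bits ((Fin n × Fin κ) ⊕ (Fin n × Fin ℓ)))
    (c : Bits (Fin ℓ)) : Bits ((Fin n × Fin κ) ⊕ (Fin n × Fin ℓ)) :=
  pair (fstBits w) fun s => if s.1 = i then c s.2 else sndBits w s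

/-- Since the key of item `i` is hidden, its ciphertext is independent of everything else and may be
replaced by one made under a fresh, external key. -/
theorem maskedKeysCts_replace {E : SymEnc} {J : Bits (Fin n)} {M M' : Bits (Fin n × Fin E.msgLen)}
    {i : Fin n} (hJ : J i = false) (hM : ∀ j, j ≠ i → ∀ b, M' (j, b) = M (j, b)) :
    maskedKeysCts E J M' = (maskedKeysCts E J M).bind fun w =>
      (E.gen.bind fun K => E.enc K fun b => M' (i, b)).map (replaceCt i w) := by
  have h : (fun j => keyCt E (J j) fun b => M' (j, b)) =
      Function.update (fun j => keyCt E (J j) fun b => M (j, b)) i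
        ((E.gen.bind fun K => E.enc K fun b => M' (i, b)).map fun c => pair (fun _ => false) c) := by
    funext j
    by_cases hj : j = i
    · subst hj
      simp [keyCt, hJ, PMF.map_bind]
    · simp [hj, hM]
  -- `replaceCt` keeps the key wires of item `i`, which is harmless because the mask makes them
  -- zero.
  have hsupp : ∀ y ∈ (piPMF fun j => keyCt E (J j) fun b => M (j, b)).support, ∀ b,
      y i (.inl b) = false := by
    intro y hy b
    have := (mem_support_piPMF _ y).1 hy i
    simp only [keyCt, hJ, PMF.mem_support_bind_iff, PMF.mem_support_map_iff] at this
    obtain ⟨K, -, c, -, h⟩ := this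
    rw [← h]
    rfl
  rw [maskedKeysCts_eq, h, ← piPMF_update, maskedKeysCts_eq, PMF.map_bind, PMF.bind_map]
  refine pmf_bind_congr fun y hy => ?_
  rw [PMF.map_comp, PMF.map_comp, Function.comp_apply]
  congr 1
  funext c s
  rcases s with ⟨j, b⟩ | ⟨j, b⟩
  · by_cases hj : j = i
    · subst hj
      simp [replaceCt, hsupp y hy b]
    · simp [replaceCt, hj]
  · by_cases hj : j = i
    · subst hj
      simp [replaceCt]
    · simp [replaceCt, hj]

theorem isRewire_replaceCt {κ ℓ : ℕ} (i : Fin n) :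
    IsRewire fun w : Bits (Fin ℓ ⊕ ((Fin n × Fin κ) ⊕ (Fin n × Fin ℓ))) =>
      replaceCt i (sndBits w) (fstBits w) := by
  refine IsRewire.id.snd.fst.pair fun s => ?_
  by_cases hs : s.1 = i
  · exact .inl ⟨.inl s.2, fun x => by simp [hs, fstBits]⟩
  · exact .inl ⟨.inr (.inr s), fun x => by simp [hs, sndBits]⟩

theorem comp_maskedKeysCts {E : SymEnc} {t : ℝ≥0∞} (hE : EncBound E t) (J : Bits (Fin n))
    (M : Bits (Fin n × Fin E.msgLen)) {α : Type} :
    Comp (fun _ : Bits α => maskedKeysCts E J M) fun _ => n * t + n * t := by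
  refine ((comp_keysCts hE).pre (IsRewire.const M)).post (IsRewire.pair (fun s => ?_) IsRewire.id.snd)
  cases hs : J s.1
  · exact .inr ⟨false, fun x => by simp [maskKeys, hs]⟩
  · exact .inl ⟨.inl s, fun x => by simp [maskKeys, hs, fstBits]⟩

variable {E : ℕ → SymEnc}

/-- Reduction to the security of the encryption: everything except the `i`-th ciphertext is sampled
by the new distinguisher, which puts its challenge in that place. -/
theorem compIndist_replace_one (hE : SecureEnc E) {J : ℕ → Bits (Fin n)}
    {M M' : ∀ k, Bits (Fin n × Fin (E k).msgLen)} (i : Fin n)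
    (h : ∀ k, J k i = true → ∀ b, M' k (i, b) = M k (i, b))
    (hM : ∀ k j, j ≠ i → ∀ b, M' k (j, b) = M k (j, b)) :
    CompIndist (fun k => maskedKeysCts (E k) (J k) (M k))
      fun k => maskedKeysCts (E k) (J k) (M' k) := by
  intro D hD
  obtain ⟨t, ht, hEt⟩ := hE.exists_bound
  obtain ⟨s, hs, hDs⟩ := hD.exists_comp
  let D' : ∀ k, Kernel (Fin (E k).ctLen) Unit := fun k c =>
    (maskedKeysCts (E k) (J k) (M k)).bind fun w => D k (replaceCt i w c)
  have hD' : PPT D' := PPT.of_comp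
    ((((PolyLe.const n).mul ht).add ((PolyLe.const n).mul ht)).add hs) fun k =>
      (comp_maskedKeysCts (hEt k) (J k) (M k)).bind_const (g := fun c w => D k (replaceCt i w c))
        ((hDs k).pre (isRewire_replaceCt i))
  have key := hE.secure (fun k b => M k (i, b)) (fun k b => M' k (i, b)) D' hD'
  have hacc : ∀ k (c : PMF (Bits (Fin (E k).ctLen))), acceptProb c (D' k) =
      acceptProb ((maskedKeysCts (E k) (J k) (M k)).bind fun w => c.map (replaceCt i w)) (D k) := by
    intro k c
    simp only [acceptProb, D', PMF.bind_bind, PMF.bind_map, Function.comp_def]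
    rw [PMF.bind_comm]
  refine key.mono fun k => ?_
  rw [abs_abs]
  -- `J` varies with `k`: where key `i` is hidden, the reduction applies, and where it is revealed,
  -- the two message vectors coincide.
  cases hk : J k i
  · rw [hacc, hacc, ← maskedKeysCts_replace hk (hM k), ← maskedKeysCts_replace hk fun _ _ _ => rfl]
  · have : M' k = M k := by
      funext s
      obtain ⟨j, b⟩ := s
      by_cases hj : j = i
      · subst hj; exact h k hk b
      · exact hM k j hj b
    simp [this]

/-- If two message vectors agree wherever the key is revealed, then the keys and ciphertexts are
indistinguishable. -/
theorem compIndist_maskedKeysCts (hE : SecureEnc E) {J : ℕ → Bits (Fin n)}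
    {M M' : ∀ k, Bits (Fin n × Fin (E k).msgLen)}
    (h : ∀ k i, J k i = true → ∀ b, M' k (i, b) = M k (i, b)) :
    CompIndist (fun k => maskedKeysCts (E k) (J k) (M k))
      fun k => maskedKeysCts (E k) (J k) (M' k) := by
  classical
  have key : ∀ T : Finset (Fin n), CompIndist (fun k => maskedKeysCts (E k) (J k) (M k))
      fun k => maskedKeysCts (E k) (J k) fun s => if s.1 ∈ T then M' k s else M k s := by
    intro T
    induction T using Finset.induction_on with
    | empty => simpa using CompIndist.refl _
    | insert i T hi ih =>
      refine ih.trans (compIndist_replace_one hE i (fun k hk b => ?_) fun k j hj b => ?_)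
      · simp [hi, h k i hk b]
      · simp [hj]
  simpa using key Finset.univ

end Hybrid

/-! ## Malicious receivers -/

section Receiver

variable {n : ℕ} {p : Fin n → ℕ}

/-- The wires of a request to the trusted party of the oblivious transfer. -/
abbrev Request (p : Fin n → ℕ) : Type := Parts p ⊕ Fin (total fun _ : Parts p => 1)

/-- Identify the prices of the oblivious transfer with those of the weighted transfer. -/
def castPrice {S : Type} (y : Bits (Fin (total fun _ : Parts p => 1) ⊕ S)) :
    Bits (Fin (total p) ⊕ S) :=
  pair (fun j => fstBits y (Fin.cast (total_parts p).symm j)) (sndBits y)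

theorem isRewire_castPrice {S : Type} : IsRewire (castPrice (p := p) (S := S)) :=
  (IsRewire.id.fst.reindex _).pair IsRewire.id.snd

/-! ### Malicious receivers as receivers of the underlying transfer. -/

section OneParameter

variable {E : SymEnc} {ot : Protocol (Parts p) (fun _ => 1) E.keyLen} {Aux : Type}

/-- The strategy against the oblivious transfer of a receiver of the weighted transfer; the
ciphertexts become part of the auxiliary input. -/
def ReceiverStrategy.toOT (A : ReceiverStrategy (keySplitProtocol p E ot) Aux) :
    ReceiverStrategy ot (Aux ⊕ (Fin n × Fin E.ctLen)) where
  State := A.State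
  init := fun w => A.init (pair (fstBits (fstBits w)) (pair (sndBits (fstBits w)) (sndBits w)))
  send := A.send
  recv := A.recv

theorem run_keySplitInit {S : Type} (init : Bits ((Fin n × Fin E.ctLen) ⊕ ot.First) → PMF (Bits S))
    (send : Kernel S (S ⊕ ot.ToS)) (recv : Kernel (S ⊕ ot.ToR) S)
    (m : Bits (Fin n × Fin E.msgLen)) :
    ((keySplitInit p E ot m).bind fun a => (init (sndBits a)).bind fun r =>
      (interact ot.sStep send recv ot.rounds (fstBits a) r).bind fun f =>
      ((ot.sOut f.1).map fun P j => P (Fin.cast (total_parts p).symm j)).map fun P =>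
        pair (unary (total p) (ones P)) f.2) =
    (keysCts E m).bind fun w => (splitKeys p (fstBits w)).bind fun x =>
      ((ot.sInit x).bind fun a => (init (pair (sndBits w) (sndBits a))).bind fun r =>
        (interact ot.sStep send recv ot.rounds (fstBits a) r).bind fun f =>
        (ot.sOut f.1).map fun P =>
          pair (unary (total fun _ : Parts p => 1) (ones P)) f.2).map (castPrice (p := p)) := by
  simp only [keySplitInit, PMF.bind_bind, PMF.map_bind, PMF.bind_map, PMF.map_comp,
    Function.comp_def, sndBits_pair, fstBits_pair, ones_cast]
  rfl

/-- The ciphertexts do not depend on the run of the underlying transfer, so they can be moved into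
the auxiliary input of its receiver. -/
theorem realRun_keySplit (A : ReceiverStrategy (keySplitProtocol p E ot) Aux) (z : Bits Aux)
    (m : Bits (Fin n × Fin E.msgLen)) :
    realRun (keySplitProtocol p E ot) A z m =
      (keysCts E m).bind fun w => (splitKeys p (fstBits w)).bind fun x =>
        (realRun ot A.toOT (pair z (sndBits w)) x).map (castPrice (p := p)) := by
  refine Eq.trans ?_ (run_keySplitInit (fun a => A.init (pair z a)) A.send A.recv m)
  rw [← keySplit_sInit]
  rfl

/-- The items are those of the trusted party of the oblivious transfer. -/
def hybridRun {Out : Type} (E : SymEnc) (B : Simulator (fun _ : Parts p => 1) E.keyLen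
    (Aux ⊕ (Fin n × Fin E.ctLen)) Out) (z : Bits Aux) (m : Bits (Fin n × Fin E.msgLen)) :
    PMF (Bits (Fin (total p) ⊕ Out)) :=
  (keysCts E m).bind fun w => (splitKeys p (fstBits w)).bind fun x =>
    (idealRun B (pair z (sndBits w)) x).map (castPrice (p := p))

end OneParameter

theorem ReceiverPPT.toOT {E : ℕ → SymEnc} {ot : ∀ k, Protocol (Parts p) (fun _ => 1) (E k).keyLen}
    {Aux : ℕ → Type} {A : ∀ k, ReceiverStrategy (keySplitProtocol p (E k) (ot k)) (Aux k)}
    (hA : ReceiverPPT (Q := fun k => keySplitProtocol p (E k) (ot k)) A) :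
    ReceiverPPT (Q := ot) fun k => (A k).toOT := by
  refine ⟨?_, hA.send, hA.recv⟩
  obtain ⟨t, ht, h⟩ := hA.init.exists_comp
  exact PPT.of_comp ht fun k => (h k).pre
    (IsRewire.id.fst.fst.pair (IsRewire.id.fst.snd.pair IsRewire.id.snd))

/-- The hypothesis concerns fixed auxiliary inputs and fixed items. It survives averaging over
random ciphertexts and key parts by `CompIndist.average`, and relabelling the price wires by
`CompIndist.bind`. -/
theorem compIndist_bind_castPrice {E : ℕ → SymEnc} {Aux S : ℕ → Type}
    {X Y : ∀ k, Bits (Aux k ⊕ (Fin n × Fin (E k).ctLen)) → Bits (Parts p × Fin (E k).keyLen) →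
      PMF (Bits (Fin (total fun _ : Parts p => 1) ⊕ S k))}
    (h : ∀ (z : ∀ k, Bits (Aux k ⊕ (Fin n × Fin (E k).ctLen)))
      (x : ∀ k, Bits (Parts p × Fin (E k).keyLen)),
      CompIndist (fun k => X k (z k) (x k)) fun k => Y k (z k) (x k))
    (z : ∀ k, Bits (Aux k)) (m : ∀ k, Bits (Fin n × Fin (E k).msgLen)) :
    CompIndist (fun k => (keysCts (E k) (m k)).bind fun w => (splitKeys p (fstBits w)).bind fun x =>
        (X k (pair (z k) (sndBits w)) x).map (castPrice (p := p)))
      fun k => (keysCts (E k) (m k)).bind fun w => (splitKeys p (fstBits w)).bind fun x =>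
        (Y k (pair (z k) (sndBits w)) x).map (castPrice (p := p)) := by
  let μ : ∀ k, PMF (Bits (Fin n × Fin (E k).ctLen) × Bits (Parts p × Fin (E k).keyLen)) := fun k =>
    (keysCts (E k) (m k)).bind fun w => (splitKeys p (fstBits w)).map fun x => (sndBits w, x)
  have hg : PPT (α := fun k => Fin (total fun _ : Parts p => 1) ⊕ S k)
      (β := fun k => Fin (total p) ⊕ S k) fun _ y => PMF.pure (castPrice y) :=
    PPT.of_comp (PolyLe.const 0) fun k => (Comp.rewire isRewire_castPrice).mono fun _ => zero_le
  have h := CompIndist.average (I := fun k => Bits (Fin n × Fin (E k).ctLen) ×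
    Bits (Parts p × Fin (E k).keyLen)) (X := fun k i => X k (pair (z k) i.1) i.2)
    (Y := fun k i => Y k (pair (z k) i.1) i.2) μ fun i =>
      h (fun k => pair (z k) (i k).1) fun k => (i k).2
  have h := h.bind hg
  have e : ∀ X : ∀ k, Bits (Aux k ⊕ (Fin n × Fin (E k).ctLen)) →
      Bits (Parts p × Fin (E k).keyLen) → PMF (Bits (Fin (total fun _ : Parts p => 1) ⊕ S k)),
      (fun k => ((μ k).bind fun i => X k (pair (z k) i.1) i.2).bind fun y =>
        PMF.pure (castPrice (p := p) y)) = fun k => (keysCts (E k) (m k)).bind fun w =>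
        (splitKeys p (fstBits w)).bind fun x => (X k (pair (z k) (sndBits w)) x).map (castPrice (p := p)) := by
    intro X
    funext k
    simp only [μ, PMF.bind_bind, PMF.bind_map]
    rfl
  rwa [e, e] at h

theorem compIndist_hybridRun {E : ℕ → SymEnc}
    {ot : ∀ k, Protocol (Parts p) (fun _ => 1) (E k).keyLen} {Aux : ℕ → Type}
    {A : ∀ k, ReceiverStrategy (keySplitProtocol p (E k) (ot k)) (Aux k)}
    {B : ∀ k, Simulator (fun _ : Parts p => 1) (E k).keyLen (Aux k ⊕ (Fin n × Fin (E k).ctLen))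
      (A k).State}
    (hB : ∀ (z : ∀ k, Bits (Aux k ⊕ (Fin n × Fin (E k).ctLen)))
      (x : ∀ k, Bits (Parts p × Fin (E k).keyLen)), CompIndist
      (fun k => realRun (ot k) (A k).toOT (z k) (x k)) fun k => idealRun (B k) (z k) (x k))
    (z : ∀ k, Bits (Aux k)) (m : ∀ k, Bits (Fin n × Fin (E k).msgLen)) :
    CompIndist (fun k => realRun (keySplitProtocol p (E k) (ot k)) (A k) (z k) (m k))
      fun k => hybridRun (E k) (B k) (z k) (m k) := by
  have h := compIndist_bind_castPrice (S := fun k => (A k).State)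
    (X := fun k => realRun (ot k) (A k).toOT) (Y := fun k => idealRun (B k)) hB z m
  have e : (fun k => realRun (keySplitProtocol p (E k) (ot k)) (A k) (z k) (m k)) = fun k =>
      (keysCts (E k) (m k)).bind fun w => (splitKeys p (fstBits w)).bind fun x =>
        (realRun (ot k) (A k).toOT (pair (z k) (sndBits w)) x).map (castPrice (p := p)) :=
    funext fun k => realRun_keySplit (A k) (z k) (m k)
  rw [e]
  exact h

/-! ## The simulator of the oblivious transfer -/

/-- The parts that the trusted party returns. -/
def visible (r : Bits (Request p)) : Bits (Parts p) := fun s =>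
  decide (price (fun _ => 1) (fstBits r) ≤ ones (sndBits r)) && fstBits r s

section Simulation

variable {E : SymEnc} {Aux Out : Type}
  (B : Simulator (fun _ : Parts p => 1) E.keyLen (Aux ⊕ (Fin n × Fin E.ctLen)) Out)

theorem answered_eq (x : Bits (Parts p × Fin E.keyLen)) (u : Bits (B.State ⊕ Request p)) :
    B.answered x u = pair (fstBits u) (maskParts (visible (sndBits u)) x) := rfl

/-- Share the given keys and finish the simulation. -/
def finishKernel : Kernel ((Fin n × Fin E.keyLen) ⊕ (B.State ⊕ Request p)) Out := fun w =>
  (splitKeys p (fstBits w)).bind fun x => B.finish.run (B.answered x (sndBits w))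

/-- The expected running time of the end of the simulation. -/
def finishCost (w : Bits ((Fin n × Fin E.keyLen) ⊕ (B.State ⊕ Request p))) : ℝ≥0∞ :=
  ev (splitKeys p (fstBits w)) fun x => B.finish.cost (B.answered x (sndBits w))

/-- Only the keys whose parts are all visible matter. -/
theorem finishKernel_mask {J : Bits (Fin n)} {u : Bits (B.State ⊕ Request p)}
    (hJ : ∀ i, J i = false → ∃ j, visible (sndBits u) ⟨i, j⟩ = false)
    (K : Bits (Fin n × Fin E.keyLen)) :
    finishKernel B (pair (maskKeys J K) u) = finishKernel B (pair K u) := by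
  have h : ∀ L : Bits (Fin n × Fin E.keyLen), finishKernel B (pair L u) =
      ((splitKeys p L).map (maskParts (visible (sndBits u)))).bind fun x =>
        B.finish.run (pair (fstBits u) x) := by
    intro L
    rw [PMF.bind_map]
    rfl
  rw [h, h, splitKeys_mask hJ]

/-- The output of the ideal model, when the receiver has sent the given request. -/
def reportPrice (r : Bits (Request p)) (y : Bits Out) : Bits (Fin (total p) ⊕ Out) :=
  pair (unary (total p) (ones (sndBits r))) y

/-- The request depends on the ciphertexts but not on the key parts, so the sharing of the keys can
be postponed until after the request. -/
theorem hybridRun_eq (z : Bits Aux) (m : Bits (Fin n × Fin E.msgLen)) :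
    hybridRun E B z m = (keysCts E m).bind fun w =>
      (B.choose.run (pair z (sndBits w))).bind fun u =>
        (finishKernel B (pair (fstBits w) u)).map (reportPrice (sndBits u)) := by
  rw [hybridRun]
  refine congrArg _ (funext fun w => ?_)
  simp only [idealRun, PMF.map_bind, PMF.map_comp, finishKernel]
  rw [PMF.bind_comm]
  rfl

variable {B}

theorem choose_cost_le {s : ℝ≥0∞} (hB : ∀ x, B.cost x ≤ s)
    (z : Bits (Aux ⊕ (Fin n × Fin E.ctLen))) : B.choose.cost z ≤ s :=
  le_self_add.trans (hB (z, fun _ => false))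

/-- The bound on the cost of `B` holds for every list of parts. Averaging over the list and
exchanging the expectations preserves it. -/
theorem ev_finishCost_le {s : ℝ≥0∞} (hB : ∀ x, B.cost x ≤ s) (K : Bits (Fin n × Fin E.keyLen))
    (z : Bits (Aux ⊕ (Fin n × Fin E.ctLen))) :
    (ev (B.choose.run z) fun u => finishCost B (pair K u)) ≤ s := by
  simp only [finishCost, fstBits_pair, sndBits_pair]
  rw [ev_comm]
  exact ev_le fun x => le_add_self.trans (hB (z, x))

theorem comp_choose {s : ℝ≥0∞} (hB : ∀ x, B.cost x ≤ s) : Comp B.choose.run fun _ => s :=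
  ⟨B.choose, rfl, choose_cost_le hB⟩

/-- Only the masking of the parts needs new gates. The term `finishCost B w` has to remain, because
`B.finish` is cheap only on average over the requests of `B.choose`. -/
theorem comp_finishKernel {C : ℕ} (hC : ∀ κ : ℕ,
    Comp (fun K : Bits (Fin n × Fin κ) => splitKeys p K) fun _ => (C * κ : ℕ))
    {t : ℝ≥0∞} (hE : EncBound E t) :
    Comp (finishKernel B) fun w =>
      C * t + total p * t * gateBound (Option (Request p)) + finishCost B w := by
  have hκ := hE.keyLen
  have h1 : Comp (fun w : Bits ((Fin n × Fin E.keyLen) ⊕ (B.State ⊕ Request p)) =>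
      splitKeys p (fstBits w)) fun _ => C * t :=
    ((hC E.keyLen).pre IsRewire.id.fst).mono fun _ => by
      push_cast
      exact mul_le_mul_right hκ _
  have h2 : Comp (fun w : Bits (((Fin n × Fin E.keyLen) ⊕ (B.State ⊕ Request p)) ⊕
      (Parts p × Fin E.keyLen)) => PMF.pure
        (maskParts (visible (sndBits (sndBits (fstBits w)))) (sndBits w)))
      fun _ => total p * t * gateBound (Option (Request p)) := by
    refine Comp.mono (Comp.local (Option (Request p)) fun a =>
      ⟨fun o => o.elim (.inr a) fun c => .inl (.inr (.inr c)),
        fun y => visible (p := p) (fun c => y (some c)) a.1 && y none, fun x => rfl⟩) fun _ => ?_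
    rw [Nat.card_eq_fintype_card, Fintype.card_prod, Fintype.card_sigma]
    simp only [Fintype.card_fin, total]
    push_cast
    gcongr
  have h3 : Comp (fun w : Bits (((Fin n × Fin E.keyLen) ⊕ (B.State ⊕ Request p)) ⊕
      (Parts p × Fin E.keyLen)) => B.finish.run (B.answered (sndBits w) (sndBits (fstBits w))))
      fun w => total p * t * gateBound (Option (Request p)) +
        B.finish.cost (B.answered (sndBits w) (sndBits (fstBits w))) := by
    have h4 : Comp (fun w : Bits ((((Fin n × Fin E.keyLen) ⊕ (B.State ⊕ Request p)) ⊕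
        (Parts p × Fin E.keyLen)) ⊕ (Parts p × Fin E.keyLen)) =>
        B.finish.run (pair (fstBits (sndBits (fstBits (fstBits w)))) (sndBits w)))
        fun w => B.finish.cost (pair (fstBits (sndBits (fstBits (fstBits w)))) (sndBits w)) :=
      Comp.pre ⟨B.finish, rfl, fun _ => le_rfl⟩ (IsRewire.id.fst.fst.snd.fst.pair IsRewire.id.snd)
    refine (h2.bind (g := fun w x => B.finish.run (pair (fstBits (sndBits (fstBits w))) x))
      (t := fun w x => B.finish.cost (pair (fstBits (sndBits (fstBits w))) x)) h4).congr
      (fun w => ?_) fun w => ?_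
    · rw [PMF.pure_bind]
      rfl
    · rw [ev_pure]
      rfl
  refine (h1.bind (g := fun w x => B.finish.run (B.answered x (sndBits w)))
    (t := fun w x => total p * t * gateBound (Option (Request p)) +
      B.finish.cost (B.answered x (sndBits w))) h3).congr (fun w => rfl) fun w => ?_
  rw [ev_add, ev_const, add_assoc]
  rfl

/-- Finish the simulation after the first move, run a distinguisher, and test the request. -/
def testKernel (B : Simulator (fun _ : Parts p => 1) E.keyLen (Aux ⊕ (Fin n × Fin E.ctLen)) Out)
    (z : Bits Aux) (D : Kernel (Fin (total p) ⊕ Out) Unit) (test : Bits (Request p) → Bool) :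
    Kernel ((Fin n × Fin E.keyLen) ⊕ (Fin n × Fin E.ctLen)) Unit := fun w =>
  (B.choose.run (pair z (sndBits w))).bind fun u =>
    (finishKernel B (pair (fstBits w) u)).bind fun y =>
      (D (reportPrice (sndBits u) y)).map fun d _ => test (sndBits u) && d ()

theorem acc_testKernel (z : Bits Aux) (D : Kernel (Fin (total p) ⊕ Out) Unit)
    (test : Bits (Request p) → Bool)
    (w : Bits ((Fin n × Fin E.keyLen) ⊕ (Fin n × Fin E.ctLen))) :
    acc (testKernel B z D test) w = ev (B.choose.run (pair z (sndBits w))) fun u =>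
      if test (sndBits u) then
        ev (finishKernel B (pair (fstBits w) u)) fun y => acc D (reportPrice (sndBits u) y)
      else 0 := by
  classical
  unfold testKernel
  rw [acc, PMF.bind_apply]
  refine tsum_congr fun u => congrArg _ ?_
  rw [PMF.bind_apply]
  dsimp only
  split_ifs with h
  · refine tsum_congr fun y => congrArg _ ?_
    have hid : (fun (d : Bits Unit) (_ : Unit) => true && d ()) = id := by
      funext d c
      simp
    rw [h, hid, PMF.map_id]
    rfl
  · simp only [h, Bool.false_and]
    refine ENNReal.tsum_eq_zero.2 fun y => ?_
    rw [map_eq_bind, PMF.bind_const, PMF.pure_apply, if_neg, mul_zero]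
    intro h
    simpa using congrFun h ()

/-- The bound no longer depends on the input, since the request is drawn inside the kernel. `s`
appears twice because each phase of `B` is charged the full budget. -/
theorem comp_testKernel {C : ℕ} (hC : ∀ κ : ℕ,
    Comp (fun K : Bits (Fin n × Fin κ) => splitKeys p K) fun _ => (C * κ : ℕ))
    {s t d : ℝ≥0∞} (hE : EncBound E t) (hB : ∀ x, B.cost x ≤ s) (z : Bits Aux)
    {D : Kernel (Fin (total p) ⊕ Out) Unit} (hD : Comp D fun _ => d)
    (test : Bits (Request p) → Bool) :
    Comp (testKernel B z D test) fun _ =>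
      s + (C * t + total p * t * gateBound (Option (Request p)) + s +
        (total p * gateBound (Request p) + (d + gateBound (Option (Request p))))) := by
  let W := (Fin n × Fin E.keyLen) ⊕ (Fin n × Fin E.ctLen)
  let U := B.State ⊕ Request p
  have h1 : Comp (fun w : Bits ((((W ⊕ U) ⊕ Out) ⊕ Fin (total p)) ⊕ Unit) => PMF.pure fun _ : Unit =>
      test (sndBits (sndBits (fstBits (fstBits (fstBits w))))) && sndBits w ())
      fun _ => gateBound (Option (Request p)) := by
    refine Comp.mono (Comp.local (Option (Request p)) fun _ =>
      ⟨fun o => o.elim (.inr ()) fun c => .inl (.inl (.inl (.inr (.inr c)))),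
        fun y => test (fun c => y (some c)) && y none, fun x => rfl⟩) fun _ => ?_
    simp
  have h2 : Comp (fun w : Bits (((W ⊕ U) ⊕ Out) ⊕ Fin (total p)) =>
      (D (pair (sndBits w) (sndBits (fstBits w)))).bind fun b => PMF.pure fun _ : Unit =>
        test (sndBits (sndBits (fstBits (fstBits w)))) && b ())
      fun _ => d + gateBound (Option (Request p)) :=
    (hD.pre (IsRewire.id.snd.pair IsRewire.id.fst.snd)).bind_const
      (g := fun w b => PMF.pure fun _ : Unit =>
        test (sndBits (sndBits (fstBits (fstBits w)))) && b ()) h1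
  have h3 : Comp (fun w : Bits ((W ⊕ U) ⊕ Out) => PMF.pure
      (unary (total p) (ones (sndBits (sndBits (sndBits (fstBits w)))))))
      fun _ => total p * gateBound (Request p) := by
    refine Comp.mono (Comp.local (Request p) fun j => ⟨fun c => .inl (.inr (.inr c)),
      fun y => unary (total p) (ones (sndBits y)) j, fun x => rfl⟩) fun _ => ?_
    simp
  have h4 : Comp (fun w : Bits ((W ⊕ U) ⊕ Out) =>
      (D (reportPrice (sndBits (sndBits (fstBits w))) (sndBits w))).map fun b _ =>
        test (sndBits (sndBits (fstBits w))) && b ())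
      fun _ => total p * gateBound (Request p) + (d + gateBound (Option (Request p))) :=
    (h3.bind_const (g := fun w pr => (D (pair pr (sndBits w))).bind fun b => PMF.pure
      fun _ : Unit => test (sndBits (sndBits (fstBits w))) && b ()) h2).congr
      (fun w => by rw [PMF.pure_bind]; rfl) fun _ => le_rfl
  have h5 : Comp (fun w : Bits (W ⊕ U) => (finishKernel B (pair (fstBits (fstBits w)) (sndBits w))).bind
      fun y => (D (reportPrice (sndBits (sndBits w)) y)).map fun b (_ : Unit) =>
        test (sndBits (sndBits w)) && b ())
      fun w => C * t + total p * t * gateBound (Option (Request p)) +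
        finishCost B (pair (fstBits (fstBits w)) (sndBits w)) +
        (total p * gateBound (Request p) + (d + gateBound (Option (Request p)))) :=
    (((comp_finishKernel (B := B) hC hE).pre (IsRewire.id.fst.fst.pair IsRewire.id.snd)).bind
      (g := fun w y => (D (reportPrice (sndBits (sndBits w)) y)).map fun b (_ : Unit) =>
        test (sndBits (sndBits w)) && b ())
      (t := fun _ _ => total p * gateBound (Request p) + (d + gateBound (Option (Request p))))
      h4).mono fun w => by rw [ev_const]
  refine (((comp_choose hB).pre ((IsRewire.const z).pair (IsRewire.id (α := W)).snd)).bind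
    (g := fun w u => (finishKernel B (pair (fstBits w) u)).bind
      fun y => (D (reportPrice (sndBits u) y)).map fun b (_ : Unit) => test (sndBits u) && b ())
    (t := fun w u => C * t + total p * t * gateBound (Option (Request p)) +
        finishCost B (pair (fstBits w) u) +
        (total p * gateBound (Request p) + (d + gateBound (Option (Request p))))) h5).congr
    (fun w => rfl) fun w => ?_
  rw [ev_add, ev_add, ev_const, ev_const]
  gcongr
  exact ev_finishCost_le hB _ _

end Simulation

end Receiver

/-! ## Loops -/

section Loops

variable {α β γ : Type}

/-- A bit string with a flag. -/
def withFlag (f : Bool) (y : Bits β) : Bits (Option β) := fun o => o.elim f y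

theorem flagProb_eq (μ : PMF (Bits (Option β))) :
    flagProb μ = ev μ fun y => if y none then 1 else 0 :=
  tsum_congr fun y => by simp

theorem ev_repeatUntil {μ : PMF (Bits (Option β))} (h : flagProb μ ≠ 0) (φ : Bits β → ℝ≥0∞) :
    ev (repeatUntil μ) φ =
      (ev μ fun y => if y none then φ (fun b => y (some b)) else 0) / flagProb μ := by
  have hex : ∃ y ∈ {y : Bits (Option β) | y none = true}, y ∈ μ.support := by
    by_contra hne
    push Not at hne
    refine h (ENNReal.tsum_eq_zero.2 fun y => ?_)
    split_ifs with hy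
    · simpa using hne y hy
    · rfl
  have hs : ∑' y, ({y : Bits (Option β) | y none = true}).indicator μ y = flagProb μ :=
    tsum_congr fun y => by simp [Set.indicator_apply]
  rw [repeatUntil, dif_pos hex, ev_map, ENNReal.div_eq_inv_mul, ← ev_const_mul]
  refine tsum_congr fun y => ?_
  rw [PMF.filter_apply, hs, Set.indicator_apply]
  by_cases hy : y none = true
  · simp only [Set.mem_ofPred_eq, hy, if_true]
    ring
  · simp [hy]

theorem flagProb_map (ν : PMF γ) (f : γ → Bool) (g : γ → Bits β) :
    flagProb (ν.map fun c => withFlag (f c) (g c)) = ev ν fun c => if f c then 1 else 0 := by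
  rw [flagProb_eq, ev_map]
  rfl

theorem ev_repeatUntil_map (ν : PMF γ) (f : γ → Bool) (g : γ → Bits β)
    (h : (ev ν fun c => if f c then 1 else 0) ≠ 0) (φ : Bits β → ℝ≥0∞) :
    ev (repeatUntil (ν.map fun c => withFlag (f c) (g c))) φ =
      (ev ν fun c => if f c then φ (g c) else 0) / ev ν fun c => if f c then 1 else 0 := by
  rw [ev_repeatUntil (by rwa [flagProb_map]), flagProb_map, ev_map]
  rfl

/-- A single bit. -/
def bit (b : Bool) : Bits Unit := fun _ => b

theorem ev_unit (μ : PMF (Bits Unit)) (f : Bits Unit → ℝ≥0∞) :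
    ev μ f = μ (bit true) * f (bit true) + μ (bit false) * f (bit false) := by
  unfold ev
  rw [← (Equiv.funUnique Unit Bool).symm.tsum_eq, tsum_bool, add_comm]
  rfl

theorem ev_flip (f : Bits Unit → ℝ≥0∞) :
    ev (piPMF fun _ : Unit => PMF.uniformOfFintype Bool) f =
      2⁻¹ * (f (bit true) + f (bit false)) := by
  rw [ev_unit, mul_add]
  simp [piPMF_apply]

theorem apply_eq_ev_unit (μ : PMF (Bits Unit)) (b : Bool) :
    μ (bit b) = ev μ fun y => if y () = b then 1 else 0 := by
  rw [ev_unit]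
  cases b <;> simp [bit]

end Loops

/-! ### Ones -/

theorem ones_unary {N a : ℕ} (h : a ≤ N) : ones (unary N a) = a := by
  simp only [ones, unary, decide_eq_true_eq, Finset.sum_boole, Nat.cast_id]
  rw [Fin.card_filter_val_lt, min_eq_right h]

theorem ones_le {N : ℕ} (x : Bits (Fin N)) : ones x ≤ N := by
  simp only [ones, Finset.sum_boole, Nat.cast_id]
  exact (Finset.card_filter_le _ _).trans (by simp)

/-! ### The request to the trusted party of the weighted transfer. -/

section Verdict

variable {n : ℕ} {p : Fin n → ℕ}

/-- The request to the trusted party of the weighted transfer: the items all of whose key parts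
are visible, and the payment. -/
def verdict (r : Bits (Request p)) : Bits (Fin n ⊕ Fin (total p)) :=
  pair (fun i => decide (∀ j, visible r ⟨i, j⟩ = true)) (unary (total p) (ones (sndBits r)))

theorem ones_verdict (r : Bits (Request p)) : ones (sndBits (verdict r)) = ones (sndBits r) :=
  ones_unary ((ones_le _).trans (total_parts p).le)

theorem exists_invisible {r : Bits (Request p)} {i : Fin n} (h : fstBits (verdict r) i = false) :
    ∃ j, visible r ⟨i, j⟩ = false := by
  simpa [verdict] using h

theorem visible_of_le {r : Bits (Request p)}
    (h : price (fun _ => 1) (fstBits r) ≤ ones (sndBits r)) : visible r = fstBits r := by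
  funext s
  simp only [visible, decide_eq_true h, Bool.true_and]

theorem visible_of_not_le {r : Bits (Request p)}
    (h : ¬price (fun _ => 1) (fstBits r) ≤ ones (sndBits r)) : visible r = fun _ => false := by
  funext s
  simp only [visible, decide_eq_false h, Bool.false_and]

/-- An item of weight `p i` in the verdict has `p i` visible parts, so its price is paid by these
parts. Their number is at most the payment if the request is affordable, and zero otherwise. -/
theorem price_verdict_le (r : Bits (Request p)) :
    price p (fstBits (verdict r)) ≤ ones (sndBits (verdict r)) := by
  have h1 : price p (fstBits (verdict r)) ≤ price (fun _ => 1) (visible r) := by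
    rw [← price_parts]
    refine Finset.sum_le_sum fun s _ => ?_
    dsimp only
    split_ifs with h h'
    · exact le_rfl
    · refine absurd ?_ h'
      have := of_decide_eq_true h
      exact this s.2
    · simp
    · exact le_rfl
  refine h1.trans ?_
  rw [ones_verdict]
  by_cases hle : price (fun _ => 1) (fstBits r) ≤ ones (sndBits r)
  · rwa [visible_of_le hle]
  · simp [price, visible_of_not_le hle]

end Verdict

/-! ## The simulator of the weighted transfer -/

section Simulator

variable {n : ℕ} {p : Fin n → ℕ} {E : SymEnc} {Aux Out : Type}
  (B : Simulator (fun _ : Parts p => 1) E.keyLen (Aux ⊕ (Fin n × Fin E.ctLen)) Out)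

/-- Encrypt the given messages and let the simulator of the oblivious transfer send its request;
the output consists of the keys, the state and the request. -/
def stage : Kernel (Aux ⊕ (Fin n × Fin E.msgLen))
    ((Fin n × Fin E.keyLen) ⊕ (B.State ⊕ Request p)) := fun x =>
  (keysCts E (sndBits x)).bind fun w =>
    (B.choose.run (pair (fstBits x) (sndBits w))).map fun u => pair (fstBits w) u

/-- The input of the second phase of the simulator: the auxiliary input, the request and the items
that the trusted party has returned. -/
abbrev Phase (p : Fin n → ℕ) (E : SymEnc) (Aux : Type) : Type :=
  (Aux ⊕ (Fin n ⊕ Fin (total p))) ⊕ (Fin n × Fin E.msgLen)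

/-- Run the first stage again, with the returned items (if the bit is set) or zeros as messages,
and raise the flag if the request is the same as before. -/
def trial : Kernel (Unit ⊕ Phase p E Aux)
    (Option ((Fin n × Fin E.keyLen) ⊕ (B.State ⊕ Request p))) := fun x =>
  (stage B (pair (fstBits (fstBits (sndBits x)))
    fun i => fstBits x () && sndBits (sndBits x) i)).map fun y =>
      withFlag (decide (verdict (sndBits (sndBits y)) = sndBits (fstBits (sndBits x)))) y

/-- A trial with a random choice between the returned items and zeros; the output is the choice. -/
def coinTrial : Kernel (Phase p E Aux) (Option Unit) := fun w =>
  (piPMF fun _ : Unit => PMF.uniformOfFintype Bool).bind fun b =>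
    (trial B (pair b w)).map fun y => withFlag (y none) b

/-- Decide whether to continue with the returned items: this is the case if one of `T` successful
trials used them. -/
def guess : ℕ → Kernel (Phase p E Aux) Unit
  | 0 => fun _ => PMF.pure (bit false)
  | T + 1 => fun w => (guess T w).bind fun g =>
      (repeatUntil (coinTrial B w)).bind fun b => PMF.pure fun _ => g () || b ()

/-- The second phase of the simulator. -/
def simFinish (T : ℕ) : Kernel (Phase p E Aux) Out := fun w =>
  (guess B T w).bind fun g => (repeatUntil (trial B (pair g w))).bind (finishKernel B)

/-- The first phase of the simulator. -/
def simChoose : Kernel Aux ((Aux ⊕ (Fin n ⊕ Fin (total p))) ⊕ (Fin n ⊕ Fin (total p))) := fun z =>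
  (stage B (pair z fun _ => false)).map fun y =>
    pair (pair z (verdict (sndBits (sndBits y)))) (verdict (sndBits (sndBits y)))

variable {B}

/-! ### Cost bounds for the loops and phases of the simulator. -/

section Cost

variable {s t : ℝ≥0∞}

theorem comp_stage (hE : EncBound E t) (hB : ∀ x, B.cost x ≤ s) :
    Comp (stage B) fun _ => n * t + n * t + s := by
  let A := Aux ⊕ (Fin n × Fin E.msgLen)
  have h1 : Comp (fun w : Bits (A ⊕ ((Fin n × Fin E.keyLen) ⊕ (Fin n × Fin E.ctLen))) =>
      (B.choose.run (pair (fstBits (fstBits w)) (sndBits (sndBits w)))).map fun u =>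
        pair (fstBits (sndBits w)) u) fun _ => s :=
    ((comp_choose hB).pre (IsRewire.id.fst.fst.pair IsRewire.id.snd.snd)).keep_post
      (IsRewire.id.fst.snd.fst.pair IsRewire.id.snd)
  exact ((comp_keysCts hE).pre (IsRewire.id (α := A)).snd).bind_const
    (g := fun x w => (B.choose.run (pair (fstBits x) (sndBits w))).map fun u => pair (fstBits w) u) h1

theorem comp_trial (hE : EncBound E t) (hB : ∀ x, B.cost x ≤ s) :
    Comp (trial B) fun _ => n * t * gateBound Bool + (n * t + n * t + s +
      gateBound (Request p ⊕ (Fin n ⊕ Fin (total p)))) := by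
  let A := Unit ⊕ Phase p E Aux
  let Y := (Fin n × Fin E.keyLen) ⊕ (B.State ⊕ Request p)
  have h1 : Comp (fun x : Bits A => PMF.pure fun i : Fin n × Fin E.msgLen =>
      fstBits x () && sndBits (sndBits x) i) fun _ => n * t * gateBound Bool := by
    refine Comp.mono (Comp.local Bool fun i => ⟨fun a => bif a then .inl () else .inr (.inr i),
      fun y => y true && y false, fun x => rfl⟩) fun _ => ?_
    rw [Nat.card_eq_fintype_card, Fintype.card_prod, Fintype.card_fin, Fintype.card_fin]
    push_cast
    gcongr
    exact hE.msgLen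
  have h2 : Comp (fun x : Bits ((A ⊕ (Fin n × Fin E.msgLen)) ⊕ Y) => PMF.pure (bit
      (decide (verdict (sndBits (sndBits (sndBits x))) =
        sndBits (fstBits (sndBits (fstBits (fstBits x))))))))
      fun _ => gateBound (Request p ⊕ (Fin n ⊕ Fin (total p))) := by
    refine Comp.mono (Comp.local (Request p ⊕ (Fin n ⊕ Fin (total p))) fun _ =>
      ⟨fun a => Sum.elim (fun c => .inr (.inr (.inr c)))
          (fun c => .inl (.inl (.inr (.inl (.inr c))))) a,
        fun y => decide (verdict (fstBits y) = sndBits y), fun x => rfl⟩) fun _ => ?_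
    simp
  have h3 : Comp (fun x : Bits ((A ⊕ (Fin n × Fin E.msgLen)) ⊕ Y) => PMF.pure
      (withFlag (decide (verdict (sndBits (sndBits (sndBits x))) =
        sndBits (fstBits (sndBits (fstBits (fstBits x)))))) (sndBits x)))
      fun _ => gateBound (Request p ⊕ (Fin n ⊕ Fin (total p))) := by
    refine (h2.keep_post (h := fun w => withFlag (sndBits w ()) (sndBits (fstBits w))) ?_).congr
      (fun x => ?_) fun _ => le_rfl
    · rintro (_ | b)
      · exact .inl ⟨.inr (), fun _ => rfl⟩
      · exact .inl ⟨.inl (.inr b), fun _ => rfl⟩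
    · rw [PMF.pure_map]
      rfl
  have h4 : Comp (fun x : Bits (A ⊕ (Fin n × Fin E.msgLen)) =>
      (stage B (pair (fstBits (fstBits (sndBits (fstBits x)))) (sndBits x))).bind fun y => PMF.pure
        (withFlag (decide (verdict (sndBits (sndBits y)) =
          sndBits (fstBits (sndBits (fstBits x))))) y))
      fun _ => n * t + n * t + s + gateBound (Request p ⊕ (Fin n ⊕ Fin (total p))) :=
    ((comp_stage hE hB).pre (IsRewire.id.fst.snd.fst.fst.pair IsRewire.id.snd)).bind_const
      (g := fun x y => PMF.pure (withFlag (decide (verdict (sndBits (sndBits y)) =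
          sndBits (fstBits (sndBits (fstBits x))))) y)) h3
  refine (h1.bind_const (g := fun x M =>
    (stage B (pair (fstBits (fstBits (sndBits x))) M)).bind fun y => PMF.pure
      (withFlag (decide (verdict (sndBits (sndBits y)) = sndBits (fstBits (sndBits x)))) y))
    h4).congr (fun x => ?_) fun _ => le_rfl
  rw [PMF.pure_bind]
  rfl

theorem comp_coinTrial {c : ℝ≥0∞} (h : Comp (trial B) fun _ => c) :
    Comp (coinTrial B) fun _ => 1 + c := by
  have h1 : Comp (fun x : Bits (Phase p E Aux ⊕ Unit) =>
      (trial B (pair (sndBits x) (fstBits x))).map fun y => withFlag (y none) (sndBits x))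
      fun _ => c := by
    refine (h.pre (IsRewire.id.snd.pair IsRewire.id.fst)).keep_post
      (h := fun w => withFlag (sndBits w none) (sndBits (fstBits w))) ?_
    rintro (_ | b)
    · exact .inl ⟨.inr none, fun _ => rfl⟩
    · exact .inl ⟨.inl (.inr b), fun _ => rfl⟩
  have h2 := (Comp.flips (α := Phase p E Aux) (β := Unit)).bind_const
    (g := fun w b => (trial B (pair b w)).map fun y => withFlag (y none) b) h1
  exact h2.mono fun _ => by simp

theorem comp_guess {c : ℝ≥0∞} (h : Comp (coinTrial B) fun _ => c) : ∀ T : ℕ,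
    Comp (guess B T) fun w => T * ((1 + c) / flagProb (coinTrial B w) + gateBound Bool)
  | 0 => (Comp.rewire (IsRewire.const _)).mono fun _ => zero_le
  | T + 1 => by
    let A := Phase p E Aux
    have h1 : Comp (fun x : Bits ((A ⊕ Unit) ⊕ Unit) =>
        PMF.pure fun _ : Unit => sndBits (fstBits x) () || sndBits x ()) fun _ => gateBound Bool := by
      refine Comp.mono (Comp.local Bool fun _ => ⟨fun a => bif a then .inr () else .inl (.inr ()),
        fun y => y false || y true, fun x => rfl⟩) fun _ => ?_
      simp
    have h2 : Comp (fun x : Bits (A ⊕ Unit) => (repeatUntil (coinTrial B (fstBits x))).bind fun b =>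
        PMF.pure fun _ : Unit => sndBits x () || b ())
        fun x => (1 + c) / flagProb (coinTrial B (fstBits x)) + gateBound Bool :=
      ((h.loop.pre IsRewire.id.fst).bind (g := fun x b =>
        PMF.pure fun _ : Unit => sndBits x () || b ()) (t := fun _ _ => gateBound Bool) h1).mono
        fun x => by rw [ev_const]
    refine ((comp_guess h T).bind (g := fun w g => (repeatUntil (coinTrial B w)).bind fun b =>
      PMF.pure fun _ : Unit => g () || b ())
      (t := fun w _ => (1 + c) / flagProb (coinTrial B w) + gateBound Bool) h2).mono fun w => ?_
    rw [ev_const]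
    push_cast
    rw [add_mul, one_mul]

/-- The bound depends on the input `w` and can be infinite for verdicts that never recur. It becomes
polynomial only after weighting by the probability that `w` arises. -/
theorem comp_simFinish {c d : ℝ≥0∞} (h : Comp (trial B) fun _ => c)
    (hf : Comp (finishKernel B) fun w => d + finishCost B w) (T : ℕ) :
    Comp (simFinish B T) fun w =>
      T * ((1 + (1 + c)) / flagProb (coinTrial B w) + gateBound Bool) +
        ev (guess B T w) fun g => (1 + c) / flagProb (trial B (pair g w)) +
          ev (repeatUntil (trial B (pair g w))) fun y => d + finishCost B y :=
  (comp_guess (comp_coinTrial h) T).bind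
    (g := fun w g => (repeatUntil (trial B (pair g w))).bind (finishKernel B))
    (t := fun w g => (1 + c) / flagProb (trial B (pair g w)) +
      ev (repeatUntil (trial B (pair g w))) fun y => d + finishCost B y)
    ((h.loop.seq hf).pre (IsRewire.id.snd.pair IsRewire.id.fst))

theorem comp_simChoose (hE : EncBound E t) (hB : ∀ x, B.cost x ≤ s) :
    Comp (simChoose B) fun _ => n * t + n * t + s +
      (n + total p : ℕ) * gateBound (Request p) := by
  let Y := (Fin n × Fin E.keyLen) ⊕ (B.State ⊕ Request p)
  have h1 : Comp (fun w : Bits (Aux ⊕ Y) => PMF.pure (verdict (sndBits (sndBits (sndBits w)))))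
      fun _ => (n + total p : ℕ) * gateBound (Request p) := by
    refine Comp.mono (Comp.local (Request p) fun v => ⟨fun c => .inr (.inr (.inr c)),
      fun y => verdict y v, fun x => rfl⟩) fun _ => ?_
    simp
  have h2 : Comp (fun w : Bits (Aux ⊕ Y) => PMF.pure
      (pair (pair (fstBits w) (verdict (sndBits (sndBits (sndBits w)))))
        (verdict (sndBits (sndBits (sndBits w))))))
      fun _ => (n + total p : ℕ) * gateBound (Request p) :=
    (h1.keep_post ((IsRewire.id.fst.fst.pair IsRewire.id.snd).pair IsRewire.id.snd)).congr
      (fun w => by rw [PMF.pure_map]; rfl) fun _ => le_rfl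
  exact ((comp_stage hE hB).pre (IsRewire.id.pair (IsRewire.const _))).bind_const
    (g := fun z y => PMF.pure (pair (pair z (verdict (sndBits (sndBits y))))
      (verdict (sndBits (sndBits y))))) h2

end Cost

end Simulator

section Simulator

variable {n : ℕ} {p : Fin n → ℕ} {E : SymEnc} {Aux Out : Type}
  (B : Simulator (fun _ : Parts p => 1) E.keyLen (Aux ⊕ (Fin n × Fin E.ctLen)) Out)

/-! ### Success probabilities of the loops -/

/-- The expectation of `φ` after a trial, restricted to successful trials. -/
def trialEv (b : Bool) (w : Bits (Phase p E Aux))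
    (φ : Bits ((Fin n × Fin E.keyLen) ⊕ (B.State ⊕ Request p)) → ℝ≥0∞) : ℝ≥0∞ :=
  ev (stage B (pair (fstBits (fstBits w)) fun i => b && sndBits w i)) fun y =>
    if decide (verdict (sndBits (sndBits y)) = sndBits (fstBits w)) then φ y else 0

/-- The success probability of a trial. -/
def trialProb (b : Bool) (w : Bits (Phase p E Aux)) : ℝ≥0∞ := trialEv B b w fun _ => 1

theorem trialEv_le {b : Bool} {w : Bits (Phase p E Aux)}
    (φ : Bits ((Fin n × Fin E.keyLen) ⊕ (B.State ⊕ Request p)) → ℝ≥0∞) : trialEv B b w φ ≤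
      ev (stage B (pair (fstBits (fstBits w)) fun i => b && sndBits w i)) φ :=
  ev_mono fun y => by split_ifs <;> simp

theorem trialProb_le_one (b : Bool) (w : Bits (Phase p E Aux)) : trialProb B b w ≤ 1 :=
  (trialEv_le B _).trans (by rw [ev_const])

theorem trialProb_ne_top (b : Bool) (w : Bits (Phase p E Aux)) : trialProb B b w ≠ ∞ :=
  ((trialProb_le_one B b w).trans_lt ENNReal.one_lt_top).ne

theorem flagProb_trial (b : Bool) (w : Bits (Phase p E Aux)) :
    flagProb (trial B (pair (bit b) w)) = trialProb B b w :=
  flagProb_map _ _ fun y => y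

theorem ev_repeatUntil_trial {b : Bool} {w : Bits (Phase p E Aux)} (h : trialProb B b w ≠ 0)
    (φ : Bits ((Fin n × Fin E.keyLen) ⊕ (B.State ⊕ Request p)) → ℝ≥0∞) :
    ev (repeatUntil (trial B (pair (bit b) w))) φ = trialEv B b w φ / trialProb B b w :=
  ev_repeatUntil_map _ _ (fun y => y) h φ

theorem coinTrial_eq (w : Bits (Phase p E Aux)) : coinTrial B w =
    ((piPMF fun _ : Unit => PMF.uniformOfFintype Bool).bind fun b =>
      (trial B (pair b w)).map fun y => (b, y)).map fun c => withFlag (c.2 none) c.1 := by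
  simp only [coinTrial, PMF.map_bind, PMF.map_comp]
  rfl

theorem ev_coinTrial (w : Bits (Phase p E Aux)) (φ : Bits Unit → ℝ≥0∞) :
    (ev ((piPMF fun _ : Unit => PMF.uniformOfFintype Bool).bind fun b =>
      (trial B (pair b w)).map fun y => (b, y)) fun c => if c.2 none then φ c.1 else 0) =
      2⁻¹ * (trialProb B true w * φ (bit true) + trialProb B false w * φ (bit false)) := by
  rw [ev_bind, ev_flip]
  simp only [ev_map]
  have h : ∀ b, (ev (trial B (pair (bit b) w)) fun y => if y none then φ (bit b) else 0) =
      trialProb B b w * φ (bit b) := by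
    intro b
    rw [← flagProb_trial, flagProb_eq, ← ev_mul_const]
    simp
  rw [h, h]

theorem flagProb_coinTrial (w : Bits (Phase p E Aux)) : flagProb (coinTrial B w) =
    2⁻¹ * (trialProb B true w + trialProb B false w) := by
  rw [coinTrial_eq, flagProb_map, ev_coinTrial B w fun _ => 1, mul_one, mul_one]

/-- Bayes' rule for a fair coin: given success, the two choices are weighted by their success
probabilities. -/
theorem repeatUntil_coinTrial {w : Bits (Phase p E Aux)}
    (h : trialProb B true w + trialProb B false w ≠ 0) (b : Bool) :
    repeatUntil (coinTrial B w) (bit b) =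
      trialProb B b w / (trialProb B true w + trialProb B false w) := by
  have h2 : (2⁻¹ : ℝ≥0∞) ≠ 0 := by simp
  rw [apply_eq_ev_unit, coinTrial_eq, ev_repeatUntil_map, ev_coinTrial B w fun _ => 1,
    ev_coinTrial B w fun y => if y () = b then 1 else 0, mul_one, mul_one,
    ENNReal.mul_div_mul_left _ _ h2 (by simp)]
  · cases b <;> simp [bit]
  · rw [ev_coinTrial B w fun _ => 1, mul_one, mul_one]
    exact mul_ne_zero h2 h

theorem guess_succ_false (T : ℕ) (w : Bits (Phase p E Aux)) : guess B (T + 1) w (bit false) =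
    guess B T w (bit false) * repeatUntil (coinTrial B w) (bit false) := by
  rw [apply_eq_ev_unit]
  simp only [guess, ev_bind, ev_pure, ev_unit]
  simp [bit]

theorem guess_succ_true (T : ℕ) (w : Bits (Phase p E Aux)) : guess B (T + 1) w (bit true) =
    guess B T w (bit true) + guess B T w (bit false) * repeatUntil (coinTrial B w) (bit true) := by
  have h := ev_unit (repeatUntil (coinTrial B w)) fun _ => 1
  rw [ev_const, mul_one, mul_one] at h
  rw [apply_eq_ev_unit]
  simp only [guess, ev_bind, ev_pure, ev_unit]
  simp only [bit, Bool.true_or, Bool.false_or, if_true, mul_one, mul_zero, add_zero,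
    Bool.false_eq_true, if_false] at h ⊢
  rw [← h, mul_one]

/-- All `T` successful trials, which are independent, must have used zeros. -/
theorem guess_false {w : Bits (Phase p E Aux)}
    (h : trialProb B true w + trialProb B false w ≠ 0) : ∀ T : ℕ, guess B T w (bit false) =
      (trialProb B false w / (trialProb B true w + trialProb B false w)) ^ T
  | 0 => by simp [guess]
  | T + 1 => by rw [guess_succ_false, guess_false h T, repeatUntil_coinTrial B h, pow_succ]

/-- Union bound over the `T` successful trials. -/
theorem guess_true_le {w : Bits (Phase p E Aux)}
    (h : trialProb B true w + trialProb B false w ≠ 0) : ∀ T : ℕ, guess B T w (bit true) ≤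
      T * (trialProb B true w / (trialProb B true w + trialProb B false w))
  | 0 => by
    rw [apply_eq_ev_unit, guess, ev_pure]
    simp [bit]
  | T + 1 => by
    rw [guess_succ_true, repeatUntil_coinTrial B h, Nat.cast_add, Nat.cast_one, add_mul, one_mul]
    exact add_le_add (guess_true_le h T) (mul_le_of_le_one_left' (PMF.coe_le_one _ _))

theorem guess_add (w : Bits (Phase p E Aux)) (T : ℕ) :
    guess B T w (bit true) + guess B T w (bit false) = 1 := by
  have := ev_unit (guess B T w) fun _ => 1
  simpa using this.symm

/-! ### The running time of the simulator -/

variable {B}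

/-- The expected running time of the second phase of the simulator. -/
def simFinishCost (B : Simulator (fun _ : Parts p => 1) E.keyLen (Aux ⊕ (Fin n × Fin E.ctLen)) Out)
    (c d g : ℝ≥0∞) (T : ℕ) (w : Bits (Phase p E Aux)) : ℝ≥0∞ :=
  T * ((1 + (1 + c)) / flagProb (coinTrial B w) + g) +
    ev (guess B T w) fun b => (1 + c) / flagProb (trial B (pair b w)) +
      ev (repeatUntil (trial B (pair b w))) fun y => d + finishCost B y

theorem trialEv_finishCost_le {s : ℝ≥0∞} (hB : ∀ x, B.cost x ≤ s) (d : ℝ≥0∞) (b : Bool)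
    (w : Bits (Phase p E Aux)) : (trialEv B b w fun y => d + finishCost B y) ≤ d + s := by
  refine (trialEv_le B _).trans ?_
  rw [ev_add, ev_const]
  gcongr
  rw [stage, ev_bind]
  refine ev_le fun x => ?_
  rw [ev_map]
  exact ev_finishCost_le hB _ _

/-- With q₀ and q₁ as the success probabilities, q₀ times the cost of a coin trial loop is governed
by q₀/(q₀+q₁) ≤ 1. The final loop costs a multiple of 1/q₁ with probability at most T·q₁/(q₀+q₁), or
of 1/q₀ otherwise; after multiplication by q₀ these contribute `T` and `1` to the factor `T + 1`. -/
theorem trialProb_mul_simFinishCost_le {s : ℝ≥0∞} (hB : ∀ x, B.cost x ≤ s) (c d g : ℝ≥0∞) (T : ℕ)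
    (w : Bits (Phase p E Aux)) : trialProb B false w * simFinishCost B c d g T w ≤
      T * (2 * (1 + (1 + c)) + g) + (T + 1) * (1 + c + (d + s)) := by
  set q₀ := trialProb B false w with hq₀
  set q₁ := trialProb B true w with hq₁
  -- Such a verdict is never submitted; the cost may be infinite, but `0 * ∞ = 0`.
  by_cases h₀ : q₀ = 0
  · simp [h₀]
  have htop₀ : q₀ ≠ ∞ := trialProb_ne_top B _ _
  have htop₁ : q₁ ≠ ∞ := trialProb_ne_top B _ _
  have hsum : q₁ + q₀ ≠ 0 := by simp [h₀]
  have hsum' : q₁ + q₀ ≠ ∞ := ENNReal.add_ne_top.2 ⟨htop₁, htop₀⟩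
  have hdiv : q₀ / (q₁ + q₀) ≤ 1 := ENNReal.div_le_of_le_mul (by rw [one_mul]; exact le_add_self)
  have hone₀ : q₀ ≤ 1 := trialProb_le_one B _ _
  have htrial : ∀ b, trialProb B b w ≠ 0 → (1 + c) / flagProb (trial B (pair (bit b) w)) +
      (ev (repeatUntil (trial B (pair (bit b) w))) fun y => d + finishCost B y) ≤
        (1 + c + (d + s)) / trialProb B b w := by
    intro b hb
    rw [flagProb_trial, ev_repeatUntil_trial B hb, ← ENNReal.add_div]
    gcongr
    exact trialEv_finishCost_le hB d b w
  rw [simFinishCost, mul_add, ev_unit, mul_add (a := q₀)]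
  refine add_le_add ?_ ?_
  · rw [flagProb_coinTrial, ← hq₀, ← hq₁, mul_left_comm, mul_add]
    refine mul_le_mul_right (add_le_add ?_ ?_) _
    · rw [ENNReal.div_eq_inv_mul, ENNReal.mul_inv (by simp) (by simp), inv_inv]
      calc q₀ * (2 * (q₁ + q₀)⁻¹ * (1 + (1 + c))) =
          (q₀ / (q₁ + q₀)) * (2 * (1 + (1 + c))) := by rw [ENNReal.div_eq_inv_mul]; ring
        _ ≤ 1 * (2 * (1 + (1 + c))) := by gcongr
        _ = _ := one_mul _
    · exact mul_le_of_le_one_left' hone₀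
  · rw [add_mul, one_mul]
    refine add_le_add ?_ ?_
    -- The loop with the returned items would never stop, but then it is entered with probability
    -- zero.
    · by_cases h₁ : q₁ = 0
      · have := guess_true_le B hsum T
        rw [← hq₁, h₁, ENNReal.zero_div, mul_zero, nonpos_iff_eq_zero] at this
        simp [this]
      · calc _ ≤ q₀ * (T * (q₁ / (q₁ + q₀)) * ((1 + c + (d + s)) / q₁)) := by
              gcongr
              · exact guess_true_le B hsum T
              · exact htrial true h₁
          _ = T * (1 + c + (d + s)) * (q₀ / (q₁ + q₀)) * (q₁ * q₁⁻¹) := by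
              simp only [ENNReal.div_eq_inv_mul]; ring
          _ ≤ T * (1 + c + (d + s)) * 1 * 1 := by
              gcongr
              exact ENNReal.mul_inv_le_one _
          _ = _ := by rw [mul_one, mul_one]
    · calc _ ≤ q₀ * (1 * ((1 + c + (d + s)) / q₀)) := by
            gcongr
            · exact PMF.coe_le_one _ _
            · exact htrial false h₀
        _ = (1 + c + (d + s)) * (q₀ * q₀⁻¹) := by
            simp only [ENNReal.div_eq_inv_mul]; ring
        _ ≤ (1 + c + (d + s)) * 1 := by
            gcongr
            exact ENNReal.mul_inv_le_one _
        _ = _ := mul_one _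

/-- The joint distribution of the reported price and the output of the simulator. -/
def simRun (B : Simulator (fun _ : Parts p => 1) E.keyLen (Aux ⊕ (Fin n × Fin E.ctLen)) Out)
    (T : ℕ) (z : Bits Aux) (m : Bits (Fin n × Fin E.msgLen)) : PMF (Bits (Fin (total p) ⊕ Out)) :=
  (stage B (pair z fun _ => false)).bind fun y =>
    (simFinish B T (pair (pair z (verdict (sndBits (sndBits y))))
      (maskKeys (fstBits (verdict (sndBits (sndBits y)))) m))).map
        (pair (sndBits (verdict (sndBits (sndBits y)))))

/-- By `price_verdict_le` the trusted party never refuses this request. -/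
theorem trusted_verdict (m : Bits (Fin n × Fin E.msgLen)) (r : Bits (Request p)) :
    trusted p m (fstBits (verdict r)) (ones (sndBits (verdict r))) =
      maskKeys (fstBits (verdict r)) m := by
  funext s
  simp only [trusted, maskKeys, decide_eq_true (price_verdict_le r), Bool.true_and]

theorem unary_ones_verdict (r : Bits (Request p)) :
    unary (total p) (ones (sndBits (verdict r))) = sndBits (verdict r) := by
  rw [ones_verdict]
  rfl

/-- `trialProb` with the bit `false` ignores the returned items, so `m` may depend on the verdict.
This supplies the weights q₀ in both the running time and the output distribution. -/
theorem ev_stage_fiberwise (z : Bits Aux) (F : Bits (Fin n ⊕ Fin (total p)) → ℝ≥0∞)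
    (m : Bits (Fin n ⊕ Fin (total p)) → Bits (Fin n × Fin E.msgLen)) :
    (ev (stage B (pair z fun _ => false)) fun y => F (verdict (sndBits (sndBits y)))) =
      ∑ v, trialProb B false (pair (pair z v) (m v)) * F v := by
  rw [ev_fiberwise _ fun y => verdict (sndBits (sndBits y))]
  refine Finset.sum_congr rfl fun v _ => ?_
  rw [trialProb, trialEv, ← ev_mul_const]
  refine congrArg _ (funext fun y => ?_)
  change _ = (if decide (verdict (sndBits (sndBits y)) = v) then 1 else 0) * F v
  by_cases h : verdict (sndBits (sndBits y)) = v
  · simp [h]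
  · simp [h]

/-- A bound for the expected running time of the simulator. -/
def simBound (p : Fin n → ℕ) (C T : ℕ) (t s : ℝ≥0∞) : ℝ≥0∞ :=
  let c := n * t * gateBound Bool + (n * t + n * t + s +
    gateBound (Request p ⊕ (Fin n ⊕ Fin (total p))))
  let d := C * t + total p * t * gateBound (Option (Request p))
  n * t + n * t + s + (n + total p : ℕ) * gateBound (Request p) +
    (2 ^ (n + total p) : ℕ) * (T * (2 * (1 + (1 + c)) + gateBound Bool) +
      (T + 1) * (1 + c + (d + s)))

/-- Between its phases the simulator remembers only the auxiliary input and the verdict; keys and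
ciphertexts are sampled anew afterwards. -/
theorem exists_simulator {C : ℕ} (hC : ∀ κ : ℕ,
    Comp (fun K : Bits (Fin n × Fin κ) => splitKeys p K) fun _ => (C * κ : ℕ))
    {s t : ℝ≥0∞} (hE : EncBound E t) (hB : ∀ x, B.cost x ≤ s) [Finite Aux] (T : ℕ) :
    ∃ S : Simulator p E.msgLen Aux Out, (∀ x, S.cost x ≤ simBound p C T t s) ∧
      ∀ z m, idealRun S z m = simRun B T z m := by
  classical
  obtain ⟨choose, hrun, hcost⟩ := comp_simChoose hE hB
  obtain ⟨finish, hrun', hcost'⟩ :=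
    comp_simFinish (comp_trial hE hB) (comp_finishKernel (B := B) hC hE) T
  refine ⟨⟨Aux ⊕ (Fin n ⊕ Fin (total p)), choose, finish⟩, fun x => ?_, fun z m => ?_⟩
  · refine add_le_add (hcost _) ?_
    dsimp only
    rw [hrun]
    refine (ev_mono fun u => hcost' _).trans ?_
    rw [simChoose, ev_map]
    refine (ev_stage_fiberwise (B := B) x.1 (fun v => simFinishCost B _ _ _ T
      (pair (pair x.1 v) (trusted p x.2 (fstBits v) (ones (sndBits v)))))
      fun v => trusted p x.2 (fstBits v) (ones (sndBits v))).trans_le ?_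
    -- The same bound holds for each verdict, and there are `2 ^ (n + total p)` of them.
    refine (Finset.sum_le_card_nsmul _ _ _ fun v _ =>
      trialProb_mul_simFinishCost_le hB _ _ _ T _).trans ?_
    rw [nsmul_eq_mul]
    gcongr
    simp
  · rw [idealRun, hrun, hrun', simChoose, PMF.bind_map, simRun]
    refine congrArg _ (funext fun y => ?_)
    simp only [Simulator.answered, Function.comp_apply, fstBits_pair, sndBits_pair,
      trusted_verdict, unary_ones_verdict]

end Simulator

section Simulator

/-! ### The output of the simulator -/

variable {n : ℕ} {p : Fin n → ℕ} {E : SymEnc} {Aux Out : Type}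
  {B : Simulator (fun _ : Parts p => 1) E.keyLen (Aux ⊕ (Fin n × Fin E.ctLen)) Out}

/-- The distinguisher that always accepts. -/
def acceptAll {α : Type} : Kernel α Unit := fun _ => PMF.pure (bit true)

@[simp] theorem acc_acceptAll {α : Type} (y : Bits α) : acc acceptAll y = 1 :=
  (acc_pure (fun _ => true) y).trans (if_pos rfl)

/-- The probability that the request of the simulator leads to the verdict `v`, and `D` accepts. -/
def testProb (B : Simulator (fun _ : Parts p => 1) E.keyLen (Aux ⊕ (Fin n × Fin E.ctLen)) Out)
    (z : Bits Aux) (M : Bits (Fin n × Fin E.msgLen)) (D : Kernel (Fin (total p) ⊕ Out) Unit)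
    (v : Bits (Fin n ⊕ Fin (total p))) : ℝ≥0∞ :=
  ev (keysCts E M) (acc (testKernel B z D fun r => decide (verdict r = v)))

theorem testProb_eq (z : Bits Aux) (M : Bits (Fin n × Fin E.msgLen))
    (D : Kernel (Fin (total p) ⊕ Out) Unit) (v : Bits (Fin n ⊕ Fin (total p))) :
    testProb B z M D v = ev (stage B (pair z M)) fun y =>
      if decide (verdict (sndBits (sndBits y)) = v) then
        ev (finishKernel B y) fun o => acc D (pair (sndBits v) o) else 0 := by
  rw [testProb, stage, ev_bind]
  refine congrArg _ (funext fun w => ?_)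
  rw [acc_testKernel, ev_map]
  refine congrArg _ (funext fun u => ?_)
  by_cases h : verdict (sndBits u) = v
  · subst h
    rfl
  · simp [h]

theorem trialEv_eq (b : Bool) (z : Bits Aux) (v : Bits (Fin n ⊕ Fin (total p)))
    (m : Bits (Fin n × Fin E.msgLen)) (D : Kernel (Fin (total p) ⊕ Out) Unit) :
    (trialEv B b (pair (pair z v) m) fun y =>
      ev (finishKernel B y) fun o => acc D (pair (sndBits v) o)) =
        testProb B z (fun i => b && m i) D v :=
  (testProb_eq z _ D v).symm

theorem trialProb_eq (b : Bool) (z : Bits Aux) (v : Bits (Fin n ⊕ Fin (total p)))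
    (m : Bits (Fin n × Fin E.msgLen)) :
    trialProb B b (pair (pair z v) m) = testProb B z (fun i => b && m i) acceptAll v := by
  rw [← trialEv_eq]
  simp only [acc_acceptAll, ev_const]
  rfl

theorem testProb_le (z : Bits Aux) (M : Bits (Fin n × Fin E.msgLen))
    (D : Kernel (Fin (total p) ⊕ Out) Unit) (v : Bits (Fin n ⊕ Fin (total p))) :
    testProb B z M D v ≤ testProb B z M acceptAll v := by
  rw [testProb_eq, testProb_eq]
  refine ev_mono fun y => ?_
  split_ifs
  · exact ev_mono fun o => (acc_le_one _ _).trans (acc_acceptAll _).ge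
  · exact le_rfl

theorem testProb_ne_top (z : Bits Aux) (M : Bits (Fin n × Fin E.msgLen))
    (D : Kernel (Fin (total p) ⊕ Out) Unit) (v : Bits (Fin n ⊕ Fin (total p))) :
    testProb B z M D v ≠ ∞ := ev_ne_top (acc_le_one _)

/-- The keys of items that are not chosen do not matter. -/
theorem testProb_eq_masked (z : Bits Aux) (M : Bits (Fin n × Fin E.msgLen))
    (D : Kernel (Fin (total p) ⊕ Out) Unit) (v : Bits (Fin n ⊕ Fin (total p))) :
    testProb B z M D v = ev (maskedKeysCts E (fstBits v) M)
      (acc (testKernel B z D fun r => decide (verdict r = v))) := by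
  rw [testProb, maskedKeysCts, ev_map]
  refine congrArg _ (funext fun w => ?_)
  rw [acc_testKernel, acc_testKernel]
  refine congrArg _ (funext fun u => ?_)
  by_cases h : verdict (sndBits u) = v
  · subst h
    rw [fstBits_pair, finishKernel_mask B fun i hi => exists_invisible hi]
  · simp [h]

/-- When only the verdict is tested, the end of the simulation has total mass one and is irrelevant,
so no key has to be revealed. -/
theorem testProb_acceptAll_eq_masked (z : Bits Aux) (M : Bits (Fin n × Fin E.msgLen))
    (v : Bits (Fin n ⊕ Fin (total p))) :
    testProb B z M acceptAll v = ev (maskedKeysCts E (fun _ => false) M)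
      (acc (testKernel B z acceptAll fun r => decide (verdict r = v))) := by
  rw [testProb, maskedKeysCts, ev_map]
  refine congrArg _ (funext fun w => ?_)
  rw [acc_testKernel, acc_testKernel]
  simp only [acc_acceptAll, ev_const, sndBits_pair]

theorem ev_hybridRun (z : Bits Aux) (m : Bits (Fin n × Fin E.msgLen))
    (D : Kernel (Fin (total p) ⊕ Out) Unit) :
    ev (hybridRun E B z m) (acc D) = ∑ v, testProb B z m D v := by
  rw [hybridRun_eq]
  simp only [ev_bind, ev_map]
  simp only [testProb, acc_testKernel, ← ev_sum]
  refine congrArg _ (funext fun w => congrArg _ (funext fun u => ?_))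
  simp

theorem ev_simRun (T : ℕ) (z : Bits Aux) (m : Bits (Fin n × Fin E.msgLen))
    (D : Kernel (Fin (total p) ⊕ Out) Unit) :
    ev (simRun B T z m) (acc D) = ∑ v, testProb B z (fun _ => false) acceptAll v *
      ev (simFinish B T (pair (pair z v) (maskKeys (fstBits v) m)))
        fun o => acc D (pair (sndBits v) o) := by
  rw [simRun, ev_bind]
  simp only [ev_map]
  refine (ev_stage_fiberwise (B := B) z (fun v => ev (simFinish B T (pair (pair z v)
    (maskKeys (fstBits v) m))) fun o => acc D (pair (sndBits v) o))
    fun v => maskKeys (fstBits v) m).trans ?_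
  simp only [trialProb_eq, Bool.false_and]

/-- q₀ and q₁ are the probabilities of a verdict with zeros and with the returned items; a₀ and a₁
are the probabilities that moreover the distinguisher accepts. The simulator submits the verdict
with probability q₀ and then accepts with the conditional probability a₁/q₁, or a₀/q₀ if the guess
fails; the target value is a₁. -/
theorem rejection_bound {q₀ q₁ a₀ a₁ : ℝ} (h₀ : 0 < q₀) (h₀' : q₀ ≤ 1) (h₁ : 0 ≤ q₁) (ha₀ : 0 ≤ a₀)
    (ha₀' : a₀ ≤ q₀) (ha₁ : 0 ≤ a₁) (ha₁' : a₁ ≤ q₁) (T : ℕ) :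
    |q₀ * ((1 - (q₀ / (q₁ + q₀)) ^ T) * (a₁ / q₁) + (q₀ / (q₁ + q₀)) ^ T * (a₀ / q₀)) - a₁| ≤
      3 * |q₀ - q₁| + (2 / 3) ^ T := by
  set η := (q₀ / (q₁ + q₀)) ^ T with hη
  have hx0 : 0 ≤ q₀ / (q₁ + q₀) := by positivity
  have hx1 : q₀ / (q₁ + q₀) ≤ 1 := div_le_one_of_le₀ (by linarith) (by linarith)
  have hη0 : 0 ≤ η := pow_nonneg hx0 T
  have hη1 : η ≤ 1 := pow_le_one₀ hx0 hx1
  -- The conditional acceptance probability. If `q₁ = 0`, then `a₁ = 0` and `a₁ / q₁` is zero by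
  -- convention, so `a₁ = q₁ * r` still holds.
  obtain ⟨r, hr0, hr1, hr, hrq⟩ : ∃ r, 0 ≤ r ∧ r ≤ 1 ∧ a₁ / q₁ = r ∧ a₁ = q₁ * r := by
    refine ⟨a₁ / q₁, by positivity, div_le_one_of_le₀ ha₁' h₁, rfl, ?_⟩
    rcases h₁.eq_or_lt with h | h
    · rw [← h] at ha₁' ⊢
      rw [zero_mul]
      exact le_antisymm ha₁' ha₁
    · field_simp
  -- Either `q₀ ≤ 2 * q₁`, and the base of the power is at most 2/3, or `q₀ < 2 * (q₀ - q₁)`, and `η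
  -- ≤ 1` suffices.
  have hle : η * q₀ ≤ 2 * |q₀ - q₁| + (2 / 3) ^ T := by
    by_cases h : q₀ ≤ 2 * q₁
    · have h23 : q₀ / (q₁ + q₀) ≤ 2 / 3 := by
        rw [div_le_div_iff₀ (by linarith) (by norm_num)]
        linarith
      have : η ≤ (2 / 3) ^ T := pow_le_pow_left₀ hx0 h23 T
      have h3 : η * q₀ ≤ η * 1 := mul_le_mul_of_nonneg_left h₀' hη0
      have := abs_nonneg (q₀ - q₁)
      linarith
    · have h3 : η * q₀ ≤ 1 * q₀ := mul_le_mul_of_nonneg_right hη1 h₀.le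
      have : (0 : ℝ) ≤ (2 / 3) ^ T := by positivity
      have := le_abs_self (q₀ - q₁)
      linarith
  have hid : q₀ * ((1 - η) * (a₁ / q₁) + η * (a₀ / q₀)) - a₁ =
      (q₀ - q₁) * r + η * (a₀ - q₀ * r) := by
    rw [hr, hrq]
    field_simp
    ring
  rw [hid]
  have h5 : |(q₀ - q₁) * r| ≤ |q₀ - q₁| := by
    rw [abs_mul, abs_of_nonneg hr0]
    exact mul_le_of_le_one_right (abs_nonneg _) hr1
  have h6 : |η * (a₀ - q₀ * r)| ≤ η * q₀ := by
    rw [abs_mul, abs_of_nonneg hη0]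
    refine mul_le_mul_of_nonneg_left ?_ hη0
    have := mul_le_of_le_one_right h₀.le hr1
    have := mul_nonneg h₀.le hr0
    rw [abs_le]
    constructor <;> linarith
  have := abs_add_le ((q₀ - q₁) * r) (η * (a₀ - q₀ * r))
  linarith

/-- `rejection_bound` applied to a single verdict, after the output of the second phase has been
split according to the guess. -/
theorem abs_ev_simFinish_sub_le (T : ℕ) (z : Bits Aux) (m : Bits (Fin n × Fin E.msgLen))
    (D : Kernel (Fin (total p) ⊕ Out) Unit) (v : Bits (Fin n ⊕ Fin (total p))) :
    |(testProb B z (fun _ => false) acceptAll v * ev (simFinish B T (pair (pair z v) m))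
        fun o => acc D (pair (sndBits v) o)).toReal - (testProb B z m D v).toReal| ≤
      3 * |(testProb B z (fun _ => false) acceptAll v).toReal -
        (testProb B z m acceptAll v).toReal| + (2 / 3) ^ T := by
  set w : Bits (Phase p E Aux) := pair (pair z v) m
  set φ : Bits ((Fin n × Fin E.keyLen) ⊕ (B.State ⊕ Request p)) → ℝ≥0∞ := fun y =>
    ev (finishKernel B y) fun o => acc D (pair (sndBits v) o)
  have hq : ∀ b, trialProb B b w = testProb B z (fun i => b && m i) acceptAll v := fun b =>
    trialProb_eq b z v m
  have ha : ∀ b, trialEv B b w φ = testProb B z (fun i => b && m i) D v := fun b =>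
    trialEv_eq b z v m D
  have hq₀ : trialProb B false w = testProb B z (fun _ => false) acceptAll v := hq false
  have hq₁ : trialProb B true w = testProb B z m acceptAll v := hq true
  have ha₁ : trialEv B true w φ = testProb B z m D v := ha true
  have hle : ∀ b, trialEv B b w φ ≤ trialProb B b w := fun b => by
    rw [hq, ha]
    exact testProb_le _ _ _ _
  have htop : ∀ b, trialProb B b w ≠ ∞ := fun b => trialProb_ne_top B b w
  have hleR : ∀ b, (trialEv B b w φ).toReal ≤ (trialProb B b w).toReal := fun b =>
    ENNReal.toReal_mono (htop b) (hle b)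
  rw [← hq₀, ← hq₁, ← ha₁]
  by_cases h₀ : trialProb B false w = 0
  · rw [h₀, zero_mul, ENNReal.toReal_zero, zero_sub, zero_sub, abs_neg, abs_neg,
      abs_of_nonneg ENNReal.toReal_nonneg, abs_of_nonneg ENNReal.toReal_nonneg]
    have := hleR true
    have : (0 : ℝ) ≤ (2 / 3) ^ T := by positivity
    have : 0 ≤ (trialProb B true w).toReal := ENNReal.toReal_nonneg
    linarith
  have hsum : trialProb B true w + trialProb B false w ≠ 0 := by simp [h₀]
  have hpos : 0 < (trialProb B false w).toReal := ENNReal.toReal_pos h₀ (htop _)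
  have hfalse : (guess B T w (bit false)).toReal = ((trialProb B false w).toReal /
      ((trialProb B true w).toReal + (trialProb B false w).toReal)) ^ T := by
    rw [guess_false B hsum, ENNReal.toReal_pow, ENNReal.toReal_div,
      ENNReal.toReal_add (htop _) (htop _)]
  have htrue : (guess B T w (bit true)).toReal = 1 - ((trialProb B false w).toReal /
      ((trialProb B true w).toReal + (trialProb B false w).toReal)) ^ T := by
    have h := congrArg ENNReal.toReal (guess_add B w T)
    rw [ENNReal.toReal_add (PMF.apply_ne_top _ _) (PMF.apply_ne_top _ _), hfalse,
      ENNReal.toReal_one] at h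
    linarith
  have hφ : ∀ y, φ y ≤ 1 := fun y => ev_le_one fun o => acc_le_one _ _
  have hfin : ev (simFinish B T w) (fun o => acc D (pair (sndBits v) o)) =
      guess B T w (bit true) * ev (repeatUntil (trial B (pair (bit true) w))) φ +
        guess B T w (bit false) * ev (repeatUntil (trial B (pair (bit false) w))) φ := by
    rw [simFinish, ev_bind, ev_unit, ev_bind, ev_bind]
  have hr₁ : (guess B T w (bit true)).toReal *
      (ev (repeatUntil (trial B (pair (bit true) w))) φ).toReal =
      (guess B T w (bit true)).toReal *
        ((trialEv B true w φ).toReal / (trialProb B true w).toReal) := by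
    -- If the returned items never lead to the verdict, the outcome of the loop is a default value,
    -- but the guess is then almost surely `false`.
    by_cases h₁ : trialProb B true w = 0
    · have := guess_true_le B hsum T
      rw [h₁, ENNReal.zero_div, mul_zero, nonpos_iff_eq_zero] at this
      rw [this, ENNReal.toReal_zero, zero_mul, zero_mul]
    · rw [ev_repeatUntil_trial B h₁, ENNReal.toReal_div]
  have hval : (trialProb B false w * ev (simFinish B T w) fun o => acc D (pair (sndBits v) o)).toReal =
      (trialProb B false w).toReal * ((guess B T w (bit true)).toReal *
        ((trialEv B true w φ).toReal / (trialProb B true w).toReal) +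
        (guess B T w (bit false)).toReal *
        ((trialEv B false w φ).toReal / (trialProb B false w).toReal)) := by
    rw [hfin, ENNReal.toReal_mul, ENNReal.toReal_add, ENNReal.toReal_mul, ENNReal.toReal_mul, hr₁,
      ev_repeatUntil_trial B h₀, ENNReal.toReal_div]
    · exact ENNReal.mul_ne_top (PMF.apply_ne_top _ _) (ev_ne_top hφ)
    · exact ENNReal.mul_ne_top (PMF.apply_ne_top _ _) (ev_ne_top hφ)
  rw [hval, hfalse, htrue]
  refine rejection_bound hpos ?_ ENNReal.toReal_nonneg ENNReal.toReal_nonneg (hleR _)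
    ENNReal.toReal_nonneg (hleR _) T
  exact ENNReal.toReal_mono ENNReal.one_ne_top (trialProb_le_one B _ _)

/-- For each verdict, the intermediate term uses the items with those outside the verdict blanked
out, which is exactly what the trusted party returns. -/
theorem abs_simRun_sub_hybridRun_le (T : ℕ) (z : Bits Aux) (m : Bits (Fin n × Fin E.msgLen))
    (D : Kernel (Fin (total p) ⊕ Out) Unit) :
    |(ev (hybridRun E B z m) (acc D)).toReal - (ev (simRun B T z m) (acc D)).toReal| ≤
      ∑ v, (|(testProb B z m D v).toReal - (testProb B z (maskKeys (fstBits v) m) D v).toReal| +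
        (3 * |(testProb B z (fun _ => false) acceptAll v).toReal -
          (testProb B z (maskKeys (fstBits v) m) acceptAll v).toReal| + (2 / 3) ^ T)) := by
  rw [ev_hybridRun, ev_simRun, ENNReal.toReal_sum fun v _ => testProb_ne_top z m D v,
    ENNReal.toReal_sum fun v _ => ENNReal.mul_ne_top (testProb_ne_top _ _ _ _)
      (ev_ne_top fun o => acc_le_one _ _), ← Finset.sum_sub_distrib]
  refine (Finset.abs_sum_le_sum_abs _ _).trans (Finset.sum_le_sum fun v _ => ?_)
  refine (abs_sub_le _ (testProb B z (maskKeys (fstBits v) m) D v).toReal _).trans ?_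
  refine add_le_add le_rfl ?_
  rw [abs_sub_comm]
  exact abs_ev_simFinish_sub_le T z _ D v

end Simulator

/-! ## Sender's privacy -/

section SenderPrivacy

variable {n : ℕ} {p : Fin n → ℕ} {E : ℕ → SymEnc} {Aux Out : ℕ → Type}
  {B : ∀ k, Simulator (fun _ : Parts p => 1) (E k).keyLen (Aux k ⊕ (Fin n × Fin (E k).ctLen)) (Out k)}

theorem ppt_testKernel (hE : SecureEnc E) (hB : PolyBounded fun k => (B k).cost)
    (z : ∀ k, Bits (Aux k)) {D : ∀ k, Kernel (Fin (total p) ⊕ Out k) Unit} (hD : PPT D)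
    (test : ℕ → Bits (Request p) → Bool) :
    PPT fun k => testKernel (B k) (z k) (D k) (test k) := by
  obtain ⟨t, ht, hEt⟩ := hE.exists_bound
  obtain ⟨C, hC⟩ := exists_comp_splitKeys p
  obtain ⟨q, hq⟩ := hB
  obtain ⟨d, hd, hDd⟩ := hD.exists_comp
  have hs : PolyLe fun k => ((q.eval k : ℕ) : ℝ≥0∞) := ⟨q, fun k => le_rfl⟩
  exact PPT.of_comp (hs.add (((((PolyLe.const C).mul ht).add
    (((PolyLe.const (total p)).mul ht).mul (PolyLe.const _))).add hs).add
      (((PolyLe.const (total p)).mul (PolyLe.const _)).add (hd.add (PolyLe.const _)))))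
    fun k => comp_testKernel hC (hEt k) (hq k) (z k) (hDd k) (test k)

theorem ppt_acceptAll {α : ℕ → Type} : PPT fun k => acceptAll (α := α k) :=
  PPT.of_comp (PolyLe.const 0) fun _ => (Comp.rewire (IsRewire.const _)).mono fun _ => zero_le

/-- For a fixed verdict the blanked items have hidden keys, so the security of the encryption
applies with `testKernel` as distinguisher. -/
theorem negligible_testProb (hE : SecureEnc E) (hB : PolyBounded fun k => (B k).cost)
    (z : ∀ k, Bits (Aux k)) (m : ∀ k, Bits (Fin n × Fin (E k).msgLen))
    {D : ∀ k, Kernel (Fin (total p) ⊕ Out k) Unit} (hD : PPT D)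
    (v : Bits (Fin n ⊕ Fin (total p))) :
    Negligible fun k => |(testProb (B k) (z k) (m k) (D k) v).toReal -
      (testProb (B k) (z k) (maskKeys (fstBits v) (m k)) (D k) v).toReal| := by
  have h := compIndist_maskedKeysCts hE (J := fun _ => fstBits v) (M := m)
    (M' := fun k => maskKeys (fstBits v) (m k)) (fun k i hi b => by simp [maskKeys, hi]) _
    (ppt_testKernel hE hB z hD fun _ r => decide (verdict r = v))
  simpa only [acceptProb_eq, ← testProb_eq_masked] using h

/-- Here every key is hidden, so the message vectors need not agree anywhere. -/
theorem negligible_testProb_acceptAll (hE : SecureEnc E) (hB : PolyBounded fun k => (B k).cost)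
    (z : ∀ k, Bits (Aux k)) (m m' : ∀ k, Bits (Fin n × Fin (E k).msgLen))
    (v : Bits (Fin n ⊕ Fin (total p))) :
    Negligible fun k => |(testProb (B k) (z k) (m k) acceptAll v).toReal -
      (testProb (B k) (z k) (m' k) acceptAll v).toReal| := by
  have h := compIndist_maskedKeysCts hE (J := fun _ _ => false) (M := m) (M' := m')
    (fun k i hi b => by simp at hi) _
    (ppt_testKernel hE hB z ppt_acceptAll fun _ r => decide (verdict r = v))
  simpa only [acceptProb_eq, ← testProb_acceptAll_eq_masked] using h

theorem compIndist_simRun (hE : SecureEnc E) (hB : PolyBounded fun k => (B k).cost)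
    (z : ∀ k, Bits (Aux k)) (m : ∀ k, Bits (Fin n × Fin (E k).msgLen)) :
    CompIndist (fun k => hybridRun (E k) (B k) (z k) (m k))
      fun k => simRun (B k) k (z k) (m k) := by
  intro D hD
  refine (Negligible.sum Finset.univ fun v => (negligible_testProb hE hB z m hD v).add
    (((negligible_testProb_acceptAll hE hB z (fun _ _ => false)
      (fun k => maskKeys (fstBits v) (m k)) v).const_mul 3).add
      (Negligible.pow (r := 2 / 3) (by norm_num) (by norm_num)))).mono fun k => ?_
  rw [abs_abs, acceptProb_eq, acceptProb_eq]
  exact abs_simRun_sub_hybridRun_le k (z k) (m k) (D k)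

theorem polyLe_simBound (C : ℕ) {s t : ℕ → ℝ≥0∞} (hs : PolyLe s) (ht : PolyLe t) :
    PolyLe fun k => simBound p C k (t k) (s k) := by
  have hn := (PolyLe.const n).mul ht
  have hstage := (hn.add hn).add hs
  have hc := (hn.mul (PolyLe.const (gateBound Bool))).add
    (hstage.add (PolyLe.const (gateBound (Request p ⊕ (Fin n ⊕ Fin (total p))))))
  have hd := ((PolyLe.const C).mul ht).add
    (((PolyLe.const (total p)).mul ht).mul (PolyLe.const (gateBound (Option (Request p)))))
  have h1c := PolyLe.one.add hc
  exact (hstage.add ((PolyLe.const (n + total p)).mul (PolyLe.const (gateBound (Request p))))).add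
    ((PolyLe.const (2 ^ (n + total p))).mul
      ((PolyLe.id.mul (((PolyLe.const 2).mul (PolyLe.one.add h1c)).add
        (PolyLe.const (gateBound Bool)))).add
        ((PolyLe.id.add PolyLe.one).mul (h1c.add (hd.add hs)))))

theorem senderPrivacy_keySplit (hE : SecureEnc E)
    {ot : ∀ k, Protocol (Parts p) (fun _ => 1) (E k).keyLen} (hot : SenderPrivacy ot) :
    SenderPrivacy fun k => keySplitProtocol p (E k) (ot k) := by
  intro Aux _ A hA
  obtain ⟨B, hB, hind⟩ := hot (fun k => Aux k ⊕ (Fin n × Fin (E k).ctLen)) (fun k => (A k).toOT)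
    hA.toOT
  obtain ⟨t, ht, hEt⟩ := hE.exists_bound
  obtain ⟨C, hC⟩ := exists_comp_splitKeys p
  obtain ⟨q, hq⟩ := hB
  -- The number `T` of trials is `k`, which makes the failure term `(2 / 3) ^ k` negligible while
  -- the cost stays polynomial.
  choose S hS hrun using fun k => exists_simulator (B := B k) hC (hEt k) (hq k) k
  obtain ⟨r, hr⟩ := polyLe_simBound (p := p) C (s := fun k => (q.eval k : ℕ)) ⟨q, fun _ => le_rfl⟩ ht
  refine ⟨S, ⟨r, fun k x => (hS k x).trans (hr k)⟩, fun z m => ?_⟩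
  have h := (compIndist_hybridRun hind z m).trans (compIndist_simRun hE ⟨q, hq⟩ z m)
  simp only [← hrun] at h
  exact h

end SenderPrivacy

/-! ## Semi-honest receivers -/

section SemiHonest

/-! ### Semi-honest strategies in an arbitrary protocol. -/

section Generic

variable {ι : Type} [Fintype ι] {w : ι → ℕ} {ℓ : ℕ} {Q : Protocol ι w ℓ} {Aux : Type}

/-- The honest receiver's state is embedded in the state of `A` along `f`. -/
def ReceiverStrategy.Follows (A : ReceiverStrategy Q Aux) (σ : Bits ι) (f : Q.RState → A.State) :
    Prop :=
  (∀ z a, (A.init (pair z a)).map (fun s => s ∘ f) = Q.rInit (pair σ a)) ∧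
    (∀ s, (A.send s).map (fun u => pair (fstBits u ∘ f) (sndBits u)) = Q.rSend (s ∘ f)) ∧
    ∀ s a, (A.recv (pair s a)).map (fun s' => s' ∘ f) = Q.rRecv (pair (s ∘ f) a)

/-- Along `f` the run of `A` projects to the honest run by `interact_map`, so the honest output map
applied to the final state of `A` yields the honest outcome. -/
theorem ReceiverStrategy.Follows.realRun_bind {A : ReceiverStrategy Q Aux} {σ : Bits ι}
    {f : Q.RState → A.State} (hf : A.Follows σ f) (z : Bits Aux) (m : Bits (ι × Fin ℓ)) :
    ((realRun Q A z m).bind fun y => (Q.rOut (sndBits y ∘ f)).map fun x => (fstBits y, x)) =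
      (honestRun Q m σ).map fun o => (unary (total w) o.1, o.2) := by
  obtain ⟨hi, hs, hr⟩ := hf
  have hint := interact_map Q.sStep (fun r : Bits A.State => r ∘ f) (fun r => (hs r).symm)
    (fun r a => (hr r a).symm)
  simp only [realRun, honestRun, ← hi z, PMF.bind_bind, PMF.map_bind, PMF.bind_map, PMF.map_comp,
    Function.comp_def, fstBits_pair, sndBits_pair] at hint ⊢
  refine congrArg _ (funext fun a => congrArg _ (funext fun r => ?_))
  rw [hint, PMF.bind_map]
  rfl

/-- Perfect correctness passes to every possible final state of a semi-honest receiver, whatever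
else that state records. -/
theorem ReceiverStrategy.Follows.of_mem_support {A : ReceiverStrategy Q Aux} {σ : Bits ι}
    {f : Q.RState → A.State} (hf : A.Follows σ f) {z : Bits Aux} {m : Bits (ι × Fin ℓ)}
    (hQ : ∀ o ∈ (honestRun Q m σ).support,
      o.1 = price w σ ∧ ∀ i, σ i = true → ∀ b, o.2 (i, b) = m (i, b))
    {y : Bits (Fin (total w) ⊕ A.State)} (hy : y ∈ (realRun Q A z m).support)
    {x : Bits (ι × Fin ℓ)} (hx : x ∈ (Q.rOut (sndBits y ∘ f)).support) :
    fstBits y = unary (total w) (price w σ) ∧ ∀ i, σ i = true → ∀ b, x (i, b) = m (i, b) := by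
  have h : (fstBits y, x) ∈
      ((honestRun Q m σ).map fun o => (unary (total w) o.1, o.2)).support := by
    rw [← hf.realRun_bind z m]
    simp only [PMF.mem_support_bind_iff, PMF.mem_support_map_iff]
    exact ⟨y, hy, x, hx, rfl⟩
  obtain ⟨o, ho, he⟩ := (PMF.mem_support_map_iff _ _ _).1 h
  obtain ⟨h1, h2⟩ := hQ o ho
  rw [Prod.mk.injEq] at he
  obtain ⟨he1, he2⟩ := he
  subst he2
  exact ⟨by rw [← he1, h1], h2⟩

end Generic

variable {n : ℕ} {p : Fin n → ℕ}

/-- The embedding is restricted to the wires of the underlying state; the choice set and the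
ciphertexts are forgotten. -/
theorem ReceiverStrategy.SemiHonest.toOT {E : SymEnc}
    {ot : Protocol (Parts p) (fun _ => 1) E.keyLen} {Aux : Type}
    {A : ReceiverStrategy (keySplitProtocol p E ot) Aux} {σ : Bits (Fin n)} (h : A.SemiHonest σ) :
    ∃ f : ot.RState → A.State, A.toOT.Follows (fun s => σ s.1) f := by
  obtain ⟨f, hi, hs, hr⟩ := h
  refine ⟨fun r => f (.inr (.inr r)), fun z a => ?_, fun s => ?_, fun s a => ?_⟩
  · have h := congrArg (PMF.map fun r : Bits (Fin n ⊕ ((Fin n × Fin E.ctLen) ⊕ ot.RState)) =>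
      sndBits (sndBits r)) (hi (fstBits z) (pair (sndBits z) a))
    refine Eq.trans ?_ (h.trans ?_)
    · erw [PMF.map_comp]
      rfl
    · change ((ot.rInit (pair (fun s => σ s.1) a)).map (embedState ot σ (sndBits z))).map _ = _
      rw [PMF.map_comp]
      exact PMF.map_id _
  · have h := congrArg (PMF.map fun
      r : Bits ((Fin n ⊕ ((Fin n × Fin E.ctLen) ⊕ ot.RState)) ⊕ ot.ToS) =>
      pair (sndBits (sndBits (fstBits r))) (sndBits r)) (hs s)
    refine Eq.trans ?_ (h.trans ?_)
    · erw [PMF.map_comp]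
      rfl
    · erw [PMF.map_comp]
      refine Eq.trans ?_ (PMF.map_id _)
      congr 1
      funext u
      exact pair_eta u
  · have h := congrArg (PMF.map fun r : Bits (Fin n ⊕ ((Fin n × Fin E.ctLen) ⊕ ot.RState)) =>
      sndBits (sndBits r)) (hr s a)
    refine Eq.trans ?_ (h.trans ?_)
    · erw [PMF.map_comp]
      rfl
    · erw [PMF.map_comp]
      exact PMF.map_id _

/-- If anything beyond `τ` were visible, the request would be affordable and its price would exceed
that of `τ`, which is the payment. -/
theorem visible_eq_of_price {r : Bits (Request p)} {τ : Bits (Parts p)}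
    (h : ones (sndBits r) = price (fun _ => 1) τ) (hτ : ∀ s, τ s = true → visible r s = true) :
    visible r = τ := by
  by_contra hne
  obtain ⟨s, hs⟩ := Function.ne_iff.1 hne
  have hτs : τ s = false := by
    by_contra h'
    rw [Bool.not_eq_false] at h'
    exact hs ((hτ s h').trans h'.symm)
  have hvs : visible r s = true := by
    rw [hτs] at hs
    simpa using hs
  have hle : price (fun _ => 1) (fstBits r) ≤ ones (sndBits r) := by
    by_contra h'
    rw [visible_of_not_le h'] at hvs
    simp at hvs
  have hlt : price (fun _ => 1) τ < price (fun _ => 1) (visible r) := by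
    refine Finset.sum_lt_sum (fun i _ => ?_) ⟨s, Finset.mem_univ s, by simp [hτs, hvs]⟩
    by_cases hi : τ i = true
    · simp [hi, hτ i hi]
    · simp [hi]
  rw [visible_of_le hle, ← h] at hlt
  exact absurd hle (not_le.2 hlt)

theorem ev_indicator_not {γ : Type*} (μ : PMF γ) (P : γ → Bool) :
    (ev μ fun u => if P u then 0 else 1) = 1 - ev μ fun u => if P u then 1 else 0 := by
  refine ENNReal.eq_sub_of_add_eq (ev_ne_top fun u => by split_ifs <;> simp) ?_
  rw [← ev_add, ← ev_const μ 1]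
  refine congrArg _ (funext fun u => ?_)
  cases P u <;> simp

/-! ### Requests that differ from those of the honest receiver. -/

section Bad

variable {E : SymEnc} {Aux Out : Type}
  (B : Simulator (fun _ : Parts p => 1) E.keyLen (Aux ⊕ (Fin n × Fin E.ctLen)) Out)

/-- The probability that the simulator does not obtain exactly the parts of the items in `σ`. -/
def badProb (σ : Bits (Fin n)) (z : Bits (Aux ⊕ (Fin n × Fin E.ctLen))) : ℝ≥0∞ :=
  ev (B.choose.run z) fun u =>
    if decide (visible (sndBits u) = fun s => σ s.1) then 0 else 1

theorem ev_idealRun (z : Bits (Aux ⊕ (Fin n × Fin E.ctLen))) (x : Bits (Parts p × Fin E.keyLen))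
    (φ : Bits (Fin (total fun _ : Parts p => 1) ⊕ Out) → ℝ≥0∞) :
    ev (idealRun B z x) φ = ev (B.choose.run z) fun u =>
      ev (B.finish.run (B.answered x u)) fun y => φ (pair (unary _ (ones (sndBits (sndBits u)))) y) := by
  rw [idealRun, ev_bind]
  simp only [ev_map]

/-- By `visible_eq_of_price`, a bad request either pays the wrong price or misses a chosen part;
this is the union bound over these events. -/
theorem badProb_le (σ : Bits (Fin n)) (z : Bits (Aux ⊕ (Fin n × Fin E.ctLen))) :
    badProb B σ z ≤ (ev (B.choose.run z) fun u =>
        if decide (ones (sndBits (sndBits u)) = price p σ) then 0 else 1) +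
      ∑ s : Parts p, if σ s.1 then
        ev (B.choose.run z) fun u => if visible (sndBits u) s then 0 else 1 else 0 := by
  have : (∑ s : Parts p, if σ s.1 then
      ev (B.choose.run z) fun u => if visible (sndBits u) s then 0 else 1 else 0) =
      ev (B.choose.run z) fun u => ∑ s : Parts p, if σ s.1 then
        (if visible (sndBits u) s then 0 else 1 : ℝ≥0∞) else 0 := by
    rw [ev_sum]
    refine Finset.sum_congr rfl fun s _ => ?_
    cases σ s.1 <;> simp
  rw [this, ← ev_add]
  refine ev_mono fun u => ?_
  by_cases hbad : visible (sndBits u) = fun s => σ s.1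
  · simp [hbad]
  by_cases hP : ones (sndBits (sndBits u)) = price p σ
  · have : ∃ s : Parts p, σ s.1 = true ∧ visible (sndBits u) s = false := by
      by_contra hno
      push Not at hno
      exact hbad (visible_eq_of_price (hP.trans (price_parts p σ).symm) fun s hs => by
        simpa using hno s hs)
    obtain ⟨s, hs, hv⟩ := this
    have h1 := Finset.single_le_sum (f := fun s : Parts p => if σ s.1 then
      (if visible (sndBits u) s then 0 else 1 : ℝ≥0∞) else 0) (fun _ _ => zero_le)
      (Finset.mem_univ s)
    refine le_trans ?_ (h1.trans le_add_self)
    simp [hbad, hs, hv]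
  · simp [hbad, hP]

/-- If the request does not contain part `s`, then the simulation does not depend on that part. -/
theorem ev_idealRun_le_add (z : Bits (Aux ⊕ (Fin n × Fin E.ctLen))) (s : Parts p)
    {x x' : Bits (Parts p × Fin E.keyLen)} (hx : ∀ a, a.1 ≠ s → x a = x' a)
    {φ : Bits (Fin (total fun _ : Parts p => 1) ⊕ Out) → ℝ≥0∞} (hφ : ∀ y, φ y ≤ 1) :
    ev (idealRun B z x) φ ≤ ev (idealRun B z x') φ +
      ev (B.choose.run z) fun u => if visible (sndBits u) s then 1 else 0 := by
  rw [ev_idealRun, ev_idealRun, ← ev_add]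
  refine ev_mono fun u => ?_
  by_cases hv : visible (sndBits u) s = true
  · rw [if_pos hv]
    exact (ev_le_one fun y => hφ _).trans le_add_self
  · have : B.answered x u = B.answered x' u := by
      rw [answered_eq, answered_eq]
      congr 1
      funext a
      by_cases ha : a.1 = s
      · have : visible (sndBits u) a.1 = false := by rw [ha]; simpa using hv
        simp [maskParts, this]
      · simp [maskParts, hx a ha]
    rw [this]
    exact le_self_add

/-- If exactly the parts of the items in `σ` are visible, every other key lacks its part 0, so
erasing it changes nothing. -/
theorem abs_testKernel_mask_le (hp : ∀ i, 1 ≤ p i) (σ : Bits (Fin n)) (z : Bits Aux)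
    (D : Kernel (Fin (total p) ⊕ Out) Unit)
    (w : Bits ((Fin n × Fin E.keyLen) ⊕ (Fin n × Fin E.ctLen))) :
    |(acc (testKernel B z D fun _ => true) w).toReal -
      (acc (testKernel B z D fun _ => true) (pair (maskKeys σ (fstBits w)) (sndBits w))).toReal| ≤
        (badProb B σ (pair z (sndBits w))).toReal := by
  rw [acc_testKernel, acc_testKernel]
  have hone : ∀ (K : Bits (Fin n × Fin E.keyLen)) (u : Bits (B.State ⊕ Request p)),
      (if true = true then ev (finishKernel B (pair K u)) fun y => acc D (reportPrice (sndBits u) y)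
        else 0) ≤ (1 : ℝ≥0∞) := fun K u => by
    rw [if_pos rfl]
    exact ev_le_one fun _ => acc_le_one _ _
  have hmask : ∀ u : Bits (B.State ⊕ Request p), (visible (sndBits u) = fun s => σ s.1) →
      finishKernel B (pair (maskKeys σ (fstBits w)) u) = finishKernel B (pair (fstBits w) u) :=
    fun u hu => finishKernel_mask B (fun i hi => ⟨⟨0, hp i⟩, by rw [hu]; exact hi⟩) _
  refine abs_ev_sub_le _ (fun u => hone _ u) (fun u => hone _ u)
    (ev_ne_top fun u => by split_ifs <;> simp) (fun u => ?_) fun u => ?_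
  · by_cases hu : visible (sndBits u) = fun s => σ s.1
    · rw [fstBits_pair, hmask u hu]
      exact le_self_add
    · refine (hone _ u).trans ?_
      simp [hu]
  · by_cases hu : visible (sndBits u) = fun s => σ s.1
    · rw [fstBits_pair, hmask u hu]
      exact le_self_add
    · refine (hone _ u).trans ?_
      simp [hu]

theorem ev_hybridRun_eq_testKernel (z : Bits Aux) (m : Bits (Fin n × Fin E.msgLen))
    (D : Kernel (Fin (total p) ⊕ Out) Unit) : ev (hybridRun E B z m) (acc D) =
      ev (keysCts E m) (acc (testKernel B z D fun _ => true)) := by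
  rw [hybridRun_eq, ev_bind]
  refine congrArg _ (funext fun w => ?_)
  rw [acc_testKernel]
  simp only [ev_bind, ev_map, if_true]

end Bad

end SemiHonest

/-! ### What the simulator of a semi-honest receiver has to request. -/

section SemiHonestPrivacy

theorem acceptProb_of_support {α : Type} {μ : PMF (Bits α)} {D : Kernel α Unit} {c : ℝ≥0∞}
    (h : ∀ y ∈ μ.support, acc D y = c) : acceptProb μ D = c.toReal := by
  rw [acceptProb_eq, ev_congr h, ev_const]

theorem acc_map_bit {α β : Type} (μ : Kernel α β) (g : Bits β → Bool) (y : Bits α) :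
    acc (fun y => (μ y).map fun x => bit (g x)) y = ev (μ y) fun x => if g x then 1 else 0 := by
  change ((μ y).map fun x => bit (g x)) (bit true) = _
  rw [apply_eq_ev_unit, ev_map]
  rfl

/-- A probability is bounded by the distance of the complementary probability to one. -/
theorem toReal_ev_not_le {γ : Type*} (μ : PMF γ) (P : γ → Bool) {b : ℝ}
    (h : 1 - b ≤ (ev μ fun u => if P u then 1 else 0).toReal) :
    (ev μ fun u => if P u then 0 else 1).toReal ≤ b := by
  have hle : (ev μ fun u => if P u then 1 else 0) ≤ 1 := ev_le_one fun u => by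
    split_ifs <;> simp
  rw [ev_indicator_not, ENNReal.toReal_sub_of_le hle ENNReal.one_ne_top, ENNReal.toReal_one]
  linarith

theorem unary_inj {N a b : ℕ} (ha : a ≤ N) (hb : b ≤ N) : unary N a = unary N b ↔ a = b :=
  ⟨fun h => by rw [← ones_unary ha, h, ones_unary hb], fun h => by rw [h]⟩

variable {n : ℕ} {p : Fin n → ℕ} {E : ℕ → SymEnc}

section Request

variable {ot : ∀ k, Protocol (Parts p) (fun _ => 1) (E k).keyLen} {Aux : ℕ → Type}
  {A : ∀ k, ReceiverStrategy (ot k) (Aux k ⊕ (Fin n × Fin (E k).ctLen))}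
  {B : ∀ k, Simulator (fun _ : Parts p => 1) (E k).keyLen (Aux k ⊕ (Fin n × Fin (E k).ctLen))
    (A k).State}
  {σ : ℕ → Bits (Fin n)} {f : ∀ k, (ot k).RState → (A k).State}

/-- The simulator of a semi-honest receiver almost always pays the price of the choice set. -/
theorem negligible_wrong_price (hot : Correct ot)
    (hf : ∀ k, (A k).Follows (fun s => σ k s.1) (f k))
    (z : ∀ k, Bits (Aux k ⊕ (Fin n × Fin (E k).ctLen)))
    (hind : ∀ x : ∀ k, Bits (Parts p × Fin (E k).keyLen), CompIndist
      (fun k => realRun (ot k) (A k) (z k) (x k)) fun k => idealRun (B k) (z k) (x k)) :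
    Negligible fun k => (ev ((B k).choose.run (z k)) fun u =>
      if decide (ones (sndBits (sndBits u)) = price p (σ k)) then 0 else 1).toReal := by
  let N := total fun _ : Parts p => 1
  -- The distinguisher compares the reported price with the price of the honest choice, which is
  -- always reported in the real model.
  let test : ∀ k, Bits (Fin N) → Bool := fun k y =>
    decide (y = unary N (price (fun _ : Parts p => 1) fun s => σ k s.1))
  let D : ∀ k, Kernel (Fin N ⊕ (A k).State) Unit := fun k y => PMF.pure fun _ => test k (fstBits y)
  have hD : PPT D := PPT.of_comp (PolyLe.const (gateBound (Fin N))) fun k =>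
    Comp.mono (Comp.local (Fin N) fun _ => ⟨.inl, test k, fun y => rfl⟩) fun _ => by simp
  refine (hind (fun _ _ => false) D hD).mono fun k => ?_
  have hreal : acceptProb (realRun (ot k) (A k) (z k) fun _ => false) (D k) = 1 := by
    refine (acceptProb_of_support (c := 1) fun y hy => ?_).trans ENNReal.toReal_one
    -- `of_mem_support` speaks of an output of `rOut`; any possible output will do.
    obtain ⟨x, hx⟩ := ((ot k).rOut (sndBits y ∘ f k)).support_nonempty
    have := ((hf k).of_mem_support (fun o ho => hot k _ _ o ho) hy hx).1
    rw [acc_pure]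
    simp [test, this, N]
  have hideal : acceptProb (idealRun (B k) (z k) fun _ => false) (D k) =
      (ev ((B k).choose.run (z k)) fun u =>
        if decide (ones (sndBits (sndBits u)) = price p (σ k)) then 1 else 0).toReal := by
    rw [acceptProb_eq, ev_idealRun]
    congr 2
    funext u
    rw [← price_parts]
    refine (congrArg (ev _) (funext fun y => acc_pure (fun y => test k (fstBits y)) _)).trans
      ((ev_const _ (if test k (unary N (ones (sndBits (sndBits u)))) then 1 else 0)).trans ?_)
    have hle : price (fun _ : Parts p => 1) (fun s => σ k s.1) ≤ N :=
      Finset.sum_le_sum fun s _ => by split_ifs <;> simp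
    refine if_congr ?_ rfl rfl
    rw [decide_eq_true_iff, decide_eq_true_iff]
    exact unary_inj (ones_le _) hle
  rw [abs_of_nonneg ENNReal.toReal_nonneg]
  refine toReal_ev_not_le _ _ ?_
  rw [← hideal, hreal]
  linarith [le_abs_self (1 - acceptProb (idealRun (B k) (z k) fun _ => false) (D k))]

/-- The simulator of a semi-honest receiver almost always requests every part of a chosen item. -/
theorem negligible_invisible (hot : Correct ot) (hout : PPT fun k => (ot k).rOut)
    (hf : ∀ k, (A k).Follows (fun s => σ k s.1) (f k))
    (z : ∀ k, Bits (Aux k ⊕ (Fin n × Fin (E k).ctLen)))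
    (hind : ∀ x : ∀ k, Bits (Parts p × Fin (E k).keyLen), CompIndist
      (fun k => realRun (ot k) (A k) (z k) (x k)) fun k => idealRun (B k) (z k) (x k))
    (s : Parts p) :
    Negligible fun k => if 0 < (E k).keyLen ∧ σ k s.1 = true then
      (ev ((B k).choose.run (z k)) fun u => if visible (sndBits u) s then 0 else 1).toReal else 0 := by
  let N := total fun _ : Parts p => 1
  let test : ∀ k, Bits (Parts p × Fin (E k).keyLen) → Bool := fun k x =>
    if h : 0 < (E k).keyLen then x (s, ⟨0, h⟩) else false
  -- The distinguisher applies the honest output map to the embedded state and reads the first bit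
  -- of part `s`, if keys have any bits.
  let D : ∀ k, Kernel (Fin N ⊕ (A k).State) Unit := fun k y =>
    ((ot k).rOut (sndBits y ∘ f k)).map fun x => bit (test k x)
  have hD : PPT D := by
    obtain ⟨t, ht, h⟩ := hout.exists_comp
    refine PPT.of_comp ht fun k => ((h k).pre (IsRewire.id.snd.reindex (f k))).post fun _ => ?_
    by_cases hk : 0 < (E k).keyLen
    · exact .inl ⟨(s, ⟨0, hk⟩), fun x => by simp [bit, test, hk]⟩
    · exact .inr ⟨false, fun x => by simp [bit, test, hk]⟩
  -- Part `s` is all ones here and all zeros in the comparison. The real model gives the bits 1 and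
  -- 0; the ideal model can follow only if part `s` is visible with probability close to one.
  let x' : ∀ k, Bits (Parts p × Fin (E k).keyLen) := fun k a => decide (a.1 = s)
  refine ((hind x' D hD).add (hind (fun _ _ => false) D hD)).mono fun k => ?_
  split_ifs with hk
  swap
  · rw [abs_zero]; positivity
  have hreal : ∀ x : Bits (Parts p × Fin (E k).keyLen),
      acceptProb (realRun (ot k) (A k) (z k) x) (D k) = if test k x then 1 else 0 := by
    intro x
    refine (acceptProb_of_support (c := if test k x then 1 else 0) fun y hy => ?_).trans
      (by split_ifs <;> simp)
    rw [acc_map_bit (fun y => (ot k).rOut (sndBits y ∘ f k))]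
    refine (ev_congr fun o ho => ?_).trans (ev_const _ _)
    have := ((hf k).of_mem_support (fun o ho => hot k _ _ o ho) hy ho).2 s hk.2
    simp [test, hk.1, this]
  have h1 : test k (x' k) = true := by simp [test, x', hk.1]
  have h0 : test k (fun _ => false) = false := by simp [test]
  have hle := ENNReal.toReal_mono (ENNReal.add_ne_top.2 ⟨ev_ne_top fun y => acc_le_one (D k) y,
      ev_ne_top fun u => by split_ifs <;> simp⟩)
    (ev_idealRun_le_add (B k) (z k) s (x := x' k) (x' := fun _ => false)
      (fun a ha => by simp [x', ha]) fun y => acc_le_one (D k) y)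
  rw [ENNReal.toReal_add (ev_ne_top fun y => acc_le_one (D k) y)
    (ev_ne_top fun u => by split_ifs <;> simp), ← acceptProb_eq, ← acceptProb_eq] at hle
  rw [abs_of_nonneg ENNReal.toReal_nonneg, hreal, hreal, h1, h0, if_pos rfl, if_neg (by simp)]
  refine toReal_ev_not_le _ _ ?_
  have a1 := le_abs_self (1 - acceptProb (idealRun (B k) (z k) (x' k)) (D k))
  have a2 := neg_abs_le (0 - acceptProb (idealRun (B k) (z k) fun _ => false) (D k))
  linarith

theorem negligible_badProb (hot : Correct ot) (hout : PPT fun k => (ot k).rOut)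
    (hf : ∀ k, (A k).Follows (fun s => σ k s.1) (f k))
    (z : ∀ k, Bits (Aux k ⊕ (Fin n × Fin (E k).ctLen)))
    (hind : ∀ x : ∀ k, Bits (Parts p × Fin (E k).keyLen), CompIndist
      (fun k => realRun (ot k) (A k) (z k) (x k)) fun k => idealRun (B k) (z k) (x k)) :
    Negligible fun k => if 0 < (E k).keyLen then (badProb (B k) (σ k) (z k)).toReal else 0 := by
  refine ((negligible_wrong_price hot hf z hind).add (Negligible.sum Finset.univ fun s =>
    negligible_invisible hot hout hf z hind s)).mono fun k => ?_
  have hv : ∀ s, (ev ((B k).choose.run (z k)) fun u =>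
      if visible (sndBits u) s then 0 else 1) ≠ ∞ := fun s =>
    ev_ne_top fun u => by split_ifs <;> simp
  have hprice : (ev ((B k).choose.run (z k)) fun u =>
      if decide (ones (sndBits (sndBits u)) = price p (σ k)) then 0 else 1) ≠ ∞ :=
    ev_ne_top fun u => by split_ifs <;> simp
  split_ifs with hk
  swap
  · rw [abs_zero]; positivity
  have hsum : ∀ s, (if σ k s.1 = true then (ev ((B k).choose.run (z k)) fun u =>
      if visible (sndBits u) s then 0 else 1) else 0) ≠ ∞ := fun s => by
    split_ifs
    · exact hv s
    · simp
  have h := ENNReal.toReal_mono (ENNReal.add_ne_top.2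
    ⟨hprice, ENNReal.sum_ne_top.2 fun s _ => hsum s⟩) (badProb_le (B k) (σ k) (z k))
  rw [ENNReal.toReal_add hprice (ENNReal.sum_ne_top.2 fun s _ => hsum s),
    ENNReal.toReal_sum fun s _ => hsum s] at h
  rw [abs_of_nonneg ENNReal.toReal_nonneg]
  refine h.trans_eq (congrArg _ (Finset.sum_congr rfl fun s _ => ?_))
  by_cases hs : σ k s.1 = true <;> simp [hs, hk]

end Request

/-- For a semi-honest receiver, the keys of the items outside its choice set may be erased. -/
theorem negligible_erase_keys {Aux Out : ℕ → Type} [∀ k, Finite (Aux k)]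
    {B : ∀ k, Simulator (fun _ : Parts p => 1) (E k).keyLen (Aux k ⊕ (Fin n × Fin (E k).ctLen))
      (Out k)} (hp : ∀ i, 1 ≤ p i) {σ : ℕ → Bits (Fin n)} (z : ∀ k, Bits (Aux k))
    (hbad : ∀ zc : ∀ k, Bits (Aux k ⊕ (Fin n × Fin (E k).ctLen)), Negligible fun k =>
      if 0 < (E k).keyLen then (badProb (B k) (σ k) (zc k)).toReal else 0)
    (D : ∀ k, Kernel (Fin (total p) ⊕ Out k) Unit) (m : ∀ k, Bits (Fin n × Fin (E k).msgLen)) :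
    Negligible fun k => |acceptProb (hybridRun (E k) (B k) (z k) (m k)) (D k) -
      acceptProb (maskedKeysCts (E k) (σ k) (m k))
        (testKernel (B k) (z k) (D k) fun _ => true)| := by
  obtain ⟨s, hs, hle⟩ := Negligible.exists_uniform
    (I := fun k => Bits (Fin n × Fin (E k).ctLen)) (h := fun k c =>
      if 0 < (E k).keyLen then (badProb (B k) (σ k) (pair (z k) c)).toReal else 0)
    fun c => hbad fun k => pair (z k) (c k)
  refine hs.mono fun k => ?_
  have h0 : 0 ≤ s k := le_trans (by positivity) (hle k fun _ => false)
  rw [abs_abs, acceptProb_eq, acceptProb_eq, ev_hybridRun_eq_testKernel, maskedKeysCts, ev_map]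
  refine abs_ev_sub_le_const _ h0 (fun w => acc_le_one _ _) (fun w => acc_le_one _ _) fun w => ?_
  by_cases hk : 0 < (E k).keyLen
  · refine (abs_testKernel_mask_le (B k) hp (σ k) (z k) (D k) w).trans ?_
    simpa [hk] using hle k (sndBits w)
  -- Keys of length zero have nothing to erase, so `badProb` need not be small in this case.
  · have : maskKeys (σ k) (fstBits w) = fstBits w := funext fun a => absurd a.2.pos hk
    rw [this, pair_eta, sub_self, abs_zero]
    exact h0

/-- Both real runs are compared with their hybrids, in which the keys outside `σ` are then erased;
the two message vectors agree wherever a key is left. -/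
theorem semiHonestSenderPrivacy_keySplit (hp : ∀ i, 1 ≤ p i) (hE : SecureEnc E)
    {ot : ∀ k, Protocol (Parts p) (fun _ => 1) (E k).keyLen} (hot : IsWeightedOT ot) :
    SemiHonestSenderPrivacy fun k => keySplitProtocol p (E k) (ot k) := by
  intro Aux _ A σ hA hσ z m m' hm
  obtain ⟨B, hB, hind⟩ := hot.senderPrivacy (fun k => Aux k ⊕ (Fin n × Fin (E k).ctLen))
    (fun k => (A k).toOT) hA.toOT
  choose f hf using fun k => (hσ k).toOT
  have hbad := fun zc => negligible_badProb hot.correct hot.efficient.rOut hf zc (hind zc)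
  refine (compIndist_hybridRun hind z m).trans (CompIndist.trans (fun D hD => ?_)
    (compIndist_hybridRun hind z m').symm)
  have key := compIndist_maskedKeysCts hE (J := σ) (M := m) (M' := m')
    (fun k i hi b => (hm k i hi b).symm) _ (ppt_testKernel hE hB z hD fun _ _ => true)
  refine (((negligible_erase_keys hp z hbad D m).add key).add
    (negligible_erase_keys hp z hbad D m')).mono fun k => ?_
  rw [abs_abs]
  refine (abs_sub_le _ (acceptProb (maskedKeysCts (E k) (σ k) (m' k))
    (testKernel (B k) (z k) (D k) fun _ => true)) _).trans (add_le_add ?_ (abs_sub_comm _ _).le)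
  exact abs_sub_le _ _ _

end SemiHonestPrivacy

end WOT

end

theorem theorem1 {n : ℕ} (p : Fin n → ℕ) (hp : ∀ i, 1 ≤ p i)
    (E : ℕ → WOT.SymEnc) (hE : WOT.SecureEnc E)
    (ot : ∀ k, WOT.Protocol (WOT.Parts p) (fun _ => 1) (E k).keyLen)
    (hot : WOT.IsWeightedOT ot) :
    WOT.IsWeightedOT (fun k => WOT.keySplitProtocol p (E k) (ot k)) ∧
    WOT.SemiHonestSenderPrivacy (fun k => WOT.keySplitProtocol p (E k) (ot k)) ∧
    (WOT.UnconditionalReceiverPrivacy ot →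
      WOT.UnconditionalReceiverPrivacy (fun k => WOT.keySplitProtocol p (E k) (ot k))) :=
  ⟨⟨WOT.efficient_keySplit hE hot.efficient, WOT.correct_keySplit hp hE hot.correct,
      WOT.receiverPrivacy_keySplit hot.receiverPrivacy,
      WOT.senderPrivacy_keySplit hE hot.senderPrivacy⟩,
    WOT.semiHonestSenderPrivacy_keySplit hp hE hot,
    fun h => WOT.unconditionalReceiverPrivacy_keySplit h⟩
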